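/- Let $\bar{\mathfrak g}$ be a finite-dimensional complex simple Lie algebra with simple roots $\alpha$, Cartan matrix $(a_{\alpha\beta})$, $a_{\alpha\beta}=2(\alpha,\beta)/(\alpha,\alpha)$, and symmetrizing factors $d_\alpha$ (positive integers with $d_\alpha a_{\alpha\beta}=d_\beta a_{\beta\alpha}$). Put $(\alpha,\beta)=d_\alpha a_{\alpha\beta}$, let $q$ be a nonzero complex number, and put $q_\alpha=q^{d_\alpha}$. Let $U_q\tilde{\mathfrak b}_+$ be the algebra with generators $e_\alpha[n]$ ($n\in\mathbb Z$), $K^+_\alpha[n]$ ($n\ge 0$), $K^+_\alpha[0]^{-1}$ and, for the series $e_\alpha(z)=\sum_{n\in\mathbb Z} e_\alpha[n]z^{-n}$, $K^+_\alpha(z)=\sum_{n\ge 0}K^+_\alpha[n]z^{-n}$, the relations $$(q^{(\alpha,\beta)}z-w)\,e_\alpha(z)e_\beta(w)=(z-q^{(\alpha,\beta)}w)\,e_\beta(w)e_\alpha(z),\qquad [K^+_\alpha[n],K^+_\beta[m]]=0,$$ $$K^+_\alpha(z)e_\beta(w)K^+_\alpha(z)^{-1}=\frac{z-q^{(\alpha,\beta)}w}{q^{(\alpha,\beta)}z-w}\,e_\beta(w)\quad(\text{expanded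 for } w\ll z),$$ with coproduct (valued in a completed tensor square) $\Delta_+(K^+_\alpha(z))=K^+_\alpha(z)\otimes K^+_\alpha(z)$, $\Delta_+(e_\alpha(z))=e_\alpha(z)\otimes K^+_\alpha(z)+1\otimes e_\alpha(z)$. Let $U_q\tilde{\mathfrak b}_-$ be the algebra with generators $f_\alpha[n]$ ($n\in\mathbb Z$), $K^-_\alpha[n]$ ($n\le 0$), $K^-_\alpha[0]^{-1}$ and, for $f_\alpha(z)=\sum_{n\in\mathbb Z} f_\alpha[n]z^{-n}$, $K^-_\alpha(z)=\sum_{n\ge 0}K^-_\alpha[-n]z^{n}$, the relations $$(q^{-(\alpha,\beta)}z-w)\,f_\alpha(z)f_\beta(w)=(z-q^{-(\alpha,\beta)}w)\,f_\beta(w)f_\alpha(z),\qquad [K^-_\alpha[n],K^-_\beta[m]]=0,$$ $$K^-_\alpha(z)f_\beta(w)K^-_\alpha(z)^{-1}=\frac{z-q^{(\alpha,\beta)}w}{q^{(\alpha,\beta)}z-w}\,f_\beta(w)\quad(\text{expanded for } z\ll w),$$ with coproduct $\Delta_-(K^-_\alpha(z))=K^-_\alpha(z)\otimes K^-_\alpha(z)$,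 $\Delta_-(f_\alpha(z))=f_\alpha(z)\otimes 1+K^-_\alpha(z)^{-1}\otimes f_\alpha(z)$, and let $\Delta_-'$ be the coproduct opposite to $\Delta_-$. The counits $\varepsilon$ send $e_\alpha(z),f_\alpha(z)$ to $0$ and $K^\pm_\alpha(z)$ to $1$. Then there is a unique bilinear form $\langle\cdot,\cdot\rangle: U_q\tilde{\mathfrak b}_+\times U_q\tilde{\mathfrak b}_-\to\mathbb C$ which is a Hopf pairing between $(U_q\tilde{\mathfrak b}_+,\Delta_+)$ and $(U_q\tilde{\mathfrak b}_-,\Delta_-')$, that is $$\langle x,yy'\rangle=\langle\Delta_+(x),y\otimes y'\rangle,\quad \langle xx',y\rangle=\langle x\otimes x',\Delta_-'(y)\rangle,\quad \langle x,1\rangle=\varepsilon(x),\quad \langle 1,y\rangle=\varepsilon(y)$$ (only finitely many terms of the infinite sums $\Delta_+(x)$, $\Delta_-'(y)$ contribute), and which satisfies $$\langle K^+_\alpha(z),K^-_\beta(w)\rangle=\frac{z-q^{(\alpha,\beta)}w}{q^{(\alpha,\beta)}z-w}\ (\text{expanded for } w\ll z),\qquad \langle e_\alpha[n],f_\beta[m]\rangle=\delta_{\alpha\beta}\delta_{n+m,0},$$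 and $\langle K^+_\alpha(z),f_\beta(w)\rangle=\langle e_\alpha(z),K^-_\beta(w)\rangle=0$. Moreover, the two-sided ideal of $U_q\tilde{\mathfrak b}_+$ generated by all the coefficients of the quantum Serre expressions $$\sum_{r=0}^{N}(-1)^r\begin{bmatrix}N\\ r\end{bmatrix}_{q_\alpha}\sum_{\sigma\in S_N} e_\alpha(z_{\sigma(1)})\cdots e_\alpha(z_{\sigma(r)})\,e_\beta(w)\,e_\alpha(z_{\sigma(r+1)})\cdots e_\alpha(z_{\sigma(N)}),\qquad N=1-a_{\alpha\beta},\ \alpha\ne\beta,$$ is contained in the radical $\{x:\langle x,y\rangle=0\ \forall y\}$, and the two-sided ideal of $U_q\tilde{\mathfrak b}_-$ generated by the same expressions with $e$ replaced by $f$ is contained in the radical $\{y:\langle x,y\rangle=0\ \forall x\}$. Here the symmetric quantum binomial coefficients (built from $[n]_q=(q^n-q^{-n})/(q-q^{-1})$) are regarded as Laurent polynomials in $q$. -/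

import Mathlib

open scoped TensorProduct PowerSeries

noncomputable section

namespace QuantumCurrents

/-! ### Parameters -/

/-- The numerical data entering the new realization: an integral matrix `a` (in the theorem, the
Cartan matrix), positive integers `d` symmetrizing it, and a nonzero complex number `q`. -/
structure Datum (I : Type*) where
  a : I → I → ℤ
  d : I → ℕ
  d_pos : ∀ α, 0 < d α
  symm : ∀ α β, (d α : ℤ) * a α β = (d β : ℤ) * a β α
  q : ℂ
  q_ne_zero : q ≠ 0

namespace Datum

variable {I : Type*} (D : Datum I)

/-- The scalar product of simple roots `(α, β) = d_α a_{αβ}`. -/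
def form (α β : I) : ℤ := (D.d α : ℤ) * D.a α β

/-- `q^{(α, β)}`. -/
def t (α β : I) : ℂ := D.q ^ D.form α β

/-- `q_α = q^{d_α}`. -/
def qs (α : I) : ℂ := D.q ^ D.d α

theorem t_ne_zero (α β : I) : D.t α β ≠ 0 := zpow_ne_zero _ D.q_ne_zero

theorem t_symm (α β : I) : D.t α β = D.t β α := by
  unfold t form; rw [D.symm]

end Datum

/-! ### Quantum binomial coefficients -/

/-- The symmetric quantum integer `[n]_q = (q^n - q^{-n}) / (q - q^{-1})`. -/
def qInt (q : ℂ) (n : ℕ) : ℂ := (q ^ n - q⁻¹ ^ n) / (q - q⁻¹)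

/-- The symmetric quantum factorial `[1]_q [2]_q ⋯ [n]_q`. -/
def qFact (q : ℂ) (n : ℕ) : ℂ := ∏ i ∈ Finset.range n, qInt q (i + 1)

/-- The symmetric quantum binomial coefficient, as a Laurent polynomial evaluated at `q`
(so that it makes sense also when `q` is a root of unity); see `qBinom_mul_qFact`. -/
def qBinom (q : ℂ) : ℕ → ℕ → ℂ
  | _, 0 => 1
  | 0, _ + 1 => 0
  | n + 1, k + 1 => q ^ (k + 1) * qBinom q n (k + 1) + q⁻¹ ^ (n - k) * qBinom q n k

theorem qBinom_eq_zero (q : ℂ) : ∀ n k : ℕ, n < k → qBinom q n k = 0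
  | _, 0, h => by omega
  | 0, k + 1, _ => by simp [qBinom]
  | n + 1, k + 1, h => by
    rw [qBinom, qBinom_eq_zero q n (k + 1) (by omega), qBinom_eq_zero q n k (by omega)]; simp

/-- `[n choose k]_q [k]_q! [n-k]_q! = [n]_q!`. -/
theorem qBinom_mul_qFact (q : ℂ) (hq : q ≠ 0) (hq2 : q ^ 2 ≠ 1) :
    ∀ k j : ℕ, qBinom q (k + j) k * (qFact q k * qFact q j) = qFact q (k + j) := by
  have hz : q - q⁻¹ ≠ 0 := by
    intro h
    apply hq2
    have := sub_eq_zero.1 h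
    field_simp at this
    exact this
  have hsucc : ∀ n, qFact q (n + 1) = qFact q n * qInt q (n + 1) := fun n => by
    simp [qFact, Finset.prod_range_succ]
  have key : ∀ n k j : ℕ, k + j = n →
      qBinom q n k * (qFact q k * qFact q j) = qFact q n := by
    intro n
    induction n with
    | zero =>
      intro k j h
      obtain ⟨rfl, rfl⟩ : k = 0 ∧ j = 0 := by omega
      simp [qBinom, qFact]
    | succ n ih =>
      intro k j h
      rcases k with _ | k
      · obtain rfl : j = n + 1 := by omega
        simp [qBinom, qFact]
      · have hk : n - k = j := by omega
        have h2 := ih k j (by omega)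
        have hq1 : qInt q (n + 1) =
            q ^ (k + 1) * qInt q j + q⁻¹ ^ j * qInt q (k + 1) := by
          obtain rfl : n = k + j := by omega
          unfold qInt
          field_simp
          ring
        rw [qBinom, hk, hsucc n, hsucc k, hq1]
        rcases j with _ | j
        · rw [qBinom_eq_zero q n (k + 1) (by omega)]
          have : qInt q 0 = 0 := by simp [qInt]
          rw [this, ← h2]
          ring
        · have h1 := ih (k + 1) j (by omega)
          rw [hsucc k] at h1
          rw [hsucc j] at h2 ⊢
          linear_combination (q ^ (k + 1) * qInt q (j + 1)) * h1
            + (q⁻¹ ^ (j + 1) * qInt q (k + 1)) * h2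
  intro k j
  exact key _ k j rfl

/-! ### Expansions of the structure function -/

/-- The expansion of `(z - t w) / (t z - w)` for `w << z`, as a power series in `X = w / z`. -/
def kernelPlus (t : ℂ) : ℂ⟦X⟧ :=
  (1 - PowerSeries.C t * PowerSeries.X) * (PowerSeries.C t - PowerSeries.X)⁻¹

/-- The expansion of `(z - t w) / (t z - w)` for `z << w`, as a power series in `X = z / w`. -/
def kernelMinus (t : ℂ) : ℂ⟦X⟧ :=
  (PowerSeries.X - PowerSeries.C t) * (PowerSeries.C t * PowerSeries.X - 1)⁻¹

theorem kernelPlus_spec {t : ℂ} (ht : t ≠ 0) :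
    (PowerSeries.C t - PowerSeries.X) * kernelPlus t = 1 - PowerSeries.C t * PowerSeries.X := by
  unfold kernelPlus
  rw [mul_left_comm, PowerSeries.mul_inv_cancel, mul_one]
  simpa using ht

theorem kernelMinus_spec {t : ℂ} (ht : t ≠ 0) :
    (PowerSeries.C t⁻¹ - PowerSeries.X) * kernelMinus t =
      1 - PowerSeries.C t⁻¹ * PowerSeries.X := by
  unfold kernelMinus
  have h1 : (PowerSeries.C t * PowerSeries.X - 1 : ℂ⟦X⟧) *
      (PowerSeries.C t * PowerSeries.X - 1)⁻¹ = 1 := by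
    apply PowerSeries.mul_inv_cancel
    simp
  have h2 : (PowerSeries.C t⁻¹ : ℂ⟦X⟧) * PowerSeries.C t = 1 := by
    rw [← map_mul, inv_mul_cancel₀ ht, map_one]
  linear_combination (-PowerSeries.C t⁻¹ * PowerSeries.X + 1) * h1 +
    ((PowerSeries.X ^ 2 - 1) * (PowerSeries.C t * PowerSeries.X - 1 : ℂ⟦X⟧)⁻¹) * h2

/-! ### Auxiliary facts: relations written with power series

These facts are only used to see that the coproducts below are well defined. -/

section Aux

set_option linter.unusedSectionVars false

variable {I : Type*} {T : Type*} [Ring T] [Algebra ℂ T]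

/-- `(t z - w) M(z) e(w) = (z - t w) e(w) M(z)` with `M(z) = ∑ M_n z^{-n}`, written in `X = 1/z`. -/
def AuxMR (t : ℂ) (M : T⟦X⟧) (e : ℤ → T) : Prop :=
  ∀ m : ℤ, t • (M * PowerSeries.C (e m)) - PowerSeries.X * (M * PowerSeries.C (e (m + 1))) =
    PowerSeries.C (e m) * M - t • (PowerSeries.X * (PowerSeries.C (e (m + 1)) * M))

/-- The vertex relation in components. -/
def AuxVR (t : ℂ) (e e' : ℤ → T) : Prop :=
  ∀ n m : ℤ, t • (e (n + 1) * e' m) - e n * e' (m + 1) =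
    e' m * e (n + 1) - t • (e' (m + 1) * e n)

theorem AuxMR.zero {t : ℂ} {M : T⟦X⟧} {e : ℤ → T} (h : AuxMR t M e) (m : ℤ) :
    t • (PowerSeries.coeff 0 M * e m) = e m * PowerSeries.coeff 0 M := by
  have := congrArg (PowerSeries.coeff 0) (h m)
  simpa using this

theorem AuxMR.succ {t : ℂ} {M : T⟦X⟧} {e : ℤ → T} (h : AuxMR t M e) (n : ℕ) (m : ℤ) :
    t • (PowerSeries.coeff (n + 1) M * e m) - PowerSeries.coeff n M * e (m + 1) =
      e m * PowerSeries.coeff (n + 1) M - t • (e (m + 1) * PowerSeries.coeff n M) := by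
  have := congrArg (PowerSeries.coeff (n + 1)) (h m)
  simpa [PowerSeries.coeff_succ_X_mul] using this

theorem AuxMR.mk {t : ℂ} {M : T⟦X⟧} {e : ℤ → T}
    (h0 : ∀ m, t • (PowerSeries.coeff 0 M * e m) = e m * PowerSeries.coeff 0 M)
    (h1 : ∀ (n : ℕ) (m : ℤ),
      t • (PowerSeries.coeff (n + 1) M * e m) - PowerSeries.coeff n M * e (m + 1) =
        e m * PowerSeries.coeff (n + 1) M - t • (e (m + 1) * PowerSeries.coeff n M)) :
    AuxMR t M e := by
  intro m
  ext n
  rcases n with _ | n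
  · simpa using h0 m
  · simpa [PowerSeries.coeff_succ_X_mul] using h1 n m

/-- The expanded form of the relation gives the polynomial form. -/
theorem AuxMR.of_expanded {t : ℂ} {g : ℂ⟦X⟧} {M : ℕ → T} {e : ℤ → T}
    (hg : (PowerSeries.C t - PowerSeries.X) * g = 1 - PowerSeries.C t * PowerSeries.X)
    (h : ∀ (n : ℕ) (m : ℤ), M n * e m =
      ∑ k ∈ Finset.range (n + 1), PowerSeries.coeff k g • (e (m + k) * M (n - k))) :
    AuxMR t (PowerSeries.mk M) e := by
  have g0 : t * PowerSeries.coeff 0 g = 1 := by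
    have := congrArg (PowerSeries.coeff 0) hg
    simpa [sub_mul] using this
  have g1 : t * PowerSeries.coeff 1 g - PowerSeries.coeff 0 g = -t := by
    have := congrArg (PowerSeries.coeff 1) hg
    simpa [sub_mul, PowerSeries.coeff_one_X, PowerSeries.coeff_succ_X_mul, PowerSeries.coeff_one]
      using this
  have g2 : ∀ k, t * PowerSeries.coeff (k + 2) g - PowerSeries.coeff (k + 1) g = 0 := by
    intro k
    have := congrArg (PowerSeries.coeff (k + 2)) hg
    simpa [sub_mul, PowerSeries.coeff_X, PowerSeries.coeff_succ_X_mul, PowerSeries.coeff_one]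
      using this
  apply AuxMR.mk
  · intro m
    simp only [PowerSeries.coeff_mk]
    rw [h 0 m]
    simp only [zero_add, Finset.sum_range_one, smul_smul, g0]
    simp
  · intro n m
    simp only [PowerSeries.coeff_mk]
    rw [h (n + 1) m, h n (m + 1), Finset.sum_range_succ', smul_add, Finset.smul_sum, add_sub_right_comm,
      ← Finset.sum_sub_distrib]
    simp only [smul_smul, g0]
    have : ∀ k ∈ Finset.range (n + 1),
        (t * PowerSeries.coeff (k + 1) g) • (e (m + ((k + 1 : ℕ) : ℤ)) * M (n + 1 - (k + 1))) -
          PowerSeries.coeff k g • (e (m + 1 + (k : ℤ)) * M (n - k)) =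
        if k = 0 then -(t • (e (m + 1) * M n)) else 0 := by
      intro k _
      have e1 : m + ((k + 1 : ℕ) : ℤ) = m + 1 + (k : ℤ) := by push_cast; ring
      rw [e1, Nat.add_sub_add_right, ← sub_smul]
      rcases k with _ | k
      · rw [g1]; simp
      · rw [g2]; simp
    rw [Finset.sum_congr rfl this]
    simp [sub_eq_add_neg, add_comm]

/-- The polynomial form of the relation gives the expanded form. -/
theorem AuxMR.expanded {t : ℂ} {g : ℂ⟦X⟧} {M : T⟦X⟧} {e : ℤ → T} (ht : t ≠ 0)
    (hg : (PowerSeries.C t - PowerSeries.X) * g = 1 - PowerSeries.C t * PowerSeries.X)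
    (h : AuxMR t M e) (n : ℕ) : ∀ m : ℤ, PowerSeries.coeff n M * e m =
      ∑ k ∈ Finset.range (n + 1),
        PowerSeries.coeff k g • (e (m + k) * PowerSeries.coeff (n - k) M) := by
  have g0 : t * PowerSeries.coeff 0 g = 1 := by
    have := congrArg (PowerSeries.coeff 0) hg
    simpa [sub_mul] using this
  have g1 : t * PowerSeries.coeff 1 g - PowerSeries.coeff 0 g = -t := by
    have := congrArg (PowerSeries.coeff 1) hg
    simpa [sub_mul, PowerSeries.coeff_one_X, PowerSeries.coeff_succ_X_mul, PowerSeries.coeff_one]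
      using this
  have g2 : ∀ k, t * PowerSeries.coeff (k + 2) g - PowerSeries.coeff (k + 1) g = 0 := by
    intro k
    have := congrArg (PowerSeries.coeff (k + 2)) hg
    simpa [sub_mul, PowerSeries.coeff_X, PowerSeries.coeff_succ_X_mul, PowerSeries.coeff_one]
      using this
  have hinj : ∀ x y : T, t • x = t • y → x = y := fun x y hxy => by
    simpa [smul_smul, inv_mul_cancel₀ ht] using congrArg (fun z => t⁻¹ • z) hxy
  induction n with
  | zero =>
    intro m
    apply hinj
    rw [h.zero]
    simp only [zero_add, Finset.sum_range_one, smul_smul, g0]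
    simp
  | succ n ih =>
    intro m
    apply hinj
    rw [sub_eq_iff_eq_add.1 (h.succ n m), ih (m + 1), Finset.sum_range_succ' _ (n + 1), smul_add,
      Finset.smul_sum]
    simp only [smul_smul, g0]
    have : ∀ k ∈ Finset.range (n + 1),
        (t * PowerSeries.coeff (k + 1) g) •
            (e (m + ((k + 1 : ℕ) : ℤ)) * PowerSeries.coeff (n + 1 - (k + 1)) M) =
          PowerSeries.coeff k g • (e (m + 1 + (k : ℤ)) * PowerSeries.coeff (n - k) M) +
        if k = 0 then -(t • (e (m + 1) * PowerSeries.coeff n M)) else 0 := by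
      intro k _
      have e1 : m + ((k + 1 : ℕ) : ℤ) = m + 1 + (k : ℤ) := by push_cast; ring
      rw [e1, Nat.add_sub_add_right, ← sub_eq_iff_eq_add', ← sub_smul]
      rcases k with _ | k
      · rw [g1]; simp
      · rw [g2]; simp
    rw [Finset.sum_congr rfl this, Finset.sum_add_distrib]
    simp only [sub_eq_add_neg, Finset.sum_ite_eq', Finset.mem_range]
    simp [add_comm, add_left_comm, add_assoc]

/-- Passing to inverse series. -/
theorem AuxMR.inverse {t : ℂ} (ht : t ≠ 0) {M L : T⟦X⟧} {e : ℤ → T} (hML : M * L = 1)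
    (hLM : L * M = 1) (h : AuxMR t⁻¹ M e) : AuxMR t L e := by
  intro m
  have h1 := h m
  have h2 := congrArg (fun z => t • (L * z * L)) h1
  simp only [mul_sub, sub_mul, smul_sub, mul_smul_comm, smul_mul_assoc, smul_smul,
    mul_inv_cancel₀ ht, one_smul] at h2
  have hX : ∀ z : T⟦X⟧, L * (PowerSeries.X * z) = PowerSeries.X * (L * z) := fun z => by
    rw [← mul_assoc, ← mul_assoc, PowerSeries.commute_X L]
  simp only [hX] at h2
  have a1 : ∀ c : T⟦X⟧, L * (M * c) * L = c * L := fun c => by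
    rw [← mul_assoc, hLM, one_mul]
  have a2 : ∀ c : T⟦X⟧, L * (c * M) * L = L * c := fun c => by
    rw [mul_assoc, mul_assoc, hML, mul_one]
  simp only [mul_assoc PowerSeries.X, a1, a2] at h2
  rw [sub_eq_sub_iff_add_eq_add] at h2 ⊢
  rw [h2.symm, add_comm]

theorem AuxVR.neg {t : ℂ} (ht : t ≠ 0) {e e' : ℤ → T} (h : AuxVR t⁻¹ e e') :
    AuxVR t (fun n => e (-n)) (fun n => e' (-n)) := by
  intro n m
  have h1 := congrArg (fun z => t • z) (h (-(n + 1)) (-(m + 1)))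
  have i1 : -(n + 1) + 1 = -n := by ring
  have i2 : -(m + 1) + 1 = -m := by ring
  simp only [i1, i2, smul_sub, smul_smul, mul_inv_cancel₀ ht, one_smul] at h1
  linear_combination (norm := module) -h1

theorem AuxVR.map {S : Type*} [Ring S] [Algebra ℂ S] (f : T →ₐ[ℂ] S) {t : ℂ} {e e' : ℤ → T}
    (h : AuxVR t e e') : AuxVR t (fun n => f (e n)) (fun n => f (e' n)) := by
  intro n m
  simpa using congrArg f (h n m)

theorem AuxMR.map {S : Type*} [Ring S] [Algebra ℂ S] (f : T →ₐ[ℂ] S) {t : ℂ} {M : T⟦X⟧}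
    {e : ℤ → T} (h : AuxMR t M e) :
    AuxMR t (PowerSeries.map (f : T →+* S) M) (fun n => f (e n)) := by
  apply AuxMR.mk
  · intro m
    simpa using congrArg f (h.zero m)
  · intro n m
    simpa using congrArg f (h.succ n m)

theorem auxTensor_comm {A B : Type*} [Ring A] [Algebra ℂ A] [Ring B] [Algebra ℂ B]
    (a : A) (b : B) : Commute (Algebra.TensorProduct.includeLeft (R := ℂ) (S := ℂ) (B := B) a)
      (Algebra.TensorProduct.includeRight (R := ℂ) (A := A) b) := by
  simp [Commute, SemiconjBy]

end Aux
section AuxCoproduct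

set_option linter.unusedSectionVars false

open HahnSeries (single ofPowerSeries single_mul_single)

variable {I : Type*} {T : Type*} [Ring T] [Algebra ℂ T]

theorem single_finset_sum {ι : Type*} (s : Finset ι) (n : ℤ) (f : ι → T) :
    single n (∑ i ∈ s, f i) = ∑ i ∈ s, single n (f i) :=
  map_sum (HahnSeries.single.addMonoidHom n) f s

theorem smul_single' (n : ℤ) (t : ℂ) (x : T) : t • single n x = single n (t • x) := by
  ext k
  by_cases h : k = n
  · subst h; simp
  · simp [HahnSeries.coeff_single_of_ne h]

/-- `∑_{k ≥ 0} e₁[n - k] M₂[k] τ^k + e₂[n] τ^n`. -/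
def auxE (e₁ : ℤ → T) (M₂ : T⟦X⟧) (n : ℤ) : HahnSeries ℤ T :=
  ofPowerSeries ℤ T (PowerSeries.mk fun k => e₁ (n - k) * PowerSeries.coeff k M₂)

/-- `∑_n (∑_{i + j = n} M₁[i] M₂[j] τ^j) X^n`. -/
def auxM (M₁ M₂ : T⟦X⟧) : (HahnSeries ℤ T)⟦X⟧ :=
  PowerSeries.mk fun n => ∑ p ∈ Finset.HasAntidiagonal.antidiagonal n,
    single (p.2 : ℤ) (PowerSeries.coeff p.1 M₁ * PowerSeries.coeff p.2 M₂)

def auxP (M₁ : T⟦X⟧) : (HahnSeries ℤ T)⟦X⟧ :=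
  PowerSeries.mk fun n => single 0 (PowerSeries.coeff n M₁)

def auxQ (M₂ : T⟦X⟧) : (HahnSeries ℤ T)⟦X⟧ :=
  PowerSeries.mk fun n => single (n : ℤ) (PowerSeries.coeff n M₂)

theorem auxM_eq (M₁ M₂ : T⟦X⟧) : auxM M₁ M₂ = auxP M₁ * auxQ M₂ := by
  ext1 n
  simp [auxM, auxP, auxQ, PowerSeries.coeff_mul]

theorem auxP_mul (M N : T⟦X⟧) : auxP (M * N) = auxP M * auxP N := by
  ext1 n
  simp [auxP, PowerSeries.coeff_mul, single_finset_sum]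

theorem auxQ_mul (M N : T⟦X⟧) : auxQ (M * N) = auxQ M * auxQ N := by
  ext1 n
  simp only [auxQ, PowerSeries.coeff_mul, PowerSeries.coeff_mk, single_mul_single, single_finset_sum]
  refine Finset.sum_congr rfl fun p hp => ?_
  rw [← Finset.HasAntidiagonal.mem_antidiagonal.1 hp]
  push_cast
  rfl

theorem auxP_one : auxP (1 : T⟦X⟧) = 1 := by
  ext1 n
  simp only [auxP, PowerSeries.coeff_mk, PowerSeries.coeff_one]
  split_ifs <;> simp

theorem auxQ_one : auxQ (1 : T⟦X⟧) = 1 := by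
  ext1 n
  simp only [auxQ, PowerSeries.coeff_mk, PowerSeries.coeff_one]
  split_ifs with h <;> simp [h]

theorem auxP_auxQ_comm {M₁ M₂ : T⟦X⟧}
    (h : ∀ i j, Commute (PowerSeries.coeff i M₁) (PowerSeries.coeff j M₂)) :
    auxQ M₂ * auxP M₁ = auxP M₁ * auxQ M₂ := by
  ext1 n
  simp only [auxP, auxQ, PowerSeries.coeff_mul, PowerSeries.coeff_mk, single_mul_single, zero_add,
    add_zero]
  rw [← Finset.Nat.sum_antidiagonal_swap]
  exact Finset.sum_congr rfl fun p _ => by rw [Prod.fst_swap, Prod.snd_swap, (h _ _).eq]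

theorem auxM_mul {M₁ M₂ N₁ N₂ : T⟦X⟧}
    (h : ∀ i j, Commute (PowerSeries.coeff i N₁) (PowerSeries.coeff j M₂)) :
    auxM M₁ M₂ * auxM N₁ N₂ = auxM (M₁ * N₁) (M₂ * N₂) := by
  rw [auxM_eq, auxM_eq, auxM_eq, auxP_mul, auxQ_mul, mul_assoc, ← mul_assoc (auxQ M₂),
    auxP_auxQ_comm h]
  simp only [mul_assoc]

theorem auxM_one : auxM (1 : T⟦X⟧) 1 = 1 := by
  rw [auxM_eq, auxP_one, auxQ_one, one_mul]

theorem ofPS_coeff_neg (p : T⟦X⟧) (k : ℤ) (hk : k < 0) : (ofPowerSeries ℤ T p).coeff k = 0 := by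
  rw [HahnSeries.ofPowerSeries_apply]
  apply HahnSeries.embDomain_of_notMem_range
  rintro ⟨i, hi⟩
  have : (i : ℤ) = k := hi
  omega

theorem auxE_coeff_nat (e₁ : ℤ → T) (M₂ : T⟦X⟧) (n : ℤ) (k : ℕ) :
    (auxE e₁ M₂ n).coeff k = e₁ (n - k) * PowerSeries.coeff k M₂ := by
  rw [auxE, HahnSeries.ofPowerSeries_apply_coeff, PowerSeries.coeff_mk]

theorem auxE_coeff_neg (e₁ : ℤ → T) (M₂ : T⟦X⟧) (n k : ℤ) (hk : k < 0) :
    (auxE e₁ M₂ n).coeff k = 0 := ofPS_coeff_neg _ k hk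

/-- The vertex relation for the coproducts of `e` and `e'`. -/
theorem auxVR {t : ℂ} {e₁ e₂ e₁' e₂' : ℤ → T} {M₂ M₂' : T⟦X⟧}
    (h₁ : AuxVR t e₁ e₁') (h₂ : AuxVR t e₂ e₂')
    (hM : AuxMR t M₂ e₂') (hM' : AuxMR t M₂' e₂)
    (c1 : ∀ n m, Commute (e₁ n) (e₂' m)) (c2 : ∀ n m, Commute (e₁' n) (e₂ m))
    (c3 : ∀ n j, Commute (e₁ n) (PowerSeries.coeff j M₂'))
    (c4 : ∀ n j, Commute (e₁' n) (PowerSeries.coeff j M₂))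
    (cM : ∀ i j, Commute (PowerSeries.coeff i M₂) (PowerSeries.coeff j M₂')) :
    AuxVR t (fun n => auxE e₁ M₂ n + single n (e₂ n))
      (fun n => auxE e₁' M₂' n + single n (e₂' n)) := by
  intro n m
  have hEE : t • (auxE e₁ M₂ (n + 1) * auxE e₁' M₂' m) - auxE e₁ M₂ n * auxE e₁' M₂' (m + 1) =
      auxE e₁' M₂' m * auxE e₁ M₂ (n + 1) - t • (auxE e₁' M₂' (m + 1) * auxE e₁ M₂ n) := by
    simp only [auxE, ← map_mul]
    ext k
    rcases lt_or_ge k 0 with hk | hk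
    · simp only [HahnSeries.coeff_sub, HahnSeries.coeff_smul, ofPS_coeff_neg _ k hk, smul_zero]
    · lift k to ℕ using hk
      simp only [HahnSeries.coeff_sub, HahnSeries.coeff_smul, HahnSeries.ofPowerSeries_apply_coeff,
        PowerSeries.coeff_mul, PowerSeries.coeff_mk]
      rw [← Finset.Nat.sum_antidiagonal_swap (n := k) (f := fun p =>
          e₁' (m - p.1) * PowerSeries.coeff p.1 M₂' * _),
        ← Finset.Nat.sum_antidiagonal_swap (n := k) (f := fun p =>
          e₁' (m + 1 - p.1) * PowerSeries.coeff p.1 M₂' * _)]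
      simp only [Finset.smul_sum, ← Finset.sum_sub_distrib, Prod.fst_swap, Prod.snd_swap]
      refine Finset.sum_congr rfl fun p _ => ?_
      have a1 : ∀ x y, e₁ x * PowerSeries.coeff p.1 M₂ * (e₁' y * PowerSeries.coeff p.2 M₂') =
          e₁ x * e₁' y * (PowerSeries.coeff p.1 M₂ * PowerSeries.coeff p.2 M₂') := fun x y =>
        (c4 y p.1).symm.mul_mul_mul_comm _ _
      have a2 : ∀ x y, e₁' y * PowerSeries.coeff p.2 M₂' * (e₁ x * PowerSeries.coeff p.1 M₂) =
          e₁' y * e₁ x * (PowerSeries.coeff p.1 M₂ * PowerSeries.coeff p.2 M₂') := fun x y => by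
        rw [(c3 x p.2).symm.mul_mul_mul_comm, (cM p.1 p.2).eq]
      simp only [a1, a2]
      have h := h₁ (n - p.1) (m - p.2)
      have i1 : n - (p.1 : ℤ) + 1 = n + 1 - p.1 := by ring
      have i2 : m - (p.2 : ℤ) + 1 = m + 1 - p.2 := by ring
      rw [i1, i2] at h
      have h' := congrArg (· * (PowerSeries.coeff p.1 M₂ * PowerSeries.coeff p.2 M₂')) h
      simpa only [sub_mul, smul_mul_assoc] using h'
  have hSS : t • (single (n + 1) (e₂ (n + 1)) * single m (e₂' m)) -
      single n (e₂ n) * single (m + 1) (e₂' (m + 1)) =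
      single m (e₂' m) * single (n + 1) (e₂ (n + 1)) -
        t • (single (m + 1) (e₂' (m + 1)) * single n (e₂ n)) := by
    simp only [single_mul_single]
    have i1 : n + (m + 1) = n + 1 + m := by ring
    have i2 : m + (n + 1) = n + 1 + m := by ring
    have i3 : m + 1 + n = n + 1 + m := by ring
    rw [i1, i2, i3]
    have := congrArg (single (n + 1 + m)) (h₂ n m)
    simpa [smul_single'] using this
  have hES : t • (auxE e₁ M₂ (n + 1) * single m (e₂' m)) -
      auxE e₁ M₂ n * single (m + 1) (e₂' (m + 1)) =
      single m (e₂' m) * auxE e₁ M₂ (n + 1) -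
        t • (single (m + 1) (e₂' (m + 1)) * auxE e₁ M₂ n) := by
    ext k
    simp only [HahnSeries.coeff_sub, HahnSeries.coeff_smul, HahnSeries.coeff_mul_single,
      HahnSeries.coeff_single_mul]
    obtain ⟨j, rfl⟩ : ∃ j, k = j + m := ⟨k - m, by ring⟩
    have i1 : j + m - m = j := by ring
    have i2 : j + m - (m + 1) = j - 1 := by ring
    rw [i1, i2]
    rcases lt_trichotomy j 0 with hj | hj | hj
    · simp [auxE_coeff_neg _ _ _ j hj, auxE_coeff_neg _ _ _ (j - 1) (by omega)]
    · subst hj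
      rw [auxE_coeff_neg _ _ n (0 - 1) (by omega)]
      have := auxE_coeff_nat e₁ M₂ (n + 1) 0
      rw [Nat.cast_zero] at this
      rw [this, mul_assoc, ← mul_smul_comm, hM.zero, ← mul_assoc, ← mul_assoc, (c1 _ _).eq]
      simp
    · obtain ⟨i, rfl⟩ : ∃ i : ℕ, j = ((i + 1 : ℕ) : ℤ) := ⟨(j - 1).toNat, by omega⟩
      have i3 : ((i + 1 : ℕ) : ℤ) - 1 = (i : ℤ) := by push_cast; ring
      rw [i3, auxE_coeff_nat, auxE_coeff_nat]
      have i4 : n + 1 - ((i + 1 : ℕ) : ℤ) = n - i := by push_cast; ring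
      rw [i4, mul_assoc, mul_assoc, ← mul_assoc (e₂' m), ← mul_assoc (e₂' (m + 1)),
        ← (c1 (n - i) m).eq, ← (c1 (n - i) (m + 1)).eq, mul_assoc (e₁ _) (e₂' m),
        mul_assoc (e₁ _) (e₂' (m + 1))]
      have h' := congrArg (e₁ (n - i) * ·) (hM.succ i m)
      simpa only [mul_sub, mul_smul_comm] using h'
  have hSE : t • (single (n + 1) (e₂ (n + 1)) * auxE e₁' M₂' m) -
      single n (e₂ n) * auxE e₁' M₂' (m + 1) =
      auxE e₁' M₂' m * single (n + 1) (e₂ (n + 1)) -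
        t • (auxE e₁' M₂' (m + 1) * single n (e₂ n)) := by
    ext k
    simp only [HahnSeries.coeff_sub, HahnSeries.coeff_smul, HahnSeries.coeff_mul_single,
      HahnSeries.coeff_single_mul]
    obtain ⟨j, rfl⟩ : ∃ j, k = j + n := ⟨k - n, by ring⟩
    have i1 : j + n - n = j := by ring
    have i2 : j + n - (n + 1) = j - 1 := by ring
    rw [i1, i2]
    rcases lt_trichotomy j 0 with hj | hj | hj
    · simp [auxE_coeff_neg _ _ _ j hj, auxE_coeff_neg _ _ _ (j - 1) (by omega)]
    · subst hj
      rw [auxE_coeff_neg _ _ m (0 - 1) (by omega)]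
      have := auxE_coeff_nat e₁' M₂' (m + 1) 0
      rw [Nat.cast_zero] at this
      rw [this, ← mul_assoc, ← (c2 _ _).eq, mul_assoc, ← hM'.zero, mul_assoc]
      simp
    · obtain ⟨i, rfl⟩ : ∃ i : ℕ, j = ((i + 1 : ℕ) : ℤ) := ⟨(j - 1).toNat, by omega⟩
      have i3 : ((i + 1 : ℕ) : ℤ) - 1 = (i : ℤ) := by push_cast; ring
      rw [i3, auxE_coeff_nat, auxE_coeff_nat]
      have i4 : m + 1 - ((i + 1 : ℕ) : ℤ) = m - i := by push_cast; ring
      rw [i4, ← mul_assoc, ← mul_assoc, ← (c2 (m - i) n).eq, ← (c2 (m - i) (n + 1)).eq,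
        mul_assoc, mul_assoc, mul_assoc, mul_assoc]
      have h' := congrArg (e₁' (m - i) * ·) (hM'.succ i n)
      simp only [mul_sub, mul_smul_comm] at h'
      rw [sub_eq_sub_iff_add_eq_add] at h' ⊢
      rw [add_comm, h', add_comm]
  simp only [add_mul, mul_add, smul_add]
  have := congrArg₂ (· + ·) (congrArg₂ (· + ·) hEE hSS) (congrArg₂ (· + ·) hES hSE)
  linear_combination (norm := module) this

/-- The Cartan-current relation for the coproducts. -/
theorem auxMR {t : ℂ} {e₁ e₂ : ℤ → T} {M₁ M₂ N₂ : T⟦X⟧}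
    (h₁ : AuxMR t M₁ e₁) (h₂ : AuxMR t M₂ e₂)
    (c1 : ∀ n j, Commute (e₁ n) (PowerSeries.coeff j M₂))
    (c2 : ∀ n j, Commute (e₂ n) (PowerSeries.coeff j M₁))
    (c4 : ∀ i j, Commute (PowerSeries.coeff i M₁) (PowerSeries.coeff j N₂))
    (cM : ∀ i j, Commute (PowerSeries.coeff i M₂) (PowerSeries.coeff j N₂)) :
    AuxMR t (auxM M₁ M₂) (fun n => auxE e₁ N₂ n + single n (e₂ n)) := by
  have hP : AuxMR t (auxP M₁) (auxE e₁ N₂) := by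
    apply AuxMR.mk
    · intro m
      ext k
      simp only [auxP, PowerSeries.coeff_mk, HahnSeries.coeff_smul, HahnSeries.coeff_single_zero_mul,
        HahnSeries.coeff_mul_single_zero]
      rcases lt_or_ge k 0 with hk | hk
      · simp [auxE_coeff_neg _ _ _ k hk]
      · lift k to ℕ using hk
        rw [auxE_coeff_nat, mul_assoc, ← (c4 _ _).eq, ← mul_assoc, ← mul_assoc, ← h₁.zero,
          smul_mul_assoc]
    · intro n m
      ext k
      simp only [auxP, PowerSeries.coeff_mk, HahnSeries.coeff_smul, HahnSeries.coeff_single_zero_mul,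
        HahnSeries.coeff_mul_single_zero, HahnSeries.coeff_sub]
      rcases lt_or_ge k 0 with hk | hk
      · simp [auxE_coeff_neg _ _ _ k hk]
      · lift k to ℕ using hk
        have h' := congrArg (· * PowerSeries.coeff k N₂) (h₁.succ n (m - k))
        have i1 : m - (k : ℤ) + 1 = m + 1 - k := by ring
        simp only [i1, sub_mul, smul_mul_assoc] at h'
        rw [auxE_coeff_nat, auxE_coeff_nat, mul_assoc (e₁ _), ← (c4 _ _).eq, mul_assoc (e₁ _),
          ← (c4 _ _).eq]
        simpa only [mul_assoc] using h'
  have hQ : AuxMR t (auxQ M₂) (fun n => single n (e₂ n)) := by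
    apply AuxMR.mk
    · intro m
      simp only [auxQ, PowerSeries.coeff_mk, single_mul_single, smul_single', h₂.zero]
      rw [add_comm]
    · intro n m
      simp only [auxQ, PowerSeries.coeff_mk, single_mul_single, smul_single']
      have i1 : (n : ℤ) + (m + 1) = ((n + 1 : ℕ) : ℤ) + m := by push_cast; ring
      have i2 : m + ((n + 1 : ℕ) : ℤ) = ((n + 1 : ℕ) : ℤ) + m := by push_cast; ring
      have i3 : m + 1 + (n : ℤ) = ((n + 1 : ℕ) : ℤ) + m := by push_cast; ring
      rw [i1, i2, i3, ← HahnSeries.single_sub, ← HahnSeries.single_sub, h₂.succ]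
  have hPS : ∀ m, Commute (auxP M₁) (PowerSeries.C (single m (e₂ m))) := by
    intro m
    ext1 n
    simp only [auxP, PowerSeries.coeff_mul_C, PowerSeries.coeff_C_mul, PowerSeries.coeff_mk,
      single_mul_single, zero_add, add_zero, (c2 _ _).eq]
  have hQE : ∀ m, Commute (auxQ M₂) (PowerSeries.C (auxE e₁ N₂ m)) := by
    intro m
    ext1 n
    simp only [auxQ, PowerSeries.coeff_mul_C, PowerSeries.coeff_C_mul, PowerSeries.coeff_mk]
    ext k
    rw [HahnSeries.coeff_mul_single, HahnSeries.coeff_single_mul]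
    rcases lt_or_ge (k - n) 0 with hk | hk
    · simp [auxE_coeff_neg _ _ _ _ hk]
    · obtain ⟨i, hi⟩ : ∃ i : ℕ, k - n = i := ⟨(k - n).toNat, by omega⟩
      rw [hi, auxE_coeff_nat, mul_assoc, ← (cM _ _).eq, ← mul_assoc, ← mul_assoc, (c1 _ _).eq]
  have hPX : ∀ z, auxP M₁ * (PowerSeries.X * z) = PowerSeries.X * (auxP M₁ * z) := fun z => by
    rw [← mul_assoc, ← mul_assoc, PowerSeries.commute_X]
  intro m
  have hA := congrArg (· * auxQ M₂) (hP m)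
  have hB := congrArg (auxP M₁ * ·) (hQ m)
  simp only [sub_mul, smul_mul_assoc, mul_assoc, mul_sub, mul_smul_comm, hPX] at hA hB
  simp only [← (hQE _).eq] at hA
  simp only [map_add, mul_add, add_mul, smul_add, auxM_eq, mul_assoc]
  simp only [← mul_assoc (PowerSeries.C (single _ (e₂ _))) (auxP M₁) (auxQ M₂), ← (hPS _).eq]
  simp only [mul_assoc]
  linear_combination (norm := module) hA + hB

end AuxCoproduct
variable {I : Type*} (D : Datum I)

/-! ### The algebra `U_q b̃₊` -/

/-- Generators of `U_q b̃₊`: `e_α[n]` for `n ∈ ℤ`, `K⁺_α[n]` for `n ≥ 0`, and `K⁺_α[0]⁻¹`. -/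
inductive GenPlus (I : Type*)
  | e (α : I) (n : ℤ)
  | K (α : I) (n : ℕ)
  | Kinv (α : I)

namespace Plus

/-- The generator `e_α[n]` in the free algebra. -/
def fe (α : I) (n : ℤ) : FreeAlgebra ℂ (GenPlus I) := FreeAlgebra.ι ℂ (GenPlus.e α n)

/-- The generator `K⁺_α[n]` in the free algebra. -/
def fK (α : I) (n : ℕ) : FreeAlgebra ℂ (GenPlus I) := FreeAlgebra.ι ℂ (GenPlus.K α n)

/-- The generator `K⁺_α[0]⁻¹` in the free algebra. -/
def fKinv (α : I) : FreeAlgebra ℂ (GenPlus I) := FreeAlgebra.ι ℂ (GenPlus.Kinv α)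

/-- The defining relations of `U_q b̃₊`, in components, for `e_α(z) = ∑_n e_α[n] z^{-n}` and
`K⁺_α(z) = ∑_{n ≥ 0} K⁺_α[n] z^{-n}`.
* `vertex`: the coefficient of `z^{-n} w^{-m}` in
  `(q^{(α,β)} z - w) e_α(z) e_β(w) = (z - q^{(α,β)} w) e_β(w) e_α(z)`;
* `K_e`: the coefficient of `z^{-n} w^{-m}` in
  `K⁺_α(z) e_β(w) = ((z - q^{(α,β)} w) / (q^{(α,β)} z - w)) e_β(w) K⁺_α(z)`, the fraction being
  expanded for `w << z`.
No Serre relation is imposed. -/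
inductive Rel : FreeAlgebra ℂ (GenPlus I) → FreeAlgebra ℂ (GenPlus I) → Prop
  | vertex (α β : I) (n m : ℤ) :
      Rel (D.t α β • (fe α (n + 1) * fe β m) - fe α n * fe β (m + 1))
        (fe β m * fe α (n + 1) - D.t α β • (fe β (m + 1) * fe α n))
  | K_K (α β : I) (n m : ℕ) : Rel (fK α n * fK β m) (fK β m * fK α n)
  | K_Kinv (α : I) : Rel (fK α 0 * fKinv α) 1
  | Kinv_K (α : I) : Rel (fKinv α * fK α 0) 1
  | K_e (α β : I) (n : ℕ) (m : ℤ) :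
      Rel (fK α n * fe β m)
        (∑ k ∈ Finset.range (n + 1), PowerSeries.coeff k (kernelPlus (D.t α β)) •
          (fe β (m + k) * fK α (n - k)))

end Plus

/-- The algebra `U_q b̃₊`. -/
def UPlus : Type _ := RingQuot (Plus.Rel D)

instance : Ring (UPlus D) := inferInstanceAs (Ring (RingQuot (Plus.Rel D)))

instance : Algebra ℂ (UPlus D) := inferInstanceAs (Algebra ℂ (RingQuot (Plus.Rel D)))

namespace Plus

/-- The projection from the free algebra. -/
def proj : FreeAlgebra ℂ (GenPlus I) →ₐ[ℂ] UPlus D := RingQuot.mkAlgHom ℂ (Rel D)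

/-- `e_α[n] ∈ U_q b̃₊`. -/
def e (α : I) (n : ℤ) : UPlus D := proj D (fe α n)

/-- `K⁺_α[n] ∈ U_q b̃₊`, `n ≥ 0`. -/
def K (α : I) (n : ℕ) : UPlus D := proj D (fK α n)

/-- `K⁺_α[0]⁻¹ ∈ U_q b̃₊`. -/
def Kinv (α : I) : UPlus D := proj D (fKinv α)

theorem proj_rel {x y : FreeAlgebra ℂ (GenPlus I)} (h : Rel D x y) : proj D x = proj D y :=
  RingQuot.mkAlgHom_rel ℂ h

theorem vertex (α β : I) : AuxVR (D.t α β) (e D α) (e D β) := fun n m => by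
  simpa [e] using proj_rel D (Rel.vertex α β n m)

theorem K_K (α β : I) (n m : ℕ) : K D α n * K D β m = K D β m * K D α n := by
  simpa [K] using proj_rel D (Rel.K_K α β n m)

theorem K_Kinv (α : I) : K D α 0 * Kinv D α = 1 := by
  simpa [K, Kinv] using proj_rel D (Rel.K_Kinv α)

theorem Kinv_K (α : I) : Kinv D α * K D α 0 = 1 := by
  simpa [K, Kinv] using proj_rel D (Rel.Kinv_K α)

theorem K_e (α β : I) (n : ℕ) (m : ℤ) : K D α n * e D β m =
    ∑ k ∈ Finset.range (n + 1), PowerSeries.coeff k (kernelPlus (D.t α β)) •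
      (e D β (m + k) * K D α (n - k)) := by
  simpa [K, e, map_sum] using proj_rel D (Rel.K_e α β n m)

theorem K_e_series (α β : I) : AuxMR (D.t α β) (PowerSeries.mk (K D α)) (e D β) :=
  AuxMR.of_expanded (kernelPlus_spec (D.t_ne_zero α β)) (K_e D α β)

/-- Algebra morphisms out of `U_q b̃₊`. -/
def lift {S : Type*} [Ring S] [Algebra ℂ S] (xe : I → ℤ → S) (xK : I → ℕ → S) (xKinv : I → S)
    (h1 : ∀ α β, AuxVR (D.t α β) (xe α) (xe β))
    (h2 : ∀ α β n m, xK α n * xK β m = xK β m * xK α n)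
    (h3 : ∀ α, xK α 0 * xKinv α = 1) (h4 : ∀ α, xKinv α * xK α 0 = 1)
    (h5 : ∀ α β, AuxMR (D.t α β) (PowerSeries.mk (xK α)) (xe β)) : UPlus D →ₐ[ℂ] S :=
  RingQuot.liftAlgHom ℂ ⟨FreeAlgebra.lift ℂ (fun g => match g with
    | GenPlus.e α n => xe α n
    | GenPlus.K α n => xK α n
    | GenPlus.Kinv α => xKinv α), by
      intro x y h
      induction h with
      | vertex α β n m => simpa [fe] using h1 α β n m
      | K_K α β n m => simpa [fK] using h2 α β n m
      | K_Kinv α => simpa [fK, fKinv] using h3 α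
      | Kinv_K α => simpa [fK, fKinv] using h4 α
      | K_e α β n m =>
        have := (h5 α β).expanded (D.t_ne_zero α β) (kernelPlus_spec (D.t_ne_zero α β)) n m
        simpa [fK, fe, map_sum] using this⟩

/-- The counit of `U_q b̃₊`: `e_α[n] ↦ 0`, `K⁺_α(z) ↦ 1`. -/
def counit : UPlus D →ₐ[ℂ] ℂ :=
  lift D (fun _ _ => 0) (fun _ n => if n = 0 then 1 else 0) (fun _ => 1)
    (fun _ _ n m => by simp) (fun _ _ _ _ => mul_comm _ _) (by simp) (by simp)
    (fun _ _ m => by simp)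

/-- The coefficient `Δ₊(e_α[n]) = ∑_{k ≥ 0} e_α[n - k] ⊗ K⁺_α[k] + 1 ⊗ e_α[n]` of
`Δ₊(e_α(z)) = e_α(z) ⊗ K⁺_α(z) + 1 ⊗ e_α(z)`, the powers of `τ` being those explained at
`coproduct`. -/
def coproductE (α : I) (n : ℤ) : HahnSeries ℤ (UPlus D ⊗[ℂ] UPlus D) :=
  HahnSeries.ofPowerSeries ℤ (UPlus D ⊗[ℂ] UPlus D)
      (PowerSeries.mk fun k => e D α (n - k) ⊗ₜ[ℂ] K D α k) +
    HahnSeries.single n (1 ⊗ₜ[ℂ] e D α n)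

/-- The coefficient `Δ₊(K⁺_α[n]) = ∑_{i + j = n} K⁺_α[i] ⊗ K⁺_α[j]` of
`Δ₊(K⁺_α(z)) = K⁺_α(z) ⊗ K⁺_α(z)`, the powers of `τ` being those explained at `coproduct`. -/
def coproductK (α : I) (n : ℕ) : HahnSeries ℤ (UPlus D ⊗[ℂ] UPlus D) :=
  ∑ p ∈ Finset.HasAntidiagonal.antidiagonal n,
    HahnSeries.single (p.2 : ℤ) (K D α p.1 ⊗ₜ[ℂ] K D α p.2)

def inL : UPlus D →ₐ[ℂ] UPlus D ⊗[ℂ] UPlus D := Algebra.TensorProduct.includeLeft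

def inR : UPlus D →ₐ[ℂ] UPlus D ⊗[ℂ] UPlus D := Algebra.TensorProduct.includeRight

theorem inL_apply (x : UPlus D) : inL D x = x ⊗ₜ[ℂ] 1 := rfl

theorem inR_apply (x : UPlus D) : inR D x = 1 ⊗ₜ[ℂ] x := rfl

theorem inL_inR (x y : UPlus D) : Commute (inL D x) (inR D y) := auxTensor_comm x y

theorem coproductE_eq (α : I) : coproductE D α = fun n =>
    auxE (fun j => inL D (e D α j))
      (PowerSeries.map (inR D : UPlus D →+* UPlus D ⊗[ℂ] UPlus D) (PowerSeries.mk (K D α))) n +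
    HahnSeries.single n (inR D (e D α n)) := by
  funext n
  simp [coproductE, auxE, inL_apply, inR_apply]

theorem coproductK_eq (α : I) : PowerSeries.mk (coproductK D α) =
    auxM (PowerSeries.map (inL D : UPlus D →+* UPlus D ⊗[ℂ] UPlus D) (PowerSeries.mk (K D α)))
      (PowerSeries.map (inR D : UPlus D →+* UPlus D ⊗[ℂ] UPlus D) (PowerSeries.mk (K D α))) := by
  ext1 n
  simp [auxM, coproductK, inL_apply, inR_apply]

theorem coproductE_vertex (α β : I) : AuxVR (D.t α β) (coproductE D α) (coproductE D β) := by
  rw [coproductE_eq, coproductE_eq]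
  refine auxVR ((vertex D α β).map (inL D)) ((vertex D α β).map (inR D))
    ((K_e_series D α β).map (inR D)) (D.t_symm α β ▸ (K_e_series D β α).map (inR D)) ?_ ?_ ?_ ?_ ?_
  · exact fun _ _ => inL_inR D _ _
  · exact fun _ _ => inL_inR D _ _
  · intro _ _
    rw [PowerSeries.coeff_map]
    exact inL_inR D _ _
  · intro _ _
    rw [PowerSeries.coeff_map]
    exact inL_inR D _ _
  · intro i j
    rw [PowerSeries.coeff_map, PowerSeries.coeff_map, PowerSeries.coeff_mk, PowerSeries.coeff_mk]
    exact (show Commute _ _ from K_K D α β i j).map (inR D)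

theorem coproductK_comm (α β : I) (n m : ℕ) :
    coproductK D α n * coproductK D β m = coproductK D β m * coproductK D α n :=
  Commute.eq <| Commute.sum_left _ _ _ fun p _ => Commute.sum_right _ _ _ fun r _ => by
    simp only [Commute, SemiconjBy, HahnSeries.single_mul_single,
      Algebra.TensorProduct.tmul_mul_tmul]
    rw [K_K D α β p.1 r.1, K_K D α β p.2 r.2, add_comm]

theorem coproductK_e (α β : I) :
    AuxMR (D.t α β) (PowerSeries.mk (coproductK D α)) (coproductE D β) := by
  rw [coproductE_eq, coproductK_eq]
  refine auxMR ((K_e_series D α β).map (inL D)) ((K_e_series D α β).map (inR D)) ?_ ?_ ?_ ?_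
  · intro _ _
    rw [PowerSeries.coeff_map]
    exact inL_inR D _ _
  · intro _ _
    rw [PowerSeries.coeff_map]
    exact (inL_inR D _ _).symm
  · intro _ _
    rw [PowerSeries.coeff_map, PowerSeries.coeff_map]
    exact inL_inR D _ _
  · intro i j
    rw [PowerSeries.coeff_map, PowerSeries.coeff_map, PowerSeries.coeff_mk, PowerSeries.coeff_mk]
    exact (show Commute _ _ from K_K D α β i j).map (inR D)

/-- The coproduct `Δ₊` of `U_q b̃₊`. It takes its values in a completed tensor square: an
(infinite) sum `∑_k x_k`, where the right factors of `x_k` have degree `k` for the grading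
`deg e_α[n] = deg K⁺_α[n] = n` and `x_k = 0` for `k << 0`, is encoded as the Laurent series
`∑_k x_k τ^k` with coefficients in `U_q b̃₊ ⊗ U_q b̃₊`. Thus the definition reads
`Δ₊(e_α(z)) = e_α(z) ⊗ K⁺_α(z) + 1 ⊗ e_α(z)`, `Δ₊(K⁺_α(z)) = K⁺_α(z) ⊗ K⁺_α(z)`. -/
def coproduct : UPlus D →ₐ[ℂ] HahnSeries ℤ (UPlus D ⊗[ℂ] UPlus D) :=
  lift D (coproductE D) (coproductK D)
    (fun α => HahnSeries.single 0 (Kinv D α ⊗ₜ[ℂ] Kinv D α))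
    (coproductE_vertex D) (coproductK_comm D)
    (fun α => by
      simp [coproductK, HahnSeries.single_mul_single, K_Kinv, ← Algebra.TensorProduct.one_def])
    (fun α => by
      simp [coproductK, HahnSeries.single_mul_single, Kinv_K, ← Algebra.TensorProduct.one_def])
    (coproductK_e D)

theorem coproduct_e (α : I) (n : ℤ) : coproduct D (e D α n) = coproductE D α n := by
  unfold coproduct lift e proj fe
  erw [RingQuot.liftAlgHom_mkAlgHom_apply]
  simp

theorem coproduct_K (α : I) (n : ℕ) : coproduct D (K D α n) = coproductK D α n := by
  unfold coproduct lift K proj fK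
  erw [RingQuot.liftAlgHom_mkAlgHom_apply]
  simp

theorem coproduct_Kinv (α : I) :
    coproduct D (Kinv D α) = HahnSeries.single 0 (Kinv D α ⊗ₜ[ℂ] Kinv D α) := by
  unfold coproduct lift
  rw [Kinv, proj, fKinv]
  erw [RingQuot.liftAlgHom_mkAlgHom_apply]
  simp
  rfl

end Plus

/-! ### The algebra `U_q b̃₋` -/

/-- Generators of `U_q b̃₋`: `f_α[n]` for `n ∈ ℤ`, `K⁻_α[-n]` for `n ≥ 0` (written `K α n`), and
`K⁻_α[0]⁻¹`. -/
inductive GenMinus (I : Type*)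
  | f (α : I) (n : ℤ)
  | K (α : I) (n : ℕ)
  | Kinv (α : I)

namespace Minus

/-- The generator `f_α[n]` in the free algebra. -/
def ff (α : I) (n : ℤ) : FreeAlgebra ℂ (GenMinus I) := FreeAlgebra.ι ℂ (GenMinus.f α n)

/-- The generator `K⁻_α[-n]` in the free algebra. -/
def fK (α : I) (n : ℕ) : FreeAlgebra ℂ (GenMinus I) := FreeAlgebra.ι ℂ (GenMinus.K α n)

/-- The generator `K⁻_α[0]⁻¹` in the free algebra. -/
def fKinv (α : I) : FreeAlgebra ℂ (GenMinus I) := FreeAlgebra.ι ℂ (GenMinus.Kinv α)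

/-- The defining relations of `U_q b̃₋`, in components, for `f_α(z) = ∑_n f_α[n] z^{-n}` and
`K⁻_α(z) = ∑_{n ≥ 0} K⁻_α[-n] z^n`.
* `vertex`: the coefficient of `z^{-n} w^{-m}` in
  `(q^{-(α,β)} z - w) f_α(z) f_β(w) = (z - q^{-(α,β)} w) f_β(w) f_α(z)`;
* `K_f`: the coefficient of `z^n w^{-m}` in
  `K⁻_α(z) f_β(w) = ((z - q^{(α,β)} w) / (q^{(α,β)} z - w)) f_β(w) K⁻_α(z)`, the fraction being
  expanded for `z << w`.
No Serre relation is imposed. -/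
inductive Rel : FreeAlgebra ℂ (GenMinus I) → FreeAlgebra ℂ (GenMinus I) → Prop
  | vertex (α β : I) (n m : ℤ) :
      Rel ((D.t α β)⁻¹ • (ff α (n + 1) * ff β m) - ff α n * ff β (m + 1))
        (ff β m * ff α (n + 1) - (D.t α β)⁻¹ • (ff β (m + 1) * ff α n))
  | K_K (α β : I) (n m : ℕ) : Rel (fK α n * fK β m) (fK β m * fK α n)
  | K_Kinv (α : I) : Rel (fK α 0 * fKinv α) 1
  | Kinv_K (α : I) : Rel (fKinv α * fK α 0) 1
  | K_f (α β : I) (n : ℕ) (m : ℤ) :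
      Rel (fK α n * ff β m)
        (∑ k ∈ Finset.range (n + 1), PowerSeries.coeff k (kernelMinus (D.t α β)) •
          (ff β (m - k) * fK α (n - k)))

end Minus

/-- The algebra `U_q b̃₋`. -/
def UMinus : Type _ := RingQuot (Minus.Rel D)

instance : Ring (UMinus D) := inferInstanceAs (Ring (RingQuot (Minus.Rel D)))

instance : Algebra ℂ (UMinus D) := inferInstanceAs (Algebra ℂ (RingQuot (Minus.Rel D)))

namespace Minus

/-- The projection from the free algebra. -/
def proj : FreeAlgebra ℂ (GenMinus I) →ₐ[ℂ] UMinus D := RingQuot.mkAlgHom ℂ (Rel D)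

/-- `f_α[n] ∈ U_q b̃₋`. -/
def f (α : I) (n : ℤ) : UMinus D := proj D (ff α n)

/-- `K⁻_α[-n] ∈ U_q b̃₋`, `n ≥ 0`. -/
def K (α : I) (n : ℕ) : UMinus D := proj D (fK α n)

/-- `K⁻_α[0]⁻¹ ∈ U_q b̃₋`. -/
def Kinv (α : I) : UMinus D := proj D (fKinv α)

theorem proj_rel {x y : FreeAlgebra ℂ (GenMinus I)} (h : Rel D x y) : proj D x = proj D y :=
  RingQuot.mkAlgHom_rel ℂ h

theorem vertex (α β : I) : AuxVR (D.t α β)⁻¹ (f D α) (f D β) := fun n m => by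
  simpa [f] using proj_rel D (Rel.vertex α β n m)

theorem K_K (α β : I) (n m : ℕ) : K D α n * K D β m = K D β m * K D α n := by
  simpa [K] using proj_rel D (Rel.K_K α β n m)

theorem K_Kinv (α : I) : K D α 0 * Kinv D α = 1 := by
  simpa [K, Kinv] using proj_rel D (Rel.K_Kinv α)

theorem Kinv_K (α : I) : Kinv D α * K D α 0 = 1 := by
  simpa [K, Kinv] using proj_rel D (Rel.Kinv_K α)

theorem K_f (α β : I) (n : ℕ) (m : ℤ) : K D α n * f D β m =
    ∑ k ∈ Finset.range (n + 1), PowerSeries.coeff k (kernelMinus (D.t α β)) •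
      (f D β (m - k) * K D α (n - k)) := by
  simpa [K, f, map_sum] using proj_rel D (Rel.K_f α β n m)

/-- `K⁻_α(z)`, as a power series in `z`. -/
def KSeries (α : I) : (UMinus D)⟦X⟧ := PowerSeries.mk (K D α)

/-- `K⁻_α(z)⁻¹`, as a power series in `z`. -/
def KSeriesInv (α : I) : (UMinus D)⟦X⟧ :=
  PowerSeries.invOfUnit (KSeries D α) ⟨K D α 0, Kinv D α, K_Kinv D α, Kinv_K D α⟩

theorem KSeries_mul_inv (α : I) : KSeries D α * KSeriesInv D α = 1 :=
  PowerSeries.mul_invOfUnit _ _ (by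
    rw [← PowerSeries.coeff_zero_eq_constantCoeff_apply, KSeries, PowerSeries.coeff_mk])

theorem KSeriesInv_mul (α : I) : KSeriesInv D α * KSeries D α = 1 :=
  PowerSeries.invOfUnit_mul _ _ (by
    rw [← PowerSeries.coeff_zero_eq_constantCoeff_apply, KSeries, PowerSeries.coeff_mk])

theorem K_f_series (α β : I) :
    AuxMR (D.t α β)⁻¹ (KSeries D α) (fun n => f D β (-n)) :=
  AuxMR.of_expanded (kernelMinus_spec (D.t_ne_zero α β)) (fun n m => by
    rw [K_f]
    refine Finset.sum_congr rfl fun k _ => ?_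
    rw [neg_add'])

theorem KInv_f_series (α β : I) :
    AuxMR (D.t α β) (KSeriesInv D α) (fun n => f D β (-n)) :=
  (K_f_series D α β).inverse (D.t_ne_zero α β) (KSeries_mul_inv D α) (KSeriesInv_mul D α)

theorem vertex_neg (α β : I) :
    AuxVR (D.t α β) (fun n => f D α (-n)) (fun n => f D β (-n)) :=
  (vertex D α β).neg (D.t_ne_zero α β)

/-- Algebra morphisms out of `U_q b̃₋`. -/
def lift {S : Type*} [Ring S] [Algebra ℂ S] (xf : I → ℤ → S) (xK : I → ℕ → S) (xKinv : I → S)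
    (h1 : ∀ α β, AuxVR (D.t α β)⁻¹ (xf α) (xf β))
    (h2 : ∀ α β n m, xK α n * xK β m = xK β m * xK α n)
    (h3 : ∀ α, xK α 0 * xKinv α = 1) (h4 : ∀ α, xKinv α * xK α 0 = 1)
    (h5 : ∀ α β, AuxMR (D.t α β)⁻¹ (PowerSeries.mk (xK α)) (fun n => xf β (-n))) :
    UMinus D →ₐ[ℂ] S :=
  RingQuot.liftAlgHom ℂ ⟨FreeAlgebra.lift ℂ (fun g => match g with
    | GenMinus.f α n => xf α n
    | GenMinus.K α n => xK α n
    | GenMinus.Kinv α => xKinv α), by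
      intro x y h
      induction h with
      | vertex α β n m => simpa [ff] using h1 α β n m
      | K_K α β n m => simpa [fK] using h2 α β n m
      | K_Kinv α => simpa [fK, fKinv] using h3 α
      | Kinv_K α => simpa [fK, fKinv] using h4 α
      | K_f α β n m =>
        have := (h5 α β).expanded (inv_ne_zero (D.t_ne_zero α β))
          (kernelMinus_spec (D.t_ne_zero α β)) n (-m)
        simpa [fK, ff, map_sum, sub_eq_add_neg, add_comm] using this⟩

/-- The counit of `U_q b̃₋`: `f_α[n] ↦ 0`, `K⁻_α(z) ↦ 1`. -/
def counit : UMinus D →ₐ[ℂ] ℂ :=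
  lift D (fun _ _ => 0) (fun _ n => if n = 0 then 1 else 0) (fun _ => 1)
    (fun _ _ n m => by simp) (fun _ _ _ _ => mul_comm _ _) (by simp) (by simp)
    (fun _ _ m => by simp)

theorem commute_KSeriesInv {x : UMinus D} {α : I} (h : ∀ i, Commute x (K D α i)) (i : ℕ) :
    Commute x (PowerSeries.coeff i (KSeriesInv D α)) := by
  have h1 : PowerSeries.C x * KSeries D α = KSeries D α * PowerSeries.C x := by
    ext1 n
    simpa [KSeries] using (h n).eq
  have h2 : PowerSeries.C x * KSeriesInv D α = KSeriesInv D α * PowerSeries.C x := by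
    calc PowerSeries.C x * KSeriesInv D α
        = KSeriesInv D α * (KSeries D α * PowerSeries.C x) * KSeriesInv D α := by
          rw [← mul_assoc, KSeriesInv_mul, one_mul]
      _ = KSeriesInv D α * PowerSeries.C x := by
          rw [← h1, mul_assoc, mul_assoc, KSeries_mul_inv, mul_one]
  have h3 := congrArg (PowerSeries.coeff i) h2
  simp only [PowerSeries.coeff_C_mul, PowerSeries.coeff_mul_C] at h3
  exact h3

theorem coeff_comm (α β : I) (i j : ℕ) :
    Commute (PowerSeries.coeff i (KSeriesInv D α)) (PowerSeries.coeff j (KSeriesInv D β)) :=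
  commute_KSeriesInv D (fun b => (commute_KSeriesInv D (fun a => K_K D β α b a) i).symm) j

def inL : UMinus D →ₐ[ℂ] UMinus D ⊗[ℂ] UMinus D := Algebra.TensorProduct.includeLeft

def inR : UMinus D →ₐ[ℂ] UMinus D ⊗[ℂ] UMinus D := Algebra.TensorProduct.includeRight

theorem inL_apply (x : UMinus D) : inL D x = x ⊗ₜ[ℂ] 1 := rfl

theorem inR_apply (x : UMinus D) : inR D x = 1 ⊗ₜ[ℂ] x := rfl

theorem inL_inR (x y : UMinus D) : Commute (inL D x) (inR D y) := auxTensor_comm x y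

/-- `Δ₋(f_α[-m])`, in the form used by the auxiliary facts. -/
def auxF (α : I) (m : ℤ) : HahnSeries ℤ (UMinus D ⊗[ℂ] UMinus D) :=
  auxE (fun j => inR D (f D α (-j)))
    (PowerSeries.map (inL D : UMinus D →+* UMinus D ⊗[ℂ] UMinus D) (KSeriesInv D α)) m +
      HahnSeries.single m (inL D (f D α (-m)))

/-- The coproduct of a series in the Cartan currents. -/
def auxK (M : (UMinus D)⟦X⟧) : (HahnSeries ℤ (UMinus D ⊗[ℂ] UMinus D))⟦X⟧ :=
  auxM (PowerSeries.map (inR D : UMinus D →+* UMinus D ⊗[ℂ] UMinus D) M)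
    (PowerSeries.map (inL D : UMinus D →+* UMinus D ⊗[ℂ] UMinus D) M)

theorem auxK_mul (M N : (UMinus D)⟦X⟧) : auxK D M * auxK D N = auxK D (M * N) := by
  unfold auxK
  rw [auxM_mul, map_mul, map_mul]
  intro _ _
  rw [PowerSeries.coeff_map, PowerSeries.coeff_map]
  exact (inL_inR D _ _).symm

theorem auxK_one : auxK D 1 = 1 := by
  unfold auxK
  rw [map_one, map_one, auxM_one]

/-- The coefficient `Δ₋(f_α[n]) = f_α[n] ⊗ 1 + ∑_{k ≥ 0} (K⁻_α)⁻¹[-k] ⊗ f_α[n + k]` of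
`Δ₋(f_α(z)) = f_α(z) ⊗ 1 + K⁻_α(z)⁻¹ ⊗ f_α(z)`, the powers of `τ` being those explained at
`coproduct`. -/
def coproductF (α : I) (n : ℤ) : HahnSeries ℤ (UMinus D ⊗[ℂ] UMinus D) :=
  HahnSeries.single (-n) (f D α n ⊗ₜ[ℂ] 1) +
    HahnSeries.ofPowerSeries ℤ (UMinus D ⊗[ℂ] UMinus D)
      (PowerSeries.mk fun k => PowerSeries.coeff k (KSeriesInv D α) ⊗ₜ[ℂ] f D α (n + k))

/-- The coefficient `Δ₋(K⁻_α[-n]) = ∑_{i + j = n} K⁻_α[-i] ⊗ K⁻_α[-j]` of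
`Δ₋(K⁻_α(z)) = K⁻_α(z) ⊗ K⁻_α(z)`, the powers of `τ` being those explained at `coproduct`. -/
def coproductK (α : I) (n : ℕ) : HahnSeries ℤ (UMinus D ⊗[ℂ] UMinus D) :=
  ∑ p ∈ Finset.HasAntidiagonal.antidiagonal n,
    HahnSeries.single (p.1 : ℤ) (K D α p.1 ⊗ₜ[ℂ] K D α p.2)

theorem coproductF_neg (α : I) : (fun n => coproductF D α (-n)) = auxF D α := by
  funext n
  simp only [coproductF, auxF, auxE, inL_apply, inR_apply, neg_neg]
  rw [add_comm]
  congr 2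
  ext1 k
  rw [PowerSeries.coeff_mk, PowerSeries.coeff_mk, PowerSeries.coeff_map, RingHom.coe_coe, inL_apply,
    Algebra.TensorProduct.tmul_mul_tmul, one_mul, mul_one]
  congr 2
  ring

theorem coproductK_eq (α : I) :
    PowerSeries.mk (coproductK D α) = auxK D (KSeries D α) := by
  ext1 n
  simp only [auxK, auxM, PowerSeries.coeff_mk, KSeries, coproductK]
  rw [← Finset.Nat.sum_antidiagonal_swap]
  simp [inL_apply, inR_apply]

theorem coproduct_vertex (α β : I) : AuxVR (D.t α β) (auxF D α) (auxF D β) := by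
  unfold auxF
  refine auxVR ((vertex_neg D α β).map (inR D)) ((vertex_neg D α β).map (inL D))
    ((KInv_f_series D α β).map (inL D))
    (D.t_symm α β ▸ (KInv_f_series D β α).map (inL D)) ?_ ?_ ?_ ?_ ?_
  · exact fun _ _ => (inL_inR D _ _).symm
  · exact fun _ _ => (inL_inR D _ _).symm
  · intro _ _
    rw [PowerSeries.coeff_map]
    exact (inL_inR D _ _).symm
  · intro _ _
    rw [PowerSeries.coeff_map]
    exact (inL_inR D _ _).symm
  · intro i j
    rw [PowerSeries.coeff_map, PowerSeries.coeff_map]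
    exact (coeff_comm D α β i j).map (inL D)

theorem coproduct_K_f (α β : I) :
    AuxMR (D.t α β)⁻¹ (auxK D (KSeries D α)) (auxF D β) := by
  have h : AuxMR (D.t α β) (auxK D (KSeriesInv D α)) (auxF D β) := by
    unfold auxF auxK
    refine auxMR ((KInv_f_series D α β).map (inR D)) ((KInv_f_series D α β).map (inL D))
      ?_ ?_ ?_ ?_
    · intro _ _
      rw [PowerSeries.coeff_map]
      exact (inL_inR D _ _).symm
    · intro _ _
      rw [PowerSeries.coeff_map]
      exact inL_inR D _ _
    · intro _ _
      rw [PowerSeries.coeff_map, PowerSeries.coeff_map]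
      exact (inL_inR D _ _).symm
    · intro i j
      rw [PowerSeries.coeff_map, PowerSeries.coeff_map]
      exact (coeff_comm D α β i j).map (inL D)
  refine AuxMR.inverse (inv_ne_zero (D.t_ne_zero α β)) ?_ ?_ (by rw [inv_inv]; exact h)
  · rw [auxK_mul, KSeriesInv_mul, auxK_one]
  · rw [auxK_mul, KSeries_mul_inv, auxK_one]

theorem coproductF_vertex (α β : I) : AuxVR (D.t α β)⁻¹ (coproductF D α) (coproductF D β) := by
  have h : AuxVR (D.t α β)⁻¹⁻¹ (auxF D α) (auxF D β) := by
    rw [inv_inv]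
    exact coproduct_vertex D α β
  have h' := h.neg (inv_ne_zero (D.t_ne_zero α β))
  simpa only [← coproductF_neg, neg_neg] using h'

theorem coproductK_comm (α β : I) (n m : ℕ) :
    coproductK D α n * coproductK D β m = coproductK D β m * coproductK D α n :=
  Commute.eq <| Commute.sum_left _ _ _ fun p _ => Commute.sum_right _ _ _ fun r _ => by
    simp only [Commute, SemiconjBy, HahnSeries.single_mul_single,
      Algebra.TensorProduct.tmul_mul_tmul]
    rw [K_K D α β p.1 r.1, K_K D α β p.2 r.2, add_comm]

theorem coproductK_f (α β : I) : AuxMR (D.t α β)⁻¹ (PowerSeries.mk (coproductK D α))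
    (fun n => coproductF D β (-n)) := by
  rw [coproductF_neg, coproductK_eq]
  exact coproduct_K_f D α β

/-- The coproduct `Δ₋` of `U_q b̃₋`. It takes its values in a completed tensor square: an
(infinite) sum `∑_k x_k`, where the left factors of `x_k` have degree `-k` for the grading
`deg f_α[n] = deg K⁻_α[n] = n` and `x_k = 0` for `k << 0`, is encoded as the Laurent series
`∑_k x_k τ^k` with coefficients in `U_q b̃₋ ⊗ U_q b̃₋`. Thus the definition reads
`Δ₋(f_α(z)) = f_α(z) ⊗ 1 + K⁻_α(z)⁻¹ ⊗ f_α(z)`, `Δ₋(K⁻_α(z)) = K⁻_α(z) ⊗ K⁻_α(z)`. -/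
def coproduct : UMinus D →ₐ[ℂ] HahnSeries ℤ (UMinus D ⊗[ℂ] UMinus D) :=
  lift D (coproductF D) (coproductK D)
    (fun α => HahnSeries.single 0 (Kinv D α ⊗ₜ[ℂ] Kinv D α))
    (coproductF_vertex D) (coproductK_comm D)
    (fun α => by
      simp [coproductK, HahnSeries.single_mul_single, K_Kinv, ← Algebra.TensorProduct.one_def])
    (fun α => by
      simp [coproductK, HahnSeries.single_mul_single, Kinv_K, ← Algebra.TensorProduct.one_def])
    (coproductK_f D)

theorem coproduct_f (α : I) (n : ℤ) : coproduct D (f D α n) = coproductF D α n := by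
  unfold coproduct lift f proj ff
  erw [RingQuot.liftAlgHom_mkAlgHom_apply]
  simp

theorem coproduct_K (α : I) (n : ℕ) : coproduct D (K D α n) = coproductK D α n := by
  unfold coproduct lift K proj fK
  erw [RingQuot.liftAlgHom_mkAlgHom_apply]
  simp

theorem coproduct_Kinv (α : I) :
    coproduct D (Kinv D α) = HahnSeries.single 0 (Kinv D α ⊗ₜ[ℂ] Kinv D α) := by
  unfold coproduct lift
  rw [Kinv, proj, fKinv]
  erw [RingQuot.liftAlgHom_mkAlgHom_apply]
  simp
  rfl

/-- The opposite coproduct `Δ₋'`, obtained from `Δ₋` by exchanging the tensor factors. -/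
def coproductOp (y : UMinus D) : HahnSeries ℤ (UMinus D ⊗[ℂ] UMinus D) :=
  (coproduct D y).map (TensorProduct.comm ℂ (UMinus D) (UMinus D))

end Minus

/-! ### Hopf pairings -/

/-- The bilinear form `⟨x ⊗ x', y ⊗ y'⟩ = ⟨x, y⟩ ⟨x', y'⟩` on the algebraic tensor squares. -/
def tensorPairing (φ : UPlus D →ₗ[ℂ] UMinus D →ₗ[ℂ] ℂ) :
    (UPlus D ⊗[ℂ] UPlus D) →ₗ[ℂ] (UMinus D ⊗[ℂ] UMinus D) →ₗ[ℂ] ℂ :=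
  TensorProduct.dualDistrib ℂ (UMinus D) (UMinus D) ∘ₗ TensorProduct.map φ φ

variable {D} in
theorem tensorPairing_tmul (φ : UPlus D →ₗ[ℂ] UMinus D →ₗ[ℂ] ℂ) (x x' : UPlus D)
    (y y' : UMinus D) :
    tensorPairing D φ (x ⊗ₜ[ℂ] x') (y ⊗ₜ[ℂ] y') = φ x y * φ x' y' := by
  simp [tensorPairing]

variable {D} in
/-- `φ` is a Hopf pairing between `(U_q b̃₊, Δ₊)` and `(U_q b̃₋, Δ₋')`, where `Δ₋'` is the coproduct
opposite to `Δ₋`: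
`⟨x, y y'⟩ = ⟨Δ₊(x), y ⊗ y'⟩`, `⟨x x', y⟩ = ⟨x ⊗ x', Δ₋'(y)⟩`, `⟨x, 1⟩ = ε(x)`, `⟨1, y⟩ = ε(y)`.
The coproducts are infinite sums; part of the condition is that only finitely many of their terms
pair nontrivially with given elements, so that the right-hand sides make sense. -/
structure IsHopfPairing (φ : UPlus D →ₗ[ℂ] UMinus D →ₗ[ℂ] ℂ) : Prop where
  apply_one : ∀ x : UPlus D, φ x 1 = Plus.counit D x
  one_apply : ∀ y : UMinus D, φ 1 y = Minus.counit D y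
  finite_apply_mul : ∀ (x : UPlus D) (y y' : UMinus D),
    {k : ℤ | tensorPairing D φ ((Plus.coproduct D x).coeff k) (y ⊗ₜ[ℂ] y') ≠ 0}.Finite
  apply_mul : ∀ (x : UPlus D) (y y' : UMinus D),
    φ x (y * y') = ∑ᶠ k : ℤ, tensorPairing D φ ((Plus.coproduct D x).coeff k) (y ⊗ₜ[ℂ] y')
  finite_mul_apply : ∀ (x x' : UPlus D) (y : UMinus D),
    {k : ℤ | tensorPairing D φ (x ⊗ₜ[ℂ] x') ((Minus.coproductOp D y).coeff k) ≠ 0}.Finite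
  mul_apply : ∀ (x x' : UPlus D) (y : UMinus D),
    φ (x * x') y = ∑ᶠ k : ℤ, tensorPairing D φ (x ⊗ₜ[ℂ] x') ((Minus.coproductOp D y).coeff k)

variable {D} in
open Classical in
/-- The values of the pairing on generators:
* `⟨K⁺_α(z), K⁻_β(w)⟩ = (z - q^{(α,β)} w) / (q^{(α,β)} z - w)`, expanded for `w << z`
  (coefficient of `z^{-n} w^m`);
* `⟨e_α[n], f_β[m]⟩ = δ_{αβ} δ_{n+m,0}`;
* `⟨K⁺_α(z), f_β(w)⟩ = ⟨e_α(z), K⁻_β(w)⟩ = 0`. -/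
structure HasGeneratorValues (φ : UPlus D →ₗ[ℂ] UMinus D →ₗ[ℂ] ℂ) : Prop where
  K_K : ∀ (α β : I) (n m : ℕ), φ (Plus.K D α n) (Minus.K D β m) =
    if n = m then PowerSeries.coeff n (kernelPlus (D.t α β)) else 0
  e_f : ∀ (α β : I) (n m : ℤ), φ (Plus.e D α n) (Minus.f D β m) =
    if α = β ∧ n + m = 0 then 1 else 0
  K_f : ∀ (α β : I) (n : ℕ) (m : ℤ), φ (Plus.K D α n) (Minus.f D β m) = 0
  e_K : ∀ (α β : I) (n : ℤ) (m : ℕ), φ (Plus.e D α n) (Minus.K D β m) = 0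

/-! ### Quantum Serre relations -/

/-- For sequences `x`, `y` in an algebra, with currents `x(z) = ∑_n x[n] z^{-n}` and
`y(w) = ∑_m y[m] w^{-m}`, the coefficient of `z_1^{-n_1} ⋯ z_N^{-n_N} w^{-m}` in
`∑_{r=0}^N (-1)^r [N choose r]_p Sym_{z_1,…,z_N} (x(z_1) ⋯ x(z_r) y(w) x(z_{r+1}) ⋯ x(z_N))`,
where `Sym` denotes the sum over all permutations of the variables. -/
def serreElement {R : Type*} [Ring R] [Algebra ℂ R] (p : ℂ) (x y : ℤ → R) (N : ℕ)
    (n : Fin N → ℤ) (m : ℤ) : R :=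
  ∑ r ∈ Finset.range (N + 1), ((-1) ^ r * qBinom p N r) •
    ∑ σ : Equiv.Perm (Fin N),
      (((List.ofFn fun i => x (n (σ i))).take r).prod * y m *
        ((List.ofFn fun i => x (n (σ i))).drop r).prod)

/-- The two-sided ideal of `U_q b̃₊` generated by the quantum Serre relations, for all `α ≠ β`,
with `N = 1 - a_{αβ}` and `p = q_α`. -/
def serreIdealPlus : TwoSidedIdeal (UPlus D) :=
  TwoSidedIdeal.span {x | ∃ α β : I, α ≠ β ∧ ∃ (n : Fin (1 - D.a α β).toNat → ℤ) (m : ℤ),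
    x = serreElement (D.qs α) (Plus.e D α) (Plus.e D β) (1 - D.a α β).toNat n m}

/-- The two-sided ideal of `U_q b̃₋` generated by the quantum Serre relations, for all `α ≠ β`,
with `N = 1 - a_{αβ}` and `p = q_α` (the quantum binomial coefficients are invariant under
`q ↦ q⁻¹`). -/
def serreIdealMinus : TwoSidedIdeal (UMinus D) :=
  TwoSidedIdeal.span {y | ∃ α β : I, α ≠ β ∧ ∃ (n : Fin (1 - D.a α β).toNat → ℤ) (m : ℤ),
    y = serreElement (D.qs α) (Minus.f D α) (Minus.f D β) (1 - D.a α β).toNat n m}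

variable {D} in
/-- The radical of `φ` in `U_q b̃₊`. -/
def radicalPlus (φ : UPlus D →ₗ[ℂ] UMinus D →ₗ[ℂ] ℂ) : Set (UPlus D) := {x | ∀ y, φ x y = 0}

variable {D} in
/-- The radical of `φ` in `U_q b̃₋`. -/
def radicalMinus (φ : UPlus D →ₗ[ℂ] UMinus D →ₗ[ℂ] ℂ) : Set (UMinus D) := {y | ∀ x, φ x y = 0}

end QuantumCurrents

end

/-! The assignment `f_α(z) ↦ e_α(z⁻¹)`, `K⁻_α(z) ↦ K⁺_α(z⁻¹)⁻¹` is an algebra morphism `toPlus` from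
the minus half to the plus half, and it exchanges the two tensor factors of the coproducts. A Hopf
pairing is therefore obtained from a symmetric bilinear form on `U_q b̃₊` whose multiplication in
one argument is dual to `Δ₊` in the other.

The form is built without any basis. Pairing with the group-like current `K_β` should be a
character. Pairing with the whole current `e_β` should be the off-diagonal entry of a triangular
representation of dimension two (`repE`), since `Δ₊(e_β)` has just two terms. Contracting the right
factor of `Δ₊` against these functionals gives skew derivations `der`, the future adjoints of right
multiplication by generators. Applying a word of them and then the counit defines a form on `U_q
b̃₊` times a free algebra. It is symmetric, by induction on total word length (`preForm_symm`); as
the first argument already lives in the quotient, symmetry makes the second one descend too, so the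
relations never have to be checked on the derivations. The Hopf axiom follows from the twisted
Leibniz rule (`formTensor_coproduct`). Uniqueness holds because the coproduct of a generator
involves generators only.

For the Serre elements, fix `z` and regard the pairings of `z` with words in the modes of the
currents as a functional on Laurent polynomials. The vertex relation suggests that the product of
currents taken in a given order is `∏ ± (z_l - t z_j)`, over ordered pairs, times a function
independent of the order. Such a division is not legitimate in the algebra, but it is after pairing
with `z`: a combination of orderings pairs to zero as soon as the corresponding combination of the
products `pairProd` vanishes (`sum_wordForm_eq_zero`). The proof peels generators off `z`: a last
factor `e_γ(X)` substitutes `X` for one variable and multiplies by expanded kernels, which are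
exactly what moves the corresponding label to the front of the list.

What remains is a polynomial identity, an antisymmetrized sum with quantum binomial coefficients. A
weighted version follows from the Pascal rule (`IsTwisted.sum_insertProd`): the variable `w` drops
out, leaving a constant that vanishes precisely because `q^{(α,β)} = q_α^{1-N}`. Finally, the
radical of a Hopf pairing is a two-sided ideal, so the generated ideals lie in it. -/

noncomputable section

namespace QuantumCurrents

open Filter

/-! ### Products of Laurent series -/

/-- Coefficients of a product of Laurent series, as sums over sufficiently large finite sets. -/
theorem eventually_coeff_mul {R : Type*} [Ring R] (A B : HahnSeries ℤ R) (m : ℤ) :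
    ∀ᶠ s : Finset ℤ in atTop, (A * B).coeff m = ∑ j ∈ s, A.coeff (m - j) * B.coeff j := by
  classical
  refine eventually_atTop.2
    ⟨(Finset.antidiagonal A.isPWO_support B.isPWO_support m).image Prod.snd, fun s hs => ?_⟩
  rw [HahnSeries.coeff_mul]
  have h1 : ∑ ij ∈ Finset.antidiagonal A.isPWO_support B.isPWO_support m,
      A.coeff ij.1 * B.coeff ij.2 =
      ∑ j ∈ (Finset.antidiagonal A.isPWO_support B.isPWO_support m).image Prod.snd,
        A.coeff (m - j) * B.coeff j := by
    rw [Finset.sum_image]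
    · refine Finset.sum_congr rfl fun p hp => ?_
      have := (Finset.mem_antidiagonal.1 hp).2.2
      rw [show p.1 = m - p.2 by omega]
    · intro p hp r hr hpr
      have hp := (Finset.mem_antidiagonal.1 hp).2.2
      have hr := (Finset.mem_antidiagonal.1 hr).2.2
      exact Prod.ext (by omega) hpr
  rw [h1]
  refine Finset.sum_subset hs fun j _ hj => ?_
  by_contra hne
  refine hj (Finset.mem_image.2 ⟨(m - j, j), Finset.mem_antidiagonal.2 ⟨?_, ?_, by simp⟩, rfl⟩)
  · exact fun h => hne (by rw [h, zero_mul])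
  · exact fun h => hne (by rw [h, mul_zero])

variable {I : Type*} (D : Datum I)

/-! ### Generators of the plus half, its characters and its two-dimensional representations. -/

namespace Plus

section Lift

variable {S : Type*} [Ring S] [Algebra ℂ S] (xe : I → ℤ → S) (xK : I → ℕ → S) (xKinv : I → S)
    (h1 : ∀ α β, AuxVR (D.t α β) (xe α) (xe β))
    (h2 : ∀ α β n m, xK α n * xK β m = xK β m * xK α n)
    (h3 : ∀ α, xK α 0 * xKinv α = 1) (h4 : ∀ α, xKinv α * xK α 0 = 1)
    (h5 : ∀ α β, AuxMR (D.t α β) (PowerSeries.mk (xK α)) (xe β))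

theorem lift_e (α : I) (n : ℤ) : lift D xe xK xKinv h1 h2 h3 h4 h5 (e D α n) = xe α n := by
  unfold lift e proj fe
  erw [RingQuot.liftAlgHom_mkAlgHom_apply]
  simp

theorem lift_K (α : I) (n : ℕ) : lift D xe xK xKinv h1 h2 h3 h4 h5 (K D α n) = xK α n := by
  unfold lift K proj fK
  erw [RingQuot.liftAlgHom_mkAlgHom_apply]
  simp

theorem lift_Kinv (α : I) : lift D xe xK xKinv h1 h2 h3 h4 h5 (Kinv D α) = xKinv α := by
  unfold lift Kinv proj fKinv
  erw [RingQuot.liftAlgHom_mkAlgHom_apply]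
  simp

end Lift

theorem counit_e (α : I) (n : ℤ) : counit D (e D α n) = 0 := lift_e ..

theorem counit_K (α : I) (n : ℕ) : counit D (K D α n) = if n = 0 then 1 else 0 := lift_K ..

theorem counit_Kinv (α : I) : counit D (Kinv D α) = 1 := lift_Kinv ..

/-- The two kinds of generating currents: `Sum.inl α` is `e_α(z)`, `Sum.inr (Sum.inl α)` is
`K⁺_α(z)` and `Sum.inr (Sum.inr α)` is the constant current `K⁺_α[0]⁻¹`. -/
abbrev Color (I : Type*) := I ⊕ (I ⊕ I)

/-- The group-like currents, with coefficients indexed by all integers. -/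
def kel : I ⊕ I → ℤ → UPlus D
  | Sum.inl α, n => if 0 ≤ n then K D α n.toNat else 0
  | Sum.inr α, n => if n = 0 then Kinv D α else 0

/-- The generators of `U_q b̃₊`. -/
def gen : Color I → ℤ → UPlus D
  | Sum.inl α, n => e D α n
  | Sum.inr i, n => kel D i n

/-- The group-like current `k` in the coproduct of a generating current. -/
def cartan : Color I → I ⊕ I
  | Sum.inl α => Sum.inl α
  | Sum.inr i => i

variable {D} in
-- Growing words on the right matches the adjunction used throughout, in which right multiplication
-- by a generator is dual to a skew derivation.
theorem induction_right {P : UPlus D → Prop} (one : P 1) (add : ∀ x y, P x → P y → P (x + y))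
    (smul : ∀ (c : ℂ) x, P x → P (c • x)) (mul : ∀ x c n, P x → P (x * gen D c n))
    (x : UPlus D) : P x := by
  -- Quantifying over the left factor `x` makes the product case a composition of two instances.
  have key : ∀ f : FreeAlgebra ℂ (GenPlus I), ∀ x, P x → P (x * proj D f) := by
    intro f
    induction f using FreeAlgebra.induction with
    | grade0 r =>
      intro x hx
      rw [AlgHom.commutes, ← Algebra.commutes, ← Algebra.smul_def]
      exact smul _ _ hx
    | grade1 g =>
      intro x hx
      rcases g with ⟨α, n⟩ | ⟨α, n⟩ | ⟨α⟩
      · exact mul x (Sum.inl α) n hx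
      · simpa [gen, kel, K, fK] using mul x (Sum.inr (Sum.inl α)) n hx
      · simpa [gen, kel, Kinv, fKinv] using mul x (Sum.inr (Sum.inr α)) 0 hx
    | mul a b ha hb =>
      intro x hx
      rw [map_mul, ← mul_assoc]
      exact hb _ (ha _ hx)
    | add a b ha hb =>
      intro x hx
      rw [map_add, mul_add]
      exact add _ _ (ha _ hx) (hb _ hx)
  obtain ⟨f, hf⟩ := RingQuot.mkAlgHom_surjective ℂ (Rel D) x
  have := key f 1 one
  rw [one_mul] at this
  exact hf ▸ this

/-- The coefficient of `X ^ n`, for an integer `n`. -/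
def zcoeff (p : ℂ⟦X⟧) (n : ℤ) : ℂ := if 0 ≤ n then PowerSeries.coeff n.toNat p else 0

/-- The values of the symmetric form on the group-like currents, as power series. -/
def kform : I ⊕ I → I ⊕ I → ℂ⟦X⟧
  | Sum.inl α, Sum.inl β => kernelPlus (D.t α β)⁻¹
  | Sum.inl α, Sum.inr β => PowerSeries.C (D.t α β)⁻¹
  | Sum.inr α, Sum.inl β => PowerSeries.C (D.t α β)⁻¹
  | Sum.inr α, Sum.inr β => PowerSeries.C (D.t α β)

theorem kform_symm (i j : I ⊕ I) : kform D i j = kform D j i := by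
  rcases i with α | α <;> rcases j with β | β <;> simp [kform, D.t_symm α β]

theorem coeff_zero_kernelPlus {t : ℂ} (ht : t ≠ 0) :
    PowerSeries.coeff 0 (kernelPlus t) = t⁻¹ := by
  have := congrArg (PowerSeries.coeff 0) (kernelPlus_spec ht)
  simp only [sub_mul, map_sub, PowerSeries.coeff_C_mul, PowerSeries.coeff_zero_X_mul, sub_zero,
    PowerSeries.coeff_zero_one, PowerSeries.coeff_zero_X, mul_zero] at this
  exact eq_inv_of_mul_eq_one_right this

theorem coeff_zero_kform_mul (α : I) (j : I ⊕ I) : PowerSeries.coeff 0 (kform D (Sum.inl α) j) *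
    PowerSeries.coeff 0 (kform D (Sum.inr α) j) = 1 := by
  rcases j with β | β
  · rw [kform, kform, coeff_zero_kernelPlus (inv_ne_zero (D.t_ne_zero α β))]
    simp [D.t_ne_zero α β]
  · simp [kform, D.t_ne_zero α β]

/-- This is the off-diagonal entry of the relation between `K⁺_α` and `e_β` in the representation
`repE`; the series `C 1` is the counit of `K⁺_α(z)`. -/
theorem gamma_rel (α β : I) (n : ℕ) :
    (D.t α β) * PowerSeries.coeff (n + 1) (PowerSeries.C (R := ℂ) 1) -
      PowerSeries.coeff n (PowerSeries.C (R := ℂ) 1) =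
    PowerSeries.coeff (n + 1) (kform D (Sum.inl α) (Sum.inl β)) -
      D.t α β * PowerSeries.coeff n (kform D (Sum.inl α) (Sum.inl β)) := by
  have ht := D.t_ne_zero α β
  have := congrArg (PowerSeries.coeff (n + 1)) (kernelPlus_spec (inv_ne_zero ht))
  simp only [sub_mul, map_sub, PowerSeries.coeff_C_mul, PowerSeries.coeff_succ_X_mul,
    PowerSeries.coeff_X, PowerSeries.coeff_one, PowerSeries.coeff_C] at this ⊢
  have h2 := congrArg (fun z => D.t α β * z) this
  simp only [mul_sub, ← mul_assoc, mul_inv_cancel₀ ht, one_mul] at h2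
  simp only [kform]
  rcases n with _ | n
  · simp at h2 ⊢
    linear_combination -h2
  · simp at h2 ⊢
    linear_combination -h2

/-- The character of `U_q b̃₊` given by the pairing with the group-like current `j`. -/
def character (j : I ⊕ I) : UPlus D →ₐ[ℂ] ℂ :=
  lift D (fun _ _ => 0) (fun α n => PowerSeries.coeff n (kform D (Sum.inl α) j))
    (fun α => PowerSeries.coeff 0 (kform D (Sum.inr α) j))
    (fun _ _ n m => by simp) (fun _ _ _ _ => mul_comm _ _) (fun α => coeff_zero_kform_mul D α j)
    (fun α => by rw [mul_comm]; exact coeff_zero_kform_mul D α j)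
    (fun _ _ m => by simp)

theorem character_e (j : I ⊕ I) (α : I) (n : ℤ) : character D j (e D α n) = 0 := lift_e ..

theorem character_K (j : I ⊕ I) (α : I) (n : ℕ) : character D j (K D α n) =
    PowerSeries.coeff n (kform D (Sum.inl α) j) := lift_K ..

theorem character_Kinv (j : I ⊕ I) (α : I) : character D j (Kinv D α) =
    PowerSeries.coeff 0 (kform D (Sum.inr α) j) := lift_Kinv ..

theorem character_kel (j i : I ⊕ I) (n : ℤ) :
    character D j (kel D i n) = zcoeff (kform D i j) n := by
  rcases i with α | α
  · simp only [kel, zcoeff]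
    split_ifs
    · exact character_K ..
    · simp
  · simp only [kel, zcoeff]
    rcases lt_trichotomy n 0 with h | h | h
    · rw [if_neg (by omega), if_neg (by omega), map_zero]
    · subst h
      simp only [if_true, le_refl]
      exact character_Kinv ..
    · rw [if_neg (by omega), if_pos (by omega), map_zero]
      rcases j with β | β <;> simp [kform, PowerSeries.coeff_C, show n.toNat ≠ 0 by omega]

open Classical in
/-- The two-dimensional representation whose off-diagonal entry is the pairing with `e_β`. -/
def repE (β : I) : UPlus D →ₐ[ℂ] Matrix (Fin 2) (Fin 2) ℂ :=
  lift D (fun α _ => if α = β then !![0, 1; 0, 0] else 0)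
    (fun α n => !![if n = 0 then 1 else 0, 0;
      0, PowerSeries.coeff n (kform D (Sum.inl α) (Sum.inl β))])
    (fun α => !![1, 0; 0, PowerSeries.coeff 0 (kform D (Sum.inr α) (Sum.inl β))])
    (fun α α' n m => by split_ifs <;> simp)
    (fun α α' n m => by
      simp only [Matrix.mul_fin_two, mul_comm]
      simp)
    (fun α => by
      simp only [Matrix.mul_fin_two, coeff_zero_kform_mul]
      simp [Matrix.one_fin_two])
    (fun α => by
      simp only [Matrix.mul_fin_two, mul_comm (PowerSeries.coeff 0 (kform D (Sum.inr α) _)),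
        coeff_zero_kform_mul]
      simp [Matrix.one_fin_two])
    (fun α α' => by
      apply AuxMR.mk
      · intro m
        split_ifs with h
        · subst h
          simp only [PowerSeries.coeff_mk, Matrix.mul_fin_two, Matrix.smul_of, Matrix.smul_cons]
          simp [kform, coeff_zero_kernelPlus, D.t_ne_zero]
        · simp
      · intro n m
        split_ifs with h
        · subst h
          have := gamma_rel D α α' n
          simp only [PowerSeries.coeff_mk, Matrix.mul_fin_two]
          simp only [PowerSeries.coeff_C] at this
          ext i j
          fin_cases i <;> fin_cases j <;> simp at this ⊢
          exact this
        · simp)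

open Classical in
theorem repE_e (β α : I) (n : ℤ) :
    repE D β (e D α n) = if α = β then !![0, 1; 0, 0] else 0 := lift_e ..

theorem repE_K (β α : I) (n : ℕ) : repE D β (K D α n) = !![if n = 0 then 1 else 0, 0;
    0, PowerSeries.coeff n (kform D (Sum.inl α) (Sum.inl β))] := lift_K ..

theorem repE_Kinv (β α : I) : repE D β (Kinv D α) =
    !![1, 0; 0, PowerSeries.coeff 0 (kform D (Sum.inr α) (Sum.inl β))] := lift_Kinv ..

/-- The images of the generators are upper triangular, and the diagonal entries of upper triangular
matrices are multiplicative; they agree with the two characters on generators. -/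
theorem repE_entries (β : I) (x : UPlus D) : repE D β x 0 0 = counit D x ∧ repE D β x 1 0 = 0 ∧
    repE D β x 1 1 = character D (Sum.inl β) x := by
  induction x using induction_right with
  | one => simp
  | add x y hx hy => simp [hx.1, hx.2.1, hx.2.2, hy.1, hy.2.1, hy.2.2]
  | smul c x hx => simp [hx.1, hx.2.1, hx.2.2]
  | mul x c n hx =>
    have hc : repE D β (gen D c n) 0 0 = counit D (gen D c n) ∧ repE D β (gen D c n) 1 0 = 0 ∧
        repE D β (gen D c n) 1 1 = character D (Sum.inl β) (gen D c n) := by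
      rcases c with α | α | α
      · simp only [gen]
        rw [counit_e, character_e, repE_e]
        split_ifs <;> simp
      · simp only [gen, kel]
        split_ifs with h
        · rw [counit_K, character_K, repE_K]
          simp
        · simp
      · simp only [gen, kel]
        split_ifs with h
        · rw [counit_Kinv, character_Kinv, repE_Kinv]
          simp
        · simp
    rw [map_mul, map_mul, map_mul, Matrix.mul_apply, Matrix.mul_apply, Matrix.mul_apply]
    simp [hx.1, hx.2.1, hx.2.2, hc.1, hc.2.1, hc.2.2]

/-- The functional on `U_q b̃₊` given by the total pairing with the generating current `c`. -/
def functional : Color I → UPlus D →ₗ[ℂ] ℂ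
  | Sum.inl β => (LinearMap.proj 1 ∘ₗ LinearMap.proj 0 : (Fin 2 → Fin 2 → ℂ) →ₗ[ℂ] ℂ) ∘ₗ
      (Matrix.ofLinearEquiv ℂ).symm.toLinearMap ∘ₗ (repE D β).toLinearMap
  | Sum.inr j => (character D j).toLinearMap

theorem functional_inl (β : I) (x : UPlus D) : functional D (Sum.inl β) x = repE D β x 0 1 := rfl

theorem functional_inr (j : I ⊕ I) (x : UPlus D) : functional D (Sum.inr j) x = character D j x :=
  rfl

open Classical in
-- The upper right entry of a product of triangular matrices. It is the dual of `c ↦ c ⊗ k + 1 ⊗ c`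
-- for a root current and of `k ↦ k ⊗ k` for a group-like one. The modes of `c` are summed over
-- here; the grading separates them again in `form_gen_of_homogeneous`.
theorem functional_mul (c : Color I) (x y : UPlus D) : functional D c (x * y) =
    (if c.isLeft then counit D x * functional D c y else 0) +
      functional D c x * character D (cartan c) y := by
  rcases c with β | j
  · rw [functional_inl, map_mul, Matrix.mul_apply]
    simp [functional_inl, (repE_entries D β _).1, (repE_entries D β _).2.2, cartan]
  · simp [functional_inr, cartan]

open Classical in
theorem functional_e (c : Color I) (α : I) (n : ℤ) :
    functional D c (e D α n) = if c = Sum.inl α then 1 else 0 := by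
  rcases c with β | j
  · rw [functional_inl, repE_e]
    by_cases h : α = β
    · simp [h]
    · simp [h, Ne.symm h]
  · simp [functional_inr, character_e]

theorem functional_kel (c : Color I) (i : I ⊕ I) (n : ℤ) : functional D c (kel D i n) =
    if c.isLeft then 0 else zcoeff (kform D i (cartan c)) n := by
  rcases c with β | j
  · rw [functional_inl]
    rcases i with α | α
    · simp only [kel]
      split_ifs <;> simp_all [repE_K]
    · simp only [kel]
      split_ifs <;> simp_all [repE_Kinv]
  · simp [functional_inr, character_kel, cartan]

theorem functional_one (c : Color I) : functional D c 1 = if c.isLeft then 0 else 1 := by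
  rcases c with β | j
  · simp [functional_inl]
  · simp [functional_inr]

end Plus

end QuantumCurrents

namespace QuantumCurrents

open Filter

variable {I : Type*} (D : Datum I)

namespace Plus

/-! ### Skew derivations -/

/-- `u ⊗ v ↦ ψ(v) u`. -/
def contract (ψ : UPlus D →ₗ[ℂ] ℂ) : (UPlus D ⊗[ℂ] UPlus D) →ₗ[ℂ] UPlus D :=
  (TensorProduct.rid ℂ (UPlus D)).toLinearMap ∘ₗ TensorProduct.map LinearMap.id ψ

theorem contract_tmul (ψ : UPlus D →ₗ[ℂ] ℂ) (u v : UPlus D) :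
    contract D ψ (u ⊗ₜ v) = ψ v • u := by
  simp [contract]

theorem contract_functional_mul (c : Color I) (a b : UPlus D ⊗[ℂ] UPlus D) :
    contract D (functional D c) (a * b) =
      (if c.isLeft then contract D (counit D).toLinearMap a * contract D (functional D c) b else 0) +
      contract D (functional D c) a * contract D (functional D (Sum.inr (cartan c))) b := by
  induction a with
  | zero => simp
  | add a a' ha ha' =>
    rw [add_mul, map_add, ha, ha', map_add, map_add]
    split_ifs <;> simp only [add_mul] <;> abel
  | tmul u v =>
    induction b with
    | zero => simp
    | add a a' ha ha' =>
      rw [mul_add, map_add, ha, ha', map_add, map_add]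
      split_ifs <;> simp only [mul_add] <;> abel
    | tmul u' v' =>
      rw [Algebra.TensorProduct.tmul_mul_tmul]
      simp only [contract_tmul, functional_mul, functional_inr, AlgHom.toLinearMap_apply]
      split_ifs <;> simp [add_smul, smul_smul, mul_comm]

theorem contract_counit_mul (a b : UPlus D ⊗[ℂ] UPlus D) :
    contract D (counit D).toLinearMap (a * b) =
      contract D (counit D).toLinearMap a * contract D (counit D).toLinearMap b := by
  induction a with
  | zero => simp
  | add a a' ha ha' => rw [add_mul, map_add, ha, ha', map_add, add_mul]
  | tmul u v =>
    induction b with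
    | zero => simp
    | add a a' ha ha' => rw [mul_add, map_add, ha, ha', map_add, mul_add]
    | tmul u' v' =>
      rw [Algebra.TensorProduct.tmul_mul_tmul]
      simp [contract_tmul, smul_smul, mul_comm]

/-- One formula covers all three families, because a group-like current is its own `cartan` partner
and modes outside the allowed range are set to zero. -/
theorem coproduct_gen_coeff (c : Color I) (n m : ℤ) : (coproduct D (gen D c n)).coeff m =
    gen D c (n - m) ⊗ₜ[ℂ] kel D (cartan c) m +
      if c.isLeft ∧ m = n then 1 ⊗ₜ[ℂ] gen D c n else 0 := by
  rcases c with α | α | α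
  · simp only [gen, coproduct_e, coproductE, cartan, kel, HahnSeries.coeff_add, Sum.isLeft_inl,
      true_and]
    congr 1
    · split_ifs with h
      · lift m to ℕ using h
        rw [HahnSeries.ofPowerSeries_apply_coeff, PowerSeries.coeff_mk, Int.toNat_natCast]
      · rw [ofPS_coeff_neg _ _ (by omega), TensorProduct.tmul_zero]
    · rw [HahnSeries.coeff_single]
      split_ifs <;> rfl
  · simp only [gen, cartan, kel, Sum.isLeft_inr, Bool.false_eq_true, false_and, if_false, add_zero]
    by_cases hn : 0 ≤ n
    · lift n to ℕ using hn
      simp only [Int.natCast_nonneg, if_true, Int.toNat_natCast, coproduct_K, coproductK,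
        HahnSeries.coeff_sum, HahnSeries.coeff_single]
      by_cases hm : 0 ≤ m ∧ 0 ≤ (n : ℤ) - m
      · obtain ⟨h1, h2⟩ := hm
        lift m to ℕ using h1
        rw [if_pos h2, if_pos (by omega), Finset.sum_eq_single (n - m, m)]
        · simp only [if_true]
          congr 2
          omega
        · intro p hp hne
          rw [Finset.HasAntidiagonal.mem_antidiagonal] at hp
          rw [if_neg]
          intro h
          exact hne (Prod.ext (by simp; omega) (by simp; omega))
        · intro h
          exact absurd (Finset.HasAntidiagonal.mem_antidiagonal.2 (by omega)) h
      · rw [Finset.sum_eq_zero]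
        · rw [not_and_or] at hm
          rcases hm with h | h
          · rw [if_neg h, TensorProduct.tmul_zero]
          · rw [if_neg h, TensorProduct.zero_tmul]
        · intro p hp
          rw [Finset.HasAntidiagonal.mem_antidiagonal] at hp
          rw [if_neg (by omega)]
    · rw [if_neg hn, map_zero, HahnSeries.coeff_zero]
      by_cases hm : 0 ≤ m
      · rw [if_neg (by omega), TensorProduct.zero_tmul]
      · rw [if_neg hm, TensorProduct.tmul_zero]
  · simp only [gen, cartan, kel, Sum.isLeft_inr, Bool.false_eq_true, false_and, if_false, add_zero]
    by_cases hn : n = 0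
    · subst hn
      simp only [if_true, coproduct_Kinv, HahnSeries.coeff_single]
      by_cases hm : m = 0 <;> simp [hm]
    · rw [if_neg hn, map_zero, HahnSeries.coeff_zero]
      by_cases hm : m = 0 <;> simp [hm, hn]

theorem counit_kel (i : I ⊕ I) (n : ℤ) : counit D (kel D i n) = if n = 0 then 1 else 0 := by
  rcases i with α | α
  · simp only [kel]
    split_ifs with h h' h'
    · simp [h', counit_K]
    · rw [counit_K, if_neg (by omega)]
    · omega
    · simp
  · simp only [kel]
    split_ifs <;> simp [counit_Kinv]

theorem counit_gen (c : Color I) (n : ℤ) :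
    counit D (gen D c n) = if c.isLeft then 0 else if n = 0 then 1 else 0 := by
  rcases c with α | i
  · simp [gen, counit_e]
  · simp [gen, counit_kel]

/-- The right counit axiom, coefficient by coefficient: the right factors of coefficient `m` have
degree `m`, and the counit sees degree zero only. -/
theorem contract_counit_coproduct (x : UPlus D) (m : ℤ) :
    contract D (counit D).toLinearMap ((coproduct D x).coeff m) = if m = 0 then x else 0 := by
  induction x using induction_right generalizing m with
  | one =>
    rw [map_one, HahnSeries.coeff_one]
    split_ifs
    · rw [Algebra.TensorProduct.one_def, contract_tmul]
      simp
    · simp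
  | add x y hx hy => rw [map_add, HahnSeries.coeff_add, map_add, hx, hy]; split_ifs <;> simp
  | smul c x hx => rw [map_smul, HahnSeries.coeff_smul, map_smul, hx]; split_ifs <;> simp
  | mul x c n hx =>
    rw [map_mul]
    -- A single finite set computes the product and contains `m`, the only index that contributes.
    obtain ⟨s, h1, h2⟩ := ((eventually_coeff_mul (coproduct D x) (coproduct D (gen D c n)) m).and
      (eventually_ge_atTop {m})).exists
    rw [h1, map_sum]
    simp only [contract_counit_mul, hx]
    rw [Finset.sum_eq_single m]
    · rw [sub_self, if_pos rfl, coproduct_gen_coeff, map_add, contract_tmul,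
        AlgHom.toLinearMap_apply, counit_kel]
      have : contract D (counit D).toLinearMap
          (if c.isLeft ∧ m = n then 1 ⊗ₜ[ℂ] gen D c n else 0) = 0 := by
        split_ifs with h
        · rw [contract_tmul, AlgHom.toLinearMap_apply, counit_gen, if_pos h.1, zero_smul]
        · simp
      rw [this]
      split_ifs with h
      · simp [h]
      · simp
    · intro j _ hj
      rw [if_neg (by omega), zero_mul]
    · intro h
      exact absurd (Finset.singleton_subset_iff.1 h2) h

/-- The skew derivation `x ↦ ∑ ⟨x₂, c[m]⟩ x₁` adjoint to the right multiplication by the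
generator `c[m]`. -/
def der (c : Color I) (m : ℤ) : UPlus D →ₗ[ℂ] UPlus D :=
  contract D (functional D c) ∘ₗ HahnSeries.coeff.linearMap m ∘ₗ (coproduct D).toLinearMap

theorem der_apply (c : Color I) (m : ℤ) (x : UPlus D) :
    der D c m x = contract D (functional D c) ((coproduct D x).coeff m) := rfl

/-- The twisted Leibniz rule: multiplicativity of `Δ₊` combined with `functional_mul`. The sum over
`j` is formally infinite with finitely many nonzero terms; stating it for all large finite sets
allows several such expansions to be compared over a common set. -/
theorem der_mul (c : Color I) (m : ℤ) (x y : UPlus D) : ∀ᶠ s : Finset ℤ in atTop,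
    der D c m (x * y) = (if c.isLeft then x * der D c m y else 0) +
      ∑ j ∈ s, der D c (m - j) x * der D (Sum.inr (cartan c)) j y := by
  filter_upwards [eventually_coeff_mul (coproduct D x) (coproduct D y) m,
    eventually_ge_atTop {m}] with s h1 h2
  rw [der_apply, map_mul, h1, map_sum]
  simp only [contract_functional_mul, contract_counit_coproduct, ← der_apply,
    Finset.sum_add_distrib]
  congr 1
  split_ifs
  · rw [Finset.sum_eq_single m]
    · simp
    · intro j _ hj
      rw [if_neg (by omega), zero_mul]
    · intro h
      exact absurd (Finset.singleton_subset_iff.1 h2) h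
  · simp

theorem der_one (c : Color I) (m : ℤ) : der D c m 1 = counit D (gen D c m) • 1 := by
  rw [der_apply, map_one, HahnSeries.coeff_one, counit_gen]
  split_ifs <;> simp_all [Algebra.TensorProduct.one_def, contract_tmul, functional_one]

theorem der_gen (c c' : Color I) (m n : ℤ) : der D c m (gen D c' n) =
    (open Classical in if c.isLeft ∧ c = c' ∧ m = n then 1 else 0) +
      if c.isLeft then 0 else
        zcoeff (kform D (cartan c') (cartan c)) m • gen D c' (n - m) := by
  classical
  rw [der_apply, coproduct_gen_coeff, map_add, contract_tmul, functional_kel]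
  rw [add_comm]
  congr 1
  · rw [apply_ite (contract D (functional D c)), map_zero, contract_tmul]
    rcases c' with α | i
    · rw [gen, functional_e]
      by_cases h : c = Sum.inl α
      · subst h
        simp
      · simp [h]
    · rcases c with β | j <;> simp
  · split_ifs <;> simp

theorem der_mul_gen (c c' : Color I) (m n : ℤ) (x : UPlus D) : ∀ᶠ s : Finset ℤ in atTop,
    der D c m (x * gen D c' n) =
      (open Classical in if c.isLeft ∧ c = c' ∧ m = n then x else 0) +
      ∑ j ∈ s, zcoeff (kform D (cartan c') (cartan c)) j •
        (der D c (m - j) x * gen D c' (n - j)) := by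
  classical
  filter_upwards [der_mul D c m x (gen D c' n)] with s hs
  rw [hs]
  congr 1
  · rw [der_gen]
    by_cases h : c.isLeft <;> simp [h]
  · refine Finset.sum_congr rfl fun j _ => ?_
    rw [der_gen]
    simp [cartan]

/-! ### The symmetric form -/

/-- The free algebra on the generators. -/
abbrev Free (I : Type*) := FreeAlgebra ℂ (Color I × ℤ)

/-- The projection to `U_q b̃₊`. -/
def toU : Free I →ₐ[ℂ] UPlus D := FreeAlgebra.lift ℂ fun g => gen D g.1 g.2

theorem toU_ι (g : Color I × ℤ) : toU D (FreeAlgebra.ι ℂ g) = gen D g.1 g.2 := by simp [toU]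

theorem toU_surjective : Function.Surjective (toU D) := by
  intro x
  induction x using induction_right with
  | one => exact ⟨1, map_one _⟩
  | add x y hx hy =>
    obtain ⟨a, rfl⟩ := hx
    obtain ⟨b, rfl⟩ := hy
    exact ⟨a + b, map_add _ _ _⟩
  | smul c x hx =>
    obtain ⟨a, rfl⟩ := hx
    exact ⟨c • a, map_smul _ _ _⟩
  | mul x c n hx =>
    obtain ⟨a, rfl⟩ := hx
    exact ⟨a * FreeAlgebra.ι ℂ (c, n), by rw [map_mul, toU_ι]⟩

/-- The left action of the free algebra on `U_q b̃₊` by the skew derivations. -/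
def freeAct : Free I →ₐ[ℂ] Module.End ℂ (UPlus D) := FreeAlgebra.lift ℂ fun g => der D g.1 g.2

theorem freeAct_ι (g : Color I × ℤ) : freeAct D (FreeAlgebra.ι ℂ g) = der D g.1 g.2 := by
  simp [freeAct]

/-- The form on `U_q b̃₊ × F` for the free algebra `F`. -/
def preForm (x : UPlus D) : Free I →ₗ[ℂ] ℂ where
  toFun L := counit D (freeAct D L x)
  map_add' L M := by simp
  map_smul' c L := by simp

theorem preForm_apply (x : UPlus D) (L : Free I) : preForm D x L = counit D (freeAct D L x) := rfl

theorem preForm_mul_ι (x : UPlus D) (L : Free I) (g : Color I × ℤ) :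
    preForm D x (L * FreeAlgebra.ι ℂ g) = preForm D (der D g.1 g.2 x) L := by
  rw [preForm_apply, map_mul, freeAct_ι]
  rfl

theorem preForm_one_right (x : UPlus D) : preForm D x 1 = counit D x := by
  rw [preForm_apply, map_one]
  rfl

theorem preForm_add (x y : UPlus D) (L : Free I) :
    preForm D (x + y) L = preForm D x L + preForm D y L := by simp [preForm_apply]

theorem preForm_smul (c : ℂ) (x : UPlus D) (L : Free I) :
    preForm D (c • x) L = c * preForm D x L := by simp [preForm_apply]

theorem preForm_sum {ι : Type*} (s : Finset ι) (f : ι → UPlus D) (L : Free I) :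
    preForm D (∑ i ∈ s, f i) L = ∑ i ∈ s, preForm D (f i) L := by simp [preForm_apply]

theorem preForm_zero (L : Free I) : preForm D 0 L = 0 := by simp [preForm_apply]

/-- Linear combinations of words of bounded length. -/
inductive LengthLE : ℕ → Free I → Prop
  | zero (n : ℕ) : LengthLE n 0
  | one (n : ℕ) : LengthLE n 1
  | add {n : ℕ} {x y : Free I} : LengthLE n x → LengthLE n y → LengthLE n (x + y)
  | smul {n : ℕ} (c : ℂ) {x : Free I} : LengthLE n x → LengthLE n (c • x)
  | mul {n : ℕ} {x : Free I} (g : Color I × ℤ) :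
      LengthLE n x → LengthLE (n + 1) (x * FreeAlgebra.ι ℂ g)

namespace LengthLE

theorem mono {n m : ℕ} {x : Free I} (h : LengthLE n x) (hnm : n ≤ m) : LengthLE m x := by
  induction h generalizing m with
  | zero => exact zero _
  | one => exact one _
  | add _ _ h1 h2 => exact add (h1 hnm) (h2 hnm)
  | smul c _ h => exact smul c (h hnm)
  | mul g _ h =>
    obtain ⟨m, rfl⟩ : ∃ k, m = k + 1 := ⟨m - 1, by omega⟩
    exact mul g (h (by omega))

theorem sum {ι : Type*} {n : ℕ} (s : Finset ι) (f : ι → Free I) (h : ∀ i ∈ s, LengthLE n (f i)) :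
    LengthLE n (∑ i ∈ s, f i) := by
  classical
  induction s using Finset.induction with
  | empty => exact zero _
  | insert a s ha ih =>
    rw [Finset.sum_insert ha]
    exact add (h _ (Finset.mem_insert_self _ _)) (ih fun i hi => h i (Finset.mem_insert_of_mem hi))

theorem exists_of_free (x : Free I) : ∃ n, LengthLE n x := by
  have key : ∀ f x : Free I, (∃ n, LengthLE n x) → ∃ n, LengthLE n (x * f) := by
    intro f
    induction f using FreeAlgebra.induction with
    | grade0 r =>
      rintro x ⟨n, hx⟩
      rw [← Algebra.commutes, ← Algebra.smul_def]
      exact ⟨n, smul r hx⟩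
    | grade1 g =>
      rintro x ⟨n, hx⟩
      exact ⟨n + 1, mul g hx⟩
    | mul a b ha hb =>
      intro x hx
      rw [← mul_assoc]
      exact hb _ (ha _ hx)
    | add a b ha hb =>
      intro x hx
      obtain ⟨n, hn⟩ := ha x hx
      obtain ⟨m, hm⟩ := hb x hx
      rw [mul_add]
      exact ⟨n + m, add (hn.mono (by omega)) (hm.mono (by omega))⟩
  simpa using key x 1 ⟨0, one 0⟩

/-- Skew derivations do not increase word length. This is what makes an induction on length
possible, as the modes themselves are unbounded. -/
theorem exists_der {n : ℕ} {x : Free I} (h : LengthLE n x) (c : Color I) (m : ℤ) :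
    ∃ y, LengthLE n y ∧ toU D y = der D c m (toU D x) := by
  classical
  induction h generalizing c m with
  | zero n => exact ⟨0, zero _, by simp⟩
  | one n => exact ⟨_, smul (counit D (gen D c m)) (one n), by simp [der_one]⟩
  | add _ _ h1 h2 =>
    obtain ⟨y1, hy1, e1⟩ := h1 c m
    obtain ⟨y2, hy2, e2⟩ := h2 c m
    exact ⟨_, add hy1 hy2, by simp [e1, e2]⟩
  | smul a _ h =>
    obtain ⟨y, hy, e⟩ := h c m
    exact ⟨_, smul a hy, by simp [e]⟩
  | @mul n x g hx h =>
    choose y hy e using h c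
    obtain ⟨s, hs⟩ := (der_mul_gen D c g.1 m g.2 (toU D x)).exists
    refine ⟨(if c.isLeft ∧ c = g.1 ∧ m = g.2 then x else 0) +
      ∑ j ∈ s, zcoeff (kform D (cartan g.1) (cartan c)) j •
        (y (m - j) * FreeAlgebra.ι ℂ (g.1, g.2 - j)), add ?_ ?_, ?_⟩
    · split_ifs
      · exact hx.mono (Nat.le_succ _)
      · exact zero _
    · exact sum _ _ fun j _ => smul _ (mul _ (hy _))
    · rw [map_mul, toU_ι, hs, map_add, map_sum]
      congr 1
      · split_ifs <;> simp
      · simp [e, toU_ι]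

end LengthLE

theorem preForm_one_left (L : Free I) : preForm D 1 L = counit D (toU D L) := by
  obtain ⟨n, h⟩ := LengthLE.exists_of_free L
  induction h with
  | zero => simp
  | one => rw [preForm_one_right, map_one, map_one (toU D), map_one]
  | add _ _ h1 h2 => simp [h1, h2]
  | smul c _ h => simp [h]
  | mul g _ h => rw [preForm_mul_ι, der_one, preForm_smul, h, map_mul, map_mul, toU_ι, mul_comm]

/-- Both sides are expanded by the Leibniz rule. The contact terms, where the two last letters pair
with each other, are matched by induction. In the remaining terms each side becomes the pairing of
`der_y M` with `der_g L` (modes shifted by `j`), weighted by the symmetric `kform`. -/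
theorem preForm_symm_step {N : ℕ}
    (ih : ∀ (n m : ℕ) (M L : Free I), n + m ≤ N → LengthLE n M → LengthLE m L →
      preForm D (toU D M) L = preForm D (toU D L) M)
    {k l : ℕ} {M L : Free I} (hkl : k + l + 1 ≤ N) (hM : LengthLE k M) (hL : LengthLE l L)
    (g y : Color I × ℤ) :
    preForm D (toU D (M * FreeAlgebra.ι ℂ g)) (L * FreeAlgebra.ι ℂ y) =
      preForm D (toU D (L * FreeAlgebra.ι ℂ y)) (M * FreeAlgebra.ι ℂ g) := by
  classical
  choose M' hM' eM using fun j => hM.exists_der D y.1 (y.2 - j)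
  choose L' hL' eL using fun j => hL.exists_der D g.1 (g.2 - j)
  obtain ⟨s, h1, h2⟩ := ((der_mul_gen D y.1 g.1 y.2 g.2 (toU D M)).and
    (der_mul_gen D g.1 y.1 g.2 y.2 (toU D L))).exists
  rw [map_mul (toU D), toU_ι, preForm_mul_ι, h1, map_mul (toU D), toU_ι, preForm_mul_ι, h2, preForm_add, preForm_add,
    preForm_sum, preForm_sum]
  congr 1
  · by_cases h : y.1.isLeft ∧ y.1 = g.1 ∧ y.2 = g.2
    · rw [if_pos h, if_pos ⟨h.2.1 ▸ h.1, h.2.1.symm, h.2.2.symm⟩]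
      exact ih k l M L (by omega) hM hL
    · have h' : ¬(g.1.isLeft ∧ g.1 = y.1 ∧ g.2 = y.2) := fun h' =>
        h ⟨h'.2.1 ▸ h'.1, h'.2.1.symm, h'.2.2.symm⟩
      rw [if_neg h, if_neg h', preForm_zero, preForm_zero]
  · refine Finset.sum_congr rfl fun j _ => ?_
    rw [preForm_smul, preForm_smul, kform_symm, ← eM, ← eL]
    congr 1
    -- Symmetry for the shorter pair puts the letter last in the second argument, where it can be
    -- traded for a skew derivation of the first argument.
    have a1 := ih (k + 1) l (M' j * FreeAlgebra.ι ℂ (g.1, g.2 - j)) L (by omega)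
      (LengthLE.mul _ (hM' j)) hL
    have a2 := ih (l + 1) k (L' j * FreeAlgebra.ι ℂ (y.1, y.2 - j)) M (by omega)
      (LengthLE.mul _ (hL' j)) hM
    rw [preForm_mul_ι, map_mul, toU_ι] at a1 a2
    rw [a1, a2, ← eM, ← eL]
    exact ih l k _ _ (by omega) (hL' j) (hM' j)

theorem preForm_symm (M L : Free I) : preForm D (toU D M) L = preForm D (toU D L) M := by
  have key : ∀ N n m (M L : Free I), n + m ≤ N → LengthLE n M → LengthLE m L →
      preForm D (toU D M) L = preForm D (toU D L) M := by
    intro N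
    induction N with
    | zero =>
      intro n m M L hN hM hL
      induction hM with
      | zero => simp [preForm_zero]
      | one => rw [map_one, preForm_one_left, preForm_one_right]
      | add _ _ h1 h2 => rw [map_add, preForm_add, h1 hN, h2 hN, map_add]
      | smul c _ h => rw [map_smul, preForm_smul, h hN, map_smul, smul_eq_mul]
      | mul g hM' _ => omega
    | succ N ih =>
      intro n m M L hN hM hL
      induction hM with
      | zero => simp [preForm_zero]
      | one => rw [map_one, preForm_one_left, preForm_one_right]
      | add _ _ h1 h2 => rw [map_add, preForm_add, h1 hN, h2 hN, map_add]
      | smul c _ h => rw [map_smul, preForm_smul, h hN, map_smul, smul_eq_mul]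
      | @mul k M g hM' hMi =>
        clear hMi
        induction hL with
        | zero => simp [preForm_zero]
        | one => rw [map_one (toU D), preForm_one_left, preForm_one_right]
        | add _ _ h1 h2 => rw [map_add, map_add (toU D), preForm_add, h1 hN, h2 hN]
        | smul c _ h => rw [map_smul, map_smul (toU D), preForm_smul, smul_eq_mul, h hN]
        | mul y hL' _ => exact preForm_symm_step D ih (by omega) hM' hL' g y
  obtain ⟨n, hn⟩ := LengthLE.exists_of_free M
  obtain ⟨m, hm⟩ := LengthLE.exists_of_free L
  exact key _ n m M L le_rfl hn hm

/-- Relations hold automatically in the first argument; symmetry transports them to the second. -/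
theorem preForm_congr (x : UPlus D) {L L' : Free I} (h : toU D L = toU D L') :
    preForm D x L = preForm D x L' := by
  obtain ⟨M, rfl⟩ := toU_surjective D x
  rw [preForm_symm, h, preForm_symm]

/-- The symmetric form on `U_q b̃₊`. -/
def form : UPlus D →ₗ[ℂ] UPlus D →ₗ[ℂ] ℂ :=
  LinearMap.mk₂ ℂ (fun x y => preForm D x (Function.surjInv (toU_surjective D) y))
    (fun x x' y => preForm_add ..) (fun c x y => preForm_smul ..)
    (fun x y y' => by
      rw [← map_add]
      apply preForm_congr
      simp [Function.surjInv_eq])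
    (fun c x y => by
      rw [← map_smul]
      apply preForm_congr
      simp [Function.surjInv_eq])

theorem form_toU (x : UPlus D) (L : Free I) : form D x (toU D L) = preForm D x L :=
  preForm_congr D x (Function.surjInv_eq _ _)

theorem form_symm (x y : UPlus D) : form D x y = form D y x := by
  obtain ⟨M, rfl⟩ := toU_surjective D x
  obtain ⟨L, rfl⟩ := toU_surjective D y
  rw [form_toU, form_toU, preForm_symm]

theorem form_one (x : UPlus D) : form D x 1 = counit D x := by
  rw [← map_one (toU D), form_toU, preForm_one_right]

theorem form_mul_gen (x y : UPlus D) (c : Color I) (n : ℤ) :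
    form D x (y * gen D c n) = form D (der D c n x) y := by
  obtain ⟨L, rfl⟩ := toU_surjective D y
  rw [← toU_ι D (c, n), ← map_mul, form_toU, form_toU, preForm_mul_ι]

theorem form_gen (x : UPlus D) (c : Color I) (n : ℤ) :
    form D x (gen D c n) = counit D (der D c n x) := by
  rw [← one_mul (gen D c n), form_mul_gen, form_one]

theorem form_gen_mul (x y : UPlus D) (c : Color I) (n : ℤ) :
    form D (x * gen D c n) y = form D x (der D c n y) := by
  rw [form_symm, form_mul_gen, form_symm]

/-! ### Homogeneous elements and the Hopf property of the symmetric form -/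

/-- Homogeneous elements for the grading `deg e_α[n] = deg K⁺_α[n] = n`. -/
inductive Homogeneous : ℤ → UPlus D → Prop
  | zero (d : ℤ) : Homogeneous d 0
  | one : Homogeneous 0 1
  | add {d : ℤ} {x y : UPlus D} : Homogeneous d x → Homogeneous d y → Homogeneous d (x + y)
  | smul {d : ℤ} (c : ℂ) {x : UPlus D} : Homogeneous d x → Homogeneous d (c • x)
  | mul {d : ℤ} {x : UPlus D} (c : Color I) (n : ℤ) :
      Homogeneous d x → Homogeneous (d + n) (x * gen D c n)

variable {D}

theorem Homogeneous.sum {ι : Type*} {d : ℤ} (s : Finset ι) (f : ι → UPlus D)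
    (h : ∀ i ∈ s, Homogeneous D d (f i)) : Homogeneous D d (∑ i ∈ s, f i) := by
  classical
  induction s using Finset.induction with
  | empty => exact .zero _
  | insert a s ha ih =>
    rw [Finset.sum_insert ha]
    exact .add (h _ (Finset.mem_insert_self _ _)) (ih fun i hi => h i (Finset.mem_insert_of_mem hi))

theorem Homogeneous.counit_eq_zero {d : ℤ} {x : UPlus D} (h : Homogeneous D d x) :
    d ≠ 0 → counit D x = 0 := by
  induction h with
  | zero d => simp
  | one => simp
  | add _ _ h1 h2 => intro hd; rw [map_add, h1 hd, h2 hd, add_zero]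
  | smul c _ h => intro hd; rw [map_smul, h hd, smul_zero]
  | @mul d x c n _ h =>
    intro hd
    rw [map_mul, counit_gen]
    by_cases hn : n = 0
    · rw [h (by omega), zero_mul]
    · simp [hn]

theorem Homogeneous.der {d : ℤ} {x : UPlus D} (h : Homogeneous D d x) (c : Color I) (m : ℤ) :
    Homogeneous D (d - m) (der D c m x) := by
  classical
  induction h generalizing c m with
  | zero d => rw [map_zero]; exact .zero _
  | one =>
    rw [der_one]
    by_cases h : m = 0
    · subst h
      exact .smul _ .one
    · rw [counit_gen, if_neg h, ite_self, zero_smul]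
      exact .zero _
  | add _ _ h1 h2 => rw [map_add]; exact .add (h1 c m) (h2 c m)
  | smul a _ h => rw [map_smul]; exact .smul a (h c m)
  | @mul d x c' n hx h =>
    obtain ⟨s, hs⟩ := (der_mul_gen D c c' m n x).exists
    rw [hs]
    refine .add ?_ (.sum _ _ fun j _ => .smul _ ?_)
    · split_ifs with h
      · rw [h.2.2, add_sub_cancel_right]
        exact hx
      · exact .zero _
    · have := (h c (m - j)).mul c' (n - j)
      rwa [show d - (m - j) + (n - j) = d + n - m by ring] at this

/-- Every element is a finite sum of homogeneous ones. Independence of the graded pieces is never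
needed. -/
theorem homogeneous_induction {P : UPlus D → Prop} (add : ∀ x y, P x → P y → P (x + y))
    (homogeneous : ∀ d x, Homogeneous D d x → P x) (x : UPlus D) : P x := by
  suffices h : ∃ (s : Finset ℤ) (f : ℤ → UPlus D), (∀ d, Homogeneous D d (f d)) ∧
      x = ∑ d ∈ s, f d by
    obtain ⟨s, f, hf, rfl⟩ := h
    classical
    induction s using Finset.induction with
    | empty => exact homogeneous 0 _ (.zero _)
    | insert a s ha ih =>
      rw [Finset.sum_insert ha]
      exact add _ _ (homogeneous _ _ (hf a)) ih
  classical
  induction x using induction_right with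
  | one =>
    refine ⟨{0}, fun d => if d = 0 then 1 else 0, fun d => ?_, by simp⟩
    dsimp only
    split_ifs with h
    · exact h ▸ .one
    · exact .zero _
  | add x y hx hy =>
    obtain ⟨s, f, hf, rfl⟩ := hx
    obtain ⟨t, g, hg, rfl⟩ := hy
    refine ⟨s ∪ t, fun d => (if d ∈ s then f d else 0) + if d ∈ t then g d else 0,
      fun d => .add ?_ ?_, ?_⟩
    · split_ifs
      exacts [hf d, .zero _]
    · split_ifs
      exacts [hg d, .zero _]
    · rw [Finset.sum_add_distrib]
      simp
  | smul c x hx =>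
    obtain ⟨s, f, hf, rfl⟩ := hx
    exact ⟨s, fun d => c • f d, fun d => .smul c (hf d), Finset.smul_sum⟩
  | mul x c n hx =>
    obtain ⟨s, f, hf, rfl⟩ := hx
    refine ⟨s.map (addRightEmbedding n), fun d => f (d - n) * gen D c n, fun d => ?_, ?_⟩
    · have := (hf (d - n)).mul c n
      rwa [sub_add_cancel] at this
    · rw [Finset.sum_map, Finset.sum_mul]
      simp

variable (D)

/-- `u ⊗ v ↦ ⟨u, z⟩ ⟨v, z'⟩`. -/
def formTensor (z z' : UPlus D) : (UPlus D ⊗[ℂ] UPlus D) →ₗ[ℂ] ℂ :=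
  LinearMap.mul' ℂ ℂ ∘ₗ TensorProduct.map ((form D).flip z) ((form D).flip z')

theorem formTensor_tmul (z z' u v : UPlus D) :
    formTensor D z z' (u ⊗ₜ v) = form D u z * form D v z' := by
  simp [formTensor]

theorem formTensor_mul_gen (z z' : UPlus D) (a : UPlus D ⊗[ℂ] UPlus D) (c c' : Color I)
    (n n' : ℤ) : formTensor D z z' (a * (gen D c n ⊗ₜ gen D c' n')) =
      formTensor D (der D c n z) (der D c' n' z') a := by
  induction a with
  | zero => simp
  | add a b ha hb => rw [add_mul, map_add, ha, hb, map_add]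
  | tmul u v =>
    rw [Algebra.TensorProduct.tmul_mul_tmul, formTensor_tmul, formTensor_tmul, form_gen_mul,
      form_gen_mul]

theorem formTensor_mul_one_gen (z z' : UPlus D) (a : UPlus D ⊗[ℂ] UPlus D) (c : Color I) (n : ℤ) :
    formTensor D z z' (a * (1 ⊗ₜ gen D c n)) = formTensor D z (der D c n z') a := by
  induction a with
  | zero => simp
  | add a b ha hb => rw [add_mul, map_add, ha, hb, map_add]
  | tmul u v =>
    rw [Algebra.TensorProduct.tmul_mul_tmul, formTensor_tmul, formTensor_tmul, form_gen_mul,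
      mul_one]

/-- The Hopf axiom in graded form: right factors in coefficient `k` have degree `k`, so only `k = d`
can pair with `z'`. In the induction, a generator multiplying `x` on the right turns into skew
derivations of `z` and `z'` on one side and of `z * z'` on the other, and these agree by `der_mul`.
-/
theorem formTensor_coproduct (x : UPlus D) (k d : ℤ) (z z' : UPlus D) (h : Homogeneous D d z') :
    formTensor D z z' ((coproduct D x).coeff k) = if k = d then form D x (z * z') else 0 := by
  induction x using induction_right generalizing k d z z' with
  | one =>
    rw [map_one, HahnSeries.coeff_one]
    by_cases hk : k = 0
    · rw [if_pos hk, Algebra.TensorProduct.one_def, formTensor_tmul]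
      simp only [form_symm D 1, form_one, map_mul]
      split_ifs with hd
      · rfl
      · rw [h.counit_eq_zero (by omega), mul_zero]
    · rw [if_neg hk, map_zero]
      split_ifs with hd
      · rw [form_symm, form_one, map_mul, h.counit_eq_zero (by omega), mul_zero]
      · rfl
  | add x y hx hy =>
    rw [map_add, HahnSeries.coeff_add, map_add, hx _ _ _ _ h, hy _ _ _ _ h, map_add]
    split_ifs <;> simp
  | smul c x hx =>
    rw [map_smul, HahnSeries.coeff_smul, map_smul, hx _ _ _ _ h, map_smul]
    split_ifs <;> simp
  | mul x c n hx =>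
    obtain ⟨s, h1, h2, h3⟩ := ((eventually_coeff_mul (coproduct D x) (coproduct D (gen D c n)) k).and
      ((der_mul D c n z z').and (eventually_ge_atTop {n}))).exists
    -- The first summand is the term of index `j` in the Leibniz expansion of the derivative of `z *
    -- z'`. The second comes from `1 ⊗ e[n]`, lives at `j = n` only, and supplies the term `z * der
    -- z'`.
    have h4 : ∀ j, formTensor D z z' ((coproduct D x).coeff (k - j) *
        (coproduct D (gen D c n)).coeff j) =
        (if k = d then form D x (der D c (n - j) z * der D (Sum.inr (cartan c)) j z') else 0) +
        if j = n then (if c.isLeft then if k = d then form D x (z * der D c n z') else 0 else 0)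
          else 0 := by
      intro j
      rw [coproduct_gen_coeff, mul_add, map_add,
        show kel D (cartan c) j = gen D (Sum.inr (cartan c)) j from rfl, formTensor_mul_gen,
        hx _ _ _ _ (h.der _ j)]
      congr 1
      · simp
      · by_cases hj : j = n
        · subst hj
          by_cases hc : c.isLeft
          · simp only [hc, and_self, if_true, formTensor_mul_one_gen]
            rw [hx _ _ _ _ (h.der _ j)]
            simp
          · simp [hc]
        · simp [hj]
    rw [map_mul, h1, map_sum, Finset.sum_congr rfl fun j _ => h4 j, Finset.sum_add_distrib,
      Finset.sum_ite_eq', if_pos (Finset.singleton_subset_iff.1 h3), form_gen_mul, h2, map_add,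
      map_sum, add_comm]
    split_ifs <;> simp

end Plus

end QuantumCurrents

namespace QuantumCurrents

open Filter

variable {I : Type*} (D : Datum I)

/-! ### Values of the form on single generators, and the inverse Cartan currents. -/

namespace Plus

/-- For reasons of degree only the mode `m = d` pairs with an element of degree `d`, so there the
functional summed over all modes equals the pairing with that one mode. -/
theorem form_gen_of_homogeneous {d : ℤ} {x : UPlus D} (h : Homogeneous D d x) (c : Color I)
    (m : ℤ) : form D x (gen D c m) = if d = m then functional D c x else 0 := by
  classical
  rw [form_gen]
  split_ifs with hd
  · subst hd
    induction h with
    | zero d => simp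
    | one =>
      rw [der_one, map_smul, counit_gen, functional_one]
      simp
    | add _ _ h1 h2 => rw [map_add, map_add, map_add, h1, h2]
    | smul a _ h => rw [map_smul, map_smul, map_smul, h]
    | @mul d x c' n hx h =>
      obtain ⟨s, h1, h2⟩ := ((der_mul_gen D c c' (d + n) n x).and (eventually_ge_atTop {n})).exists
      rw [h1, functional_mul, map_add, map_sum, Finset.sum_eq_single n]
      · rw [map_smul, map_mul, add_sub_cancel_right, h, sub_self, counit_gen]
        rcases c' with α | i
        · by_cases hc : c = Sum.inl α
          · subst hc
            by_cases hd : d = 0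
            · subst hd
              simp [gen, functional_e, character_e]
            · simp [gen, functional_e, character_e, hx.counit_eq_zero hd, hd]
          · simp [gen, functional_e, character_e, hc]
        · have : (if c.isLeft ∧ c = Sum.inr i ∧ d + n = n then x else 0) = 0 := by
            rcases c with β | j <;> simp
          rw [this, gen, functional_kel, character_kel]
          by_cases hc : c.isLeft <;> simp [hc, cartan, mul_comm]
      · intro j _ hj
        rw [map_smul, map_mul, counit_gen, if_neg (sub_ne_zero.2 (Ne.symm hj)), ite_self, mul_zero,
          smul_zero]
      · intro h
        exact absurd (Finset.singleton_subset_iff.1 h2) h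
  · exact (h.der c m).counit_eq_zero (sub_ne_zero.2 hd)

variable {D} in
theorem Homogeneous.mul_homogeneous {d d' : ℤ} {x y : UPlus D} (hx : Homogeneous D d x)
    (hy : Homogeneous D d' y) : Homogeneous D (d + d') (x * y) := by
  induction hy with
  | zero d => rw [mul_zero]; exact .zero _
  | one => simpa using hx
  | add _ _ h1 h2 => rw [mul_add]; exact .add h1 h2
  | smul a _ h => rw [mul_smul_comm]; exact .smul a h
  | mul c n _ h => rw [← mul_assoc, ← add_assoc]; exact .mul c n h

theorem homogeneous_gen (c : Color I) (n : ℤ) : Homogeneous D n (gen D c n) := by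
  simpa using Homogeneous.one.mul (D := D) c n

theorem gen_K (α : I) (n : ℕ) : gen D (Sum.inr (Sum.inl α)) n = K D α n := by simp [gen, kel]

theorem gen_Kinv (α : I) : gen D (Sum.inr (Sum.inr α)) 0 = Kinv D α := by simp [gen, kel]

theorem homogeneous_K (α : I) (n : ℕ) : Homogeneous D n (K D α n) :=
  gen_K D α n ▸ homogeneous_gen D _ _

theorem homogeneous_Kinv (α : I) : Homogeneous D 0 (Kinv D α) :=
  gen_Kinv D α ▸ homogeneous_gen D _ _

/-- `K⁺_α(z)`, as a power series in `z⁻¹`. -/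
def KSeries (α : I) : (UPlus D)⟦X⟧ := PowerSeries.mk (K D α)

/-- `K⁺_α(z)⁻¹`, as a power series in `z⁻¹`. -/
def KSeriesInv (α : I) : (UPlus D)⟦X⟧ :=
  PowerSeries.invOfUnit (KSeries D α) ⟨K D α 0, Kinv D α, K_Kinv D α, Kinv_K D α⟩

theorem KSeries_mul_inv (α : I) : KSeries D α * KSeriesInv D α = 1 :=
  PowerSeries.mul_invOfUnit _ _ (by
    rw [← PowerSeries.coeff_zero_eq_constantCoeff_apply, KSeries, PowerSeries.coeff_mk])

theorem KSeriesInv_mul (α : I) : KSeriesInv D α * KSeries D α = 1 :=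
  PowerSeries.invOfUnit_mul _ _ (by
    rw [← PowerSeries.coeff_zero_eq_constantCoeff_apply, KSeries, PowerSeries.coeff_mk])

theorem coeff_zero_KSeriesInv (α : I) : PowerSeries.coeff 0 (KSeriesInv D α) = Kinv D α := by
  simp [KSeriesInv]

theorem commute_KSeriesInv {x : UPlus D} {α : I} (h : ∀ i, Commute x (K D α i)) (i : ℕ) :
    Commute x (PowerSeries.coeff i (KSeriesInv D α)) := by
  have h1 : PowerSeries.C x * KSeries D α = KSeries D α * PowerSeries.C x := by
    ext1 n
    simpa [KSeries] using (h n).eq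
  have h2 : PowerSeries.C x * KSeriesInv D α = KSeriesInv D α * PowerSeries.C x := by
    calc PowerSeries.C x * KSeriesInv D α
        = KSeriesInv D α * (KSeries D α * PowerSeries.C x) * KSeriesInv D α := by
          rw [← mul_assoc, KSeriesInv_mul, one_mul]
      _ = KSeriesInv D α * PowerSeries.C x := by
          rw [← h1, mul_assoc, mul_assoc, KSeries_mul_inv, mul_one]
  have h3 := congrArg (PowerSeries.coeff i) h2
  simp only [PowerSeries.coeff_C_mul, PowerSeries.coeff_mul_C] at h3
  exact h3

theorem homogeneous_KSeriesInv (α : I) (n : ℕ) :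
    Homogeneous D n (PowerSeries.coeff n (KSeriesInv D α)) := by
  induction n using Nat.strong_induction_on with
  | _ n ih =>
    rcases n with _ | n
    · rw [coeff_zero_KSeriesInv]
      exact homogeneous_Kinv D α
    -- Multiplying the coefficient of `K K⁻¹ = 1` by `K[0]⁻¹` isolates the top coefficient of the
    -- inverse series.
    · have h := congrArg (fun p => Kinv D α * PowerSeries.coeff (n + 1) p) (KSeries_mul_inv D α)
      simp only [PowerSeries.coeff_mul, PowerSeries.coeff_one, KSeries, PowerSeries.coeff_mk] at h
      rw [Finset.Nat.sum_antidiagonal_succ, mul_add, ← mul_assoc, Kinv_K, one_mul, if_neg (by omega),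
        mul_zero] at h
      rw [eq_neg_of_add_eq_zero_left h, ← neg_one_smul ℂ]
      refine .smul _ ?_
      rw [← zero_add (((n + 1 : ℕ) : ℤ))]
      refine (homogeneous_Kinv D α).mul_homogeneous (.sum _ _ fun p hp => ?_)
      have hp := Finset.HasAntidiagonal.mem_antidiagonal.1 hp
      have := (homogeneous_K D α (p.1 + 1)).mul_homogeneous (ih p.2 (by omega))
      rwa [← Nat.cast_add, show p.1 + 1 + p.2 = n + 1 by omega] at this

/-- The form uses the kernel of `t⁻¹`, while the pairing must produce that of `t`; the two are
inverse, just as `toPlus` sends `K⁻` to the inverse of `K⁺`. -/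
theorem kernelPlus_mul_inv {t : ℂ} (ht : t ≠ 0) : kernelPlus t⁻¹ * kernelPlus t = 1 := by
  have h1 := kernelPlus_spec ht
  have h2 := kernelPlus_spec (inv_ne_zero ht)
  have h3 : (PowerSeries.C t⁻¹ : ℂ⟦X⟧) * PowerSeries.C t = 1 := by
    rw [← map_mul, inv_mul_cancel₀ ht, map_one]
  have h4 : (PowerSeries.C t - PowerSeries.X : ℂ⟦X⟧) * (PowerSeries.C t⁻¹ - PowerSeries.X) ≠ 0 := by
    intro h
    have := congrArg (PowerSeries.coeff 0) h
    simp [sub_mul, mul_sub, ht] at this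
  apply mul_left_cancel₀ h4
  linear_combination (PowerSeries.C t⁻¹ - PowerSeries.X) * kernelPlus t⁻¹ * h1 +
    (1 - PowerSeries.C t * PowerSeries.X) * h2 + (PowerSeries.X ^ 2 - 1) * h3

theorem character_KSeriesInv (α β : I) (n : ℕ) :
    character D (Sum.inl α) (PowerSeries.coeff n (KSeriesInv D β)) =
      PowerSeries.coeff n (kernelPlus (D.t α β)) := by
  have h1 : PowerSeries.map (character D (Sum.inl α) : UPlus D →+* ℂ) (KSeries D β) =
      kernelPlus (D.t α β)⁻¹ := by
    ext n
    rw [PowerSeries.coeff_map, KSeries, PowerSeries.coeff_mk, RingHom.coe_coe, character_K, kform,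
      D.t_symm]
  have h2 := congrArg (PowerSeries.map (character D (Sum.inl α) : UPlus D →+* ℂ))
    (KSeriesInv_mul D β)
  rw [map_mul, h1, map_one] at h2
  have h3 := left_inv_eq_right_inv h2 (kernelPlus_mul_inv (D.t_ne_zero α β))
  rw [← h3, PowerSeries.coeff_map, RingHom.coe_coe]

/-- The functional of `e_α` vanishes on `1` and on each `K⁺_β[n]`; the product rule applied to `K
K⁻¹ = 1` transfers this to the inverse current. -/
theorem functional_inl_KSeriesInv (α β : I) (n : ℕ) :
    functional D (Sum.inl α) (PowerSeries.coeff n (KSeriesInv D β)) = 0 := by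
  have h := congrArg (fun p => functional D (Sum.inl α) (PowerSeries.coeff n p))
    (KSeries_mul_inv D β)
  simp only [PowerSeries.coeff_mul, map_sum, functional_mul, KSeries, PowerSeries.coeff_mk,
    Sum.isLeft_inl, if_true, ← gen_K, gen, functional_kel, zero_mul, add_zero, counit_kel] at h
  -- The counit kills `K[i]` for `i > 0`, so one term of the convolution survives.
  rw [Finset.sum_eq_single (0, n)] at h
  · rw [PowerSeries.coeff_one] at h
    have h0 : functional D (Sum.inl α) (if n = 0 then (1 : UPlus D) else 0) = 0 := by
      split_ifs <;> simp [functional_one]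
    rw [h0] at h
    simpa using h
  · intro p hp hne
    have hp := Finset.HasAntidiagonal.mem_antidiagonal.1 hp
    rw [if_neg, zero_mul]
    intro h
    exact hne (Prod.ext (by simpa using h) (by simp at h; simp; omega))
  · intro h
    exact absurd (Finset.HasAntidiagonal.mem_antidiagonal.2 (by simp)) h

/-- The coproduct of the inverse of a group-like current. -/
theorem coproduct_KSeriesInv (α : I) (n : ℕ) : coproduct D (PowerSeries.coeff n (KSeriesInv D α)) =
    ∑ p ∈ Finset.HasAntidiagonal.antidiagonal n, HahnSeries.single (p.2 : ℤ)
      (PowerSeries.coeff p.1 (KSeriesInv D α) ⊗ₜ[ℂ] PowerSeries.coeff p.2 (KSeriesInv D α)) := by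
  have h1 : PowerSeries.map (coproduct D : UPlus D →+* HahnSeries ℤ (UPlus D ⊗[ℂ] UPlus D)) (KSeries D α) =
      auxM (PowerSeries.map (inL D : UPlus D →+* UPlus D ⊗[ℂ] UPlus D) (KSeries D α))
      (PowerSeries.map (inR D : UPlus D →+* UPlus D ⊗[ℂ] UPlus D) (KSeries D α)) := by
    rw [KSeries, ← coproductK_eq]
    ext1 n
    rw [PowerSeries.coeff_map, PowerSeries.coeff_mk, PowerSeries.coeff_mk, RingHom.coe_coe,
      coproduct_K]
  have h2 := congrArg (PowerSeries.map (coproduct D : UPlus D →+* HahnSeries ℤ (UPlus D ⊗[ℂ] UPlus D))) (KSeriesInv_mul D α)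
  rw [map_mul, map_one, h1] at h2
  have h3 : auxM (PowerSeries.map (inL D : UPlus D →+* UPlus D ⊗[ℂ] UPlus D) (KSeries D α))
      (PowerSeries.map (inR D : UPlus D →+* UPlus D ⊗[ℂ] UPlus D) (KSeries D α)) *
      auxM (PowerSeries.map (inL D : UPlus D →+* UPlus D ⊗[ℂ] UPlus D) (KSeriesInv D α))
      (PowerSeries.map (inR D : UPlus D →+* UPlus D ⊗[ℂ] UPlus D) (KSeriesInv D α)) = 1 := by
    rw [auxM_mul, ← map_mul, ← map_mul, KSeries_mul_inv, map_one, map_one, auxM_one]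
    intro i j
    rw [PowerSeries.coeff_map, PowerSeries.coeff_map]
    exact inL_inR D _ _
  have h4 := congrArg (PowerSeries.coeff n) (left_inv_eq_right_inv h2 h3)
  rw [PowerSeries.coeff_map, RingHom.coe_coe] at h4
  rw [h4]
  simp [auxM, inL_apply, inR_apply]

end Plus

/-! ### The morphism from the minus half to the plus half. -/

namespace Minus

variable {D} in
theorem induction_gen {P : UMinus D → Prop} (one : P 1) (add : ∀ x y, P x → P y → P (x + y))
    (smul : ∀ (c : ℂ) x, P x → P (c • x)) (mul : ∀ x y, P x → P y → P (x * y))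
    (hf : ∀ α n, P (f D α n)) (hK : ∀ α n, P (K D α n)) (hKinv : ∀ α, P (Kinv D α))
    (x : UMinus D) : P x := by
  obtain ⟨y, rfl⟩ := RingQuot.mkAlgHom_surjective ℂ (Rel D) x
  change P (proj D y)
  induction y using FreeAlgebra.induction with
  | grade0 r => rw [AlgHom.commutes, Algebra.algebraMap_eq_smul_one]; exact smul _ _ one
  | grade1 g =>
    rcases g with ⟨α, n⟩ | ⟨α, n⟩ | ⟨α⟩
    exacts [hf α n, hK α n, hKinv α]
  | mul a b ha hb => rw [map_mul]; exact mul _ _ ha hb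
  | add a b ha hb => rw [map_add]; exact add _ _ ha hb

section Lift

variable {S : Type*} [Ring S] [Algebra ℂ S] (xf : I → ℤ → S) (xK : I → ℕ → S) (xKinv : I → S)
    (h1 : ∀ α β, AuxVR (D.t α β)⁻¹ (xf α) (xf β))
    (h2 : ∀ α β n m, xK α n * xK β m = xK β m * xK α n)
    (h3 : ∀ α, xK α 0 * xKinv α = 1) (h4 : ∀ α, xKinv α * xK α 0 = 1)
    (h5 : ∀ α β, AuxMR (D.t α β)⁻¹ (PowerSeries.mk (xK α)) (fun n => xf β (-n)))

theorem lift_f (α : I) (n : ℤ) : lift D xf xK xKinv h1 h2 h3 h4 h5 (f D α n) = xf α n := by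
  unfold lift f proj ff
  erw [RingQuot.liftAlgHom_mkAlgHom_apply]
  simp

theorem lift_K (α : I) (n : ℕ) : lift D xf xK xKinv h1 h2 h3 h4 h5 (K D α n) = xK α n := by
  unfold lift K proj fK
  erw [RingQuot.liftAlgHom_mkAlgHom_apply]
  simp

theorem lift_Kinv (α : I) : lift D xf xK xKinv h1 h2 h3 h4 h5 (Kinv D α) = xKinv α := by
  unfold lift Kinv proj fKinv
  erw [RingQuot.liftAlgHom_mkAlgHom_apply]
  simp

end Lift

theorem counit_f (α : I) (n : ℤ) : counit D (f D α n) = 0 := lift_f ..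

theorem counit_K (α : I) (n : ℕ) : counit D (K D α n) = if n = 0 then 1 else 0 := lift_K ..

theorem counit_Kinv (α : I) : counit D (Kinv D α) = 1 := lift_Kinv ..

/-- The morphism `f_α(z) ↦ e_α(z⁻¹)`, `K⁻_α(z) ↦ K⁺_α(z⁻¹)⁻¹`. -/
def toPlus : UMinus D →ₐ[ℂ] UPlus D :=
  lift D (fun α n => Plus.e D α (-n)) (fun α n => PowerSeries.coeff n (Plus.KSeriesInv D α))
    (fun α => Plus.K D α 0)
    (fun α β => AuxVR.neg (inv_ne_zero (D.t_ne_zero α β)) (by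
      rw [inv_inv]
      exact Plus.vertex D α β))
    (fun α β n m => (Plus.commute_KSeriesInv D (fun b =>
      (Plus.commute_KSeriesInv D (fun a => Plus.K_K D β α b a) n).symm) m).eq)
    (fun α => by rw [Plus.coeff_zero_KSeriesInv, Plus.Kinv_K])
    (fun α => by rw [Plus.coeff_zero_KSeriesInv, Plus.K_Kinv])
    (fun α β => by
      simp only [neg_neg]
      rw [show (PowerSeries.mk fun n => PowerSeries.coeff n (Plus.KSeriesInv D α)) =
        Plus.KSeriesInv D α from PowerSeries.ext fun n => PowerSeries.coeff_mk _ _]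
      refine AuxMR.inverse (M := Plus.KSeries D α) (inv_ne_zero (D.t_ne_zero α β))
        (Plus.KSeries_mul_inv D α) (Plus.KSeriesInv_mul D α) ?_
      rw [inv_inv]
      exact Plus.K_e_series D α β)

theorem toPlus_f (α : I) (n : ℤ) : toPlus D (f D α n) = Plus.e D α (-n) := lift_f ..

theorem toPlus_K (α : I) (n : ℕ) :
    toPlus D (K D α n) = PowerSeries.coeff n (Plus.KSeriesInv D α) := lift_K ..

theorem toPlus_Kinv (α : I) : toPlus D (Kinv D α) = Plus.K D α 0 := lift_Kinv ..

theorem toPlus_KSeriesInv (α : I) (n : ℕ) :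
    toPlus D (PowerSeries.coeff n (KSeriesInv D α)) = Plus.K D α n := by
  have h1 : PowerSeries.map (toPlus D : UMinus D →+* UPlus D) (KSeries D α) =
      Plus.KSeriesInv D α := by
    ext1 n
    rw [PowerSeries.coeff_map, KSeries, PowerSeries.coeff_mk, RingHom.coe_coe, toPlus_K]
  have h2 := congrArg (PowerSeries.map (toPlus D : UMinus D →+* UPlus D)) (KSeriesInv_mul D α)
  rw [map_mul, h1, map_one] at h2
  have h3 := congrArg (PowerSeries.coeff n)
    (left_inv_eq_right_inv h2 (Plus.KSeriesInv_mul D α))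
  rwa [PowerSeries.coeff_map, RingHom.coe_coe, Plus.KSeries, PowerSeries.coeff_mk] at h3

theorem counit_toPlus (y : UMinus D) : Plus.counit D (toPlus D y) = counit D y := by
  induction y using induction_gen with
  | one => simp
  | add x y hx hy => simp [hx, hy]
  | smul c x hx => simp [hx]
  | mul x y hx hy => simp [hx, hy]
  | hf α n => rw [toPlus_f, counit_f, Plus.counit_e]
  | hK α n =>
    have h1 : PowerSeries.map (Plus.counit D : UPlus D →+* ℂ) (Plus.KSeries D α) = 1 := by
      ext n
      rw [PowerSeries.coeff_map, Plus.KSeries, PowerSeries.coeff_mk, RingHom.coe_coe, Plus.counit_K,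
        PowerSeries.coeff_one]
    have h2 := congrArg (fun p => PowerSeries.coeff n
      (PowerSeries.map (Plus.counit D : UPlus D →+* ℂ) p)) (Plus.KSeriesInv_mul D α)
    simp only [map_mul, h1, mul_one, map_one] at h2
    rw [PowerSeries.coeff_map, RingHom.coe_coe, PowerSeries.coeff_one] at h2
    rw [toPlus_K, h2, counit_K]
  | hKinv α => rw [toPlus_Kinv, counit_Kinv, Plus.counit_K, if_pos rfl]

/-- `toPlus ⊗ toPlus` followed by the exchange of the factors. -/
def toPlusTensor : UMinus D ⊗[ℂ] UMinus D →ₐ[ℂ] UPlus D ⊗[ℂ] UPlus D :=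
  (Algebra.TensorProduct.map (toPlus D) (toPlus D)).comp
    (Algebra.TensorProduct.comm ℂ (UMinus D) (UMinus D)).toAlgHom

theorem toPlusTensor_tmul (u v : UMinus D) :
    toPlusTensor D (u ⊗ₜ v) = toPlus D v ⊗ₜ toPlus D u := by simp [toPlusTensor]

/-- Checked on generators, both sides being multiplicative. The powers of `τ` match without any
reindexing: they record minus the degree of the left factor for `Δ₋` and the degree of the right
factor for `Δ₊`, while `toPlus` reverses degrees and the factors are exchanged. -/
theorem coproduct_toPlus (y : UMinus D) (k : ℤ) :
    (Plus.coproduct D (toPlus D y)).coeff k = toPlusTensor D ((coproduct D y).coeff k) := by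
  induction y using induction_gen generalizing k with
  | one =>
    simp only [map_one, HahnSeries.coeff_one]
    split_ifs <;> simp
  | add x y hx hy => simp [hx, hy]
  | smul c x hx => simp [hx]
  | mul x y hx hy =>
    obtain ⟨s, h1, h2⟩ := ((eventually_coeff_mul (coproduct D x) (coproduct D y) k).and
      (eventually_coeff_mul (Plus.coproduct D (toPlus D x)) (Plus.coproduct D (toPlus D y))
        k)).exists
    rw [map_mul, map_mul, map_mul, h1, h2, map_sum]
    simp [hx, hy]
  | hf α n =>
    rw [toPlus_f, coproduct_f, coproductF, Plus.coproduct_e, Plus.coproductE, add_comm,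
      HahnSeries.coeff_add, HahnSeries.coeff_add, map_add]
    congr 1
    · rw [HahnSeries.coeff_single, HahnSeries.coeff_single]
      split_ifs
      · rw [toPlusTensor_tmul, toPlus_f, map_one]
      · simp
    · rcases lt_or_ge k 0 with hk | hk
      · rw [ofPS_coeff_neg _ _ hk, ofPS_coeff_neg _ _ hk, map_zero]
      · lift k to ℕ using hk
        rw [HahnSeries.ofPowerSeries_apply_coeff, HahnSeries.ofPowerSeries_apply_coeff,
          PowerSeries.coeff_mk, PowerSeries.coeff_mk, toPlusTensor_tmul, toPlus_f,
          toPlus_KSeriesInv, neg_add']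
  | hK α n =>
    rw [toPlus_K, coproduct_K, coproductK, Plus.coproduct_KSeriesInv,
      ← Finset.Nat.sum_antidiagonal_swap, HahnSeries.coeff_sum, HahnSeries.coeff_sum, map_sum]
    refine Finset.sum_congr rfl fun p _ => ?_
    simp only [Prod.fst_swap, Prod.snd_swap, HahnSeries.coeff_single]
    split_ifs
    · rw [toPlusTensor_tmul, toPlus_K, toPlus_K]
    · simp
  | hKinv α =>
    rw [toPlus_Kinv, coproduct_Kinv, Plus.coproduct_K, Plus.coproductK]
    simp only [Finset.HasAntidiagonal.antidiagonal_zero, Finset.sum_singleton, Nat.cast_zero,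
      HahnSeries.coeff_single]
    split_ifs
    · rw [toPlusTensor_tmul, toPlus_Kinv]
    · simp

end Minus

/-! ### The Hopf pairing -/

open Plus Minus

/-- The Hopf pairing between `U_q b̃₊` and `U_q b̃₋`. -/
def pairing : UPlus D →ₗ[ℂ] UMinus D →ₗ[ℂ] ℂ := (form D).compl₂ (toPlus D).toLinearMap

theorem pairing_apply (x : UPlus D) (y : UMinus D) : pairing D x y = form D x (toPlus D y) := rfl

theorem formTensor_add_right (z z' z'' : UPlus D) (a : UPlus D ⊗[ℂ] UPlus D) :
    formTensor D z (z' + z'') a = formTensor D z z' a + formTensor D z z'' a := by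
  simp [formTensor, TensorProduct.map_add_right]

/-- For homogeneous `z'` a single coefficient contributes; the general case is a finite sum of such,
which also gives the finiteness required of a Hopf pairing. -/
theorem finsum_formTensor_coproduct (x z z' : UPlus D) :
    {k : ℤ | formTensor D z z' ((Plus.coproduct D x).coeff k) ≠ 0}.Finite ∧
      form D x (z * z') = ∑ᶠ k : ℤ, formTensor D z z' ((Plus.coproduct D x).coeff k) := by
  induction z' using homogeneous_induction with
  | homogeneous d z' h =>
    simp only [fun k => formTensor_coproduct D x k d z z' h]
    refine ⟨(Set.finite_singleton d).subset fun k hk => ?_, ?_⟩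
    · by_contra hne
      exact hk (if_neg hne)
    · rw [finsum_eq_single _ d fun k hk => if_neg hk, if_pos rfl]
  | add z' z'' h h' =>
    simp only [formTensor_add_right]
    refine ⟨(h.1.union h'.1).subset fun k hk => ?_, ?_⟩
    · by_contra hne
      rw [Set.mem_union, not_or] at hne
      simp only [Set.mem_ofPred_eq, not_not] at hne
      exact hk (by rw [hne.1, hne.2, add_zero])
    · rw [finsum_add_distrib h.1 h'.1, ← h.2, ← h'.2, mul_add, map_add]

theorem tensorPairing_right (a : UPlus D ⊗[ℂ] UPlus D) (y y' : UMinus D) :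
    tensorPairing D (pairing D) a (y ⊗ₜ y') = formTensor D (toPlus D y) (toPlus D y') a := by
  induction a with
  | zero => simp
  | add a b ha hb => rw [map_add, LinearMap.add_apply, ha, hb, map_add]
  | tmul u v => rw [tensorPairing_tmul, formTensor_tmul, pairing_apply, pairing_apply]

theorem tensorPairing_coproductOp (x x' : UPlus D) (y : UMinus D) (k : ℤ) :
    tensorPairing D (pairing D) (x ⊗ₜ x') ((coproductOp D y).coeff k) =
      formTensor D x x' ((Plus.coproduct D (toPlus D y)).coeff k) := by
  rw [coproduct_toPlus, coproductOp, HahnSeries.map_coeff]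
  generalize (Minus.coproduct D y).coeff k = b
  induction b with
  | zero => simp
  | add a b ha hb => rw [map_add, map_add, ha, hb, map_add, map_add]
  | tmul u v =>
    rw [TensorProduct.comm_tmul, tensorPairing_tmul, toPlusTensor_tmul, formTensor_tmul,
      pairing_apply, pairing_apply, form_symm D x, form_symm D x']

theorem isHopfPairing_pairing : IsHopfPairing (pairing D) where
  apply_one x := by rw [pairing_apply, map_one, form_one]
  one_apply y := by rw [pairing_apply, form_symm, form_one, counit_toPlus]
  finite_apply_mul x y y' := by
    simp only [tensorPairing_right]
    exact (finsum_formTensor_coproduct D x _ _).1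
  apply_mul x y y' := by
    simp only [tensorPairing_right]
    rw [pairing_apply, map_mul]
    exact (finsum_formTensor_coproduct D x _ _).2
  finite_mul_apply x x' y := by
    simp only [tensorPairing_coproductOp]
    exact (finsum_formTensor_coproduct D (toPlus D y) x x').1
  mul_apply x x' y := by
    simp only [tensorPairing_coproductOp]
    rw [pairing_apply, form_symm]
    exact (finsum_formTensor_coproduct D (toPlus D y) x x').2

theorem hasGeneratorValues_pairing : HasGeneratorValues (pairing D) where
  K_K α β n m := by
    rw [pairing_apply, form_symm, ← gen_K, toPlus_K,
      form_gen_of_homogeneous D (homogeneous_KSeriesInv D β m), functional_inr,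
      character_KSeriesInv]
    by_cases h : n = m
    · simp [h]
    · rw [if_neg (by omega), if_neg h]
  e_f α β n m := by
    rw [pairing_apply, toPlus_f, show Plus.e D β (-m) = gen D (Sum.inl β) (-m) from rfl, form_gen,
      show Plus.e D α n = gen D (Sum.inl α) n from rfl, der_gen]
    by_cases h : α = β ∧ n + m = 0
    · rw [if_pos h, if_pos ⟨rfl, by rw [h.1], by omega⟩]
      simp
    · rw [if_neg h, if_neg]
      · simp
      · rintro ⟨_, h1, h2⟩
        exact h ⟨(Sum.inl.inj h1).symm, by omega⟩
  K_f α β n m := by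
    rw [pairing_apply, toPlus_f, show Plus.e D β (-m) = gen D (Sum.inl β) (-m) from rfl, form_gen,
      ← gen_K, der_gen]
    simp
  e_K α β n m := by
    rw [pairing_apply, form_symm, show Plus.e D α n = gen D (Sum.inl α) n from rfl, toPlus_K,
      form_gen_of_homogeneous D (homogeneous_KSeriesInv D β m), functional_inl_KSeriesInv, ite_self]

end QuantumCurrents

namespace QuantumCurrents

open Filter Plus Minus

variable {I : Type*} {D : Datum I}

/-! ### Uniqueness of the Hopf pairing -/

section Unique

variable {φ ψ : UPlus D →ₗ[ℂ] UMinus D →ₗ[ℂ] ℂ}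

/-- Only generators occur on the right-hand side, so the pairings of all generators with `y` can be
determined simultaneously by induction on `y`. -/
theorem IsHopfPairing.gen_mul (h : IsHopfPairing φ) (c : Color I) (n : ℤ) (y y' : UMinus D) :
    φ (gen D c n) (y * y') = ∑ᶠ k : ℤ, (φ (gen D c (n - k)) y * φ (kel D (cartan c) k) y' +
      if c.isLeft ∧ k = n then Minus.counit D y * φ (gen D c n) y' else 0) := by
  rw [h.apply_mul]
  refine finsum_congr fun k => ?_
  rw [coproduct_gen_coeff, map_add, LinearMap.add_apply, tensorPairing_tmul]
  congr 1
  split_ifs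
  · rw [tensorPairing_tmul, h.one_apply]
  · simp

theorem HasGeneratorValues.kel_K_zero (h : HasGeneratorValues φ) (α β : I) (n : ℤ) :
    φ (kel D (Sum.inl α) n) (Minus.K D β 0) = if n = 0 then (D.t α β)⁻¹ else 0 := by
  rw [kel]
  split_ifs with h1 h2 h2
  · rw [h2, Int.toNat_zero, h.K_K, if_pos rfl, coeff_zero_kernelPlus (D.t_ne_zero α β)]
  · rw [h.K_K, if_neg (by omega)]
  · omega
  · simp

/-- The prescribed values say nothing about `K[0]⁻¹`. Here and in the next lemmas they are forced by
expanding the pairing with `K[0] K[0]⁻¹ = 1`. -/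
theorem IsHopfPairing.kel_Kinv (h : IsHopfPairing φ) (hg : HasGeneratorValues φ) (α β : I) (n : ℤ) :
    φ (kel D (Sum.inl α) n) (Minus.Kinv D β) = if n = 0 then D.t α β else 0 := by
  have h1 := h.gen_mul (Sum.inr (Sum.inl α)) n (Minus.K D β 0) (Minus.Kinv D β)
  rw [Minus.K_Kinv, h.apply_one, counit_gen, finsum_eq_single _ n] at h1
  · simp only [gen, sub_self, hg.kel_K_zero] at h1
    simp only [cartan, if_true, Sum.isLeft_inr, Bool.false_eq_true, if_false, false_and,
      add_zero] at h1
    rw [← mul_right_inj' (inv_ne_zero (D.t_ne_zero α β)), ← h1]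
    split_ifs <;> simp [D.t_ne_zero]
  · intro k hk
    simp only [gen, hg.kel_K_zero]
    simp [sub_eq_zero, hk.symm]

theorem IsHopfPairing.e_Kinv (h : IsHopfPairing φ) (hg : HasGeneratorValues φ) (α β : I) (n : ℤ) :
    φ (Plus.e D α n) (Minus.Kinv D β) = 0 := by
  have h1 := h.gen_mul (Sum.inl α) n (Minus.K D β 0) (Minus.Kinv D β)
  rw [Minus.K_Kinv, h.apply_one, counit_gen, finsum_eq_single _ n] at h1
  · simpa [gen, hg.e_K, Minus.counit_K] using h1.symm
  · intro k hk
    simp [gen, hg.e_K, hk]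

theorem IsHopfPairing.Kinv_K (h : IsHopfPairing φ) (hg : HasGeneratorValues φ) (α β : I) (m : ℕ) :
    φ (Plus.Kinv D α) (Minus.K D β m) = if m = 0 then D.t α β else 0 := by
  have h1 := h.mul_apply (Plus.K D α 0) (Plus.Kinv D α) (Minus.K D β m)
  have h2 : ∀ k : ℤ, tensorPairing D φ (Plus.K D α 0 ⊗ₜ[ℂ] Plus.Kinv D α)
      ((coproductOp D (Minus.K D β m)).coeff k) =
      if k = m then (D.t α β)⁻¹ * φ (Plus.Kinv D α) (Minus.K D β m) else 0 := by
    intro k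
    rw [coproductOp, HahnSeries.map_coeff, Minus.coproduct_K, Minus.coproductK,
      HahnSeries.coeff_sum, map_sum, map_sum, Finset.sum_eq_single (m, 0)]
    · simp only [HahnSeries.coeff_single]
      split_ifs
      · rw [TensorProduct.comm_tmul, tensorPairing_tmul, hg.K_K, if_pos rfl,
          coeff_zero_kernelPlus (D.t_ne_zero α β)]
      · simp
    · intro p hp hne
      have hp := Finset.HasAntidiagonal.mem_antidiagonal.1 hp
      simp only [HahnSeries.coeff_single]
      split_ifs
      · rw [TensorProduct.comm_tmul, tensorPairing_tmul, hg.K_K, if_neg, zero_mul]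
        intro h0
        exact hne (Prod.ext (by simp; omega) (by simp; omega))
      · simp
    · intro h
      exact absurd (Finset.HasAntidiagonal.mem_antidiagonal.2 (by simp)) h
  rw [Plus.K_Kinv, h.one_apply, Minus.counit_K, finsum_congr h2,
    finsum_eq_single _ (m : ℤ) (fun k hk => if_neg hk), if_pos rfl] at h1
  rw [← mul_right_inj' (inv_ne_zero (D.t_ne_zero α β)), ← h1]
  split_ifs <;> simp [D.t_ne_zero]

theorem IsHopfPairing.Kinv_f (h : IsHopfPairing φ) (hg : HasGeneratorValues φ) (α β : I) (m : ℤ) :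
    φ (Plus.Kinv D α) (Minus.f D β m) = 0 := by
  have h1 := h.mul_apply (Plus.K D α 0) (Plus.Kinv D α) (Minus.f D β m)
  have h2 : ∀ k : ℤ, tensorPairing D φ (Plus.K D α 0 ⊗ₜ[ℂ] Plus.Kinv D α)
      ((coproductOp D (Minus.f D β m)).coeff k) =
      if k = -m then φ (Plus.Kinv D α) (Minus.f D β m) else 0 := by
    intro k
    rw [coproductOp, HahnSeries.map_coeff, Minus.coproduct_f, Minus.coproductF,
      HahnSeries.coeff_add, map_add, map_add]
    have h3 : tensorPairing D φ (Plus.K D α 0 ⊗ₜ[ℂ] Plus.Kinv D α)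
      (TensorProduct.comm ℂ (UMinus D) (UMinus D) ((HahnSeries.ofPowerSeries ℤ _
        (PowerSeries.mk fun k => PowerSeries.coeff k (Minus.KSeriesInv D β) ⊗ₜ[ℂ]
          Minus.f D β (m + k))).coeff k)) = 0 := by
      rcases lt_or_ge k 0 with hk | hk
      · rw [ofPS_coeff_neg _ _ hk, map_zero, map_zero]
      · lift k to ℕ using hk
        rw [HahnSeries.ofPowerSeries_apply_coeff, PowerSeries.coeff_mk, TensorProduct.comm_tmul,
          tensorPairing_tmul, hg.K_f, zero_mul]
    rw [h3, add_zero, HahnSeries.coeff_single]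
    split_ifs
    · rw [TensorProduct.comm_tmul, tensorPairing_tmul, h.apply_one, Plus.counit_K, if_pos rfl,
        one_mul]
    · simp
  rw [Plus.K_Kinv, h.one_apply, Minus.counit_f, finsum_congr h2,
    finsum_eq_single _ (-m) (fun k hk => if_neg hk), if_pos rfl] at h1
  exact h1.symm

theorem IsHopfPairing.Kinv_Kinv (h : IsHopfPairing φ) (hg : HasGeneratorValues φ) (α β : I) :
    φ (Plus.Kinv D α) (Minus.Kinv D β) = (D.t α β)⁻¹ := by
  have h1 := h.gen_mul (Sum.inr (Sum.inr α)) 0 (Minus.K D β 0) (Minus.Kinv D β)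
  rw [Minus.K_Kinv, h.apply_one, counit_gen, finsum_eq_single _ 0] at h1
  · simp only [gen, kel, cartan, sub_self, if_true, h.Kinv_K hg] at h1
    simp only [Sum.isLeft_inr, Bool.false_eq_true, if_false, false_and, add_zero] at h1
    exact eq_inv_of_mul_eq_one_right h1.symm
  · intro k hk
    simp [cartan, kel, hk]

/-- Generators against arbitrary `y` are settled first, by splitting products in `y`; arbitrary `x`
then follows by splitting off its last generator. -/
theorem IsHopfPairing.unique (hφ : IsHopfPairing φ) (gφ : HasGeneratorValues φ)
    (hψ : IsHopfPairing ψ) (gψ : HasGeneratorValues ψ) : φ = ψ := by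
  have key : ∀ (y : UMinus D) (c : Color I) (n : ℤ), φ (gen D c n) y = ψ (gen D c n) y := by
    intro y
    induction y using induction_gen with
    | one => intro c n; rw [hφ.apply_one, hψ.apply_one]
    | add x y hx hy => intro c n; rw [map_add, map_add, hx, hy]
    | smul a x hx => intro c n; rw [map_smul, map_smul, hx]
    | mul x y hx hy =>
      intro c n
      rw [hφ.gen_mul, hψ.gen_mul]
      refine finsum_congr fun k => ?_
      rw [hx, hy, show kel D (cartan c) k = gen D (Sum.inr (cartan c)) k from rfl, hy]
    | hf β m =>
      rintro (α | α | α) n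
      · simp only [gen]
        rw [gφ.e_f, gψ.e_f]
      · simp only [gen, kel]
        split_ifs
        · rw [gφ.K_f, gψ.K_f]
        · simp
      · simp only [gen, kel]
        split_ifs
        · rw [hφ.Kinv_f gφ, hψ.Kinv_f gψ]
        · simp
    | hK β m =>
      rintro (α | α | α) n
      · simp only [gen]
        rw [gφ.e_K, gψ.e_K]
      · simp only [gen, kel]
        split_ifs
        · rw [gφ.K_K, gψ.K_K]
        · simp
      · simp only [gen, kel]
        split_ifs
        · rw [hφ.Kinv_K gφ, hψ.Kinv_K gψ]
        · simp
    | hKinv β =>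
      rintro (α | α | α) n
      · simp only [gen]
        rw [hφ.e_Kinv gφ, hψ.e_Kinv gψ]
      · simp only [gen]
        rw [hφ.kel_Kinv gφ, hψ.kel_Kinv gψ]
      · simp only [gen, kel]
        split_ifs
        · rw [hφ.Kinv_Kinv gφ, hψ.Kinv_Kinv gψ]
        · simp
  ext x y
  induction x using induction_right generalizing y with
  | one => rw [hφ.one_apply, hψ.one_apply]
  | add x x' hx hx' => simp only [map_add, LinearMap.add_apply, hx, hx']
  | smul a x hx => simp only [map_smul, LinearMap.smul_apply, hx]
  | mul x c n hx =>
    rw [hφ.mul_apply, hψ.mul_apply]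
    refine finsum_congr fun k => ?_
    induction (coproductOp D y).coeff k with
    | zero => simp
    | add a b ha hb => rw [map_add, map_add, ha, hb]
    | tmul u v => rw [tensorPairing_tmul, tensorPairing_tmul, hx, key]

end Unique

/-! ### The radical is a two-sided ideal -/

/-- By symmetry and the Hopf axiom, pairing with a product factors through pairings with each of its
factors, one of which is `x`. -/
theorem form_mul_eq_zero {x : UPlus D} (hx : ∀ y, form D x y = 0) (a b z : UPlus D) :
    form D (a * x * b) z = 0 := by
  have h1 : ∀ z, form D (a * x) z = 0 := fun z => by
    rw [form_symm, (finsum_formTensor_coproduct D z a x).2]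
    refine finsum_eq_zero_of_forall_eq_zero fun k => ?_
    induction (Plus.coproduct D z).coeff k with
    | zero => simp
    | add u v hu hv => rw [map_add, hu, hv, add_zero]
    | tmul u v => rw [formTensor_tmul, form_symm D v, hx, mul_zero]
  rw [form_symm, (finsum_formTensor_coproduct D z (a * x) b).2]
  refine finsum_eq_zero_of_forall_eq_zero fun k => ?_
  induction (Plus.coproduct D z).coeff k with
  | zero => simp
  | add u v hu hv => rw [map_add, hu, hv, add_zero]
  | tmul u v => rw [formTensor_tmul, form_symm D u, h1, zero_mul]

theorem form_eq_zero_of_mem_span {S : Set (UPlus D)} (hS : ∀ x ∈ S, ∀ y, form D x y = 0)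
    {x : UPlus D} (hx : x ∈ TwoSidedIdeal.span S) : ∀ y, form D x y = 0 := by
  induction hx using TwoSidedIdeal.span_induction with
  | mem x h => exact hS x h
  | zero => simp
  | add x y _ _ hx hy => simp [hx, hy]
  | neg x _ hx => simp [hx]
  | left_absorb a x _ h => simpa using form_mul_eq_zero h a 1
  | right_absorb a x _ h => simpa using form_mul_eq_zero h 1 a

/-- The ideal of the minus half is handled inside the plus half: `toPlus` is multiplicative, so
multiples map to multiples. -/
theorem form_toPlus_eq_zero_of_mem_span {S : Set (UMinus D)}
    (hS : ∀ y ∈ S, ∀ x, form D (toPlus D y) x = 0) {y : UMinus D}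
    (hy : y ∈ TwoSidedIdeal.span S) : ∀ x, form D (toPlus D y) x = 0 := by
  induction hy using TwoSidedIdeal.span_induction with
  | mem x h => exact hS x h
  | zero => simp
  | add x y _ _ hx hy => simp [hx, hy]
  | neg x _ hx => simp [hx]
  | left_absorb a x _ h => simpa using form_mul_eq_zero h (toPlus D a) 1
  | right_absorb a x _ h => simpa using form_mul_eq_zero h 1 (toPlus D a)

end QuantumCurrents

namespace QuantumCurrents

open Filter Plus

/-! ### Laurent polynomials in labelled variables -/

section Laurent

variable {ι : Type*} [DecidableEq ι]

/-- Laurent polynomials in variables labelled by `ι`. -/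
abbrev Laurent (ι : Type*) := AddMonoidAlgebra ℂ (ι → ℤ)

/-- The monomial with exponents `m`. -/
def mono (m : ι → ℤ) : Laurent ι := AddMonoidAlgebra.single m 1

omit [DecidableEq ι] in
theorem mono_mul (m m' : ι → ℤ) : mono m * mono m' = mono (m + m') := by
  simp [mono, AddMonoidAlgebra.single_mul_single]

omit [DecidableEq ι] in
theorem mono_zero : mono (0 : ι → ℤ) = 1 := rfl

omit [DecidableEq ι] in
theorem mono_pow (m : ι → ℤ) (n : ℕ) : mono m ^ n = mono (n • m) := by
  simp [mono, AddMonoidAlgebra.single_pow]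

/-- The variable labelled by `j`. -/
def var (j : ι) : Laurent ι := mono (Pi.single j 1)

/-- The Laurent polynomials that are homogeneous of degree `d` in the variable `j`. -/
def homogeneousIn (j : ι) (d : ℤ) : Submodule ℂ (Laurent ι) :=
  Submodule.span ℂ {p | ∃ m : ι → ℤ, m j = d ∧ p = mono m}

omit [DecidableEq ι] in
theorem mono_mem_homogeneousIn {j : ι} {d : ℤ} {m : ι → ℤ} (h : m j = d) :
    mono m ∈ homogeneousIn j d := Submodule.subset_span ⟨m, h, rfl⟩

omit [DecidableEq ι] in
theorem mul_mono_mem_homogeneousIn {j : ι} {d : ℤ} {p : Laurent ι} (hp : p ∈ homogeneousIn j d)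
    {m : ι → ℤ} (hm : m j = 0) : p * mono m ∈ homogeneousIn j d := by
  induction hp using Submodule.span_induction with
  | mem p h =>
    obtain ⟨m', h, rfl⟩ := h
    rw [mono_mul]
    exact mono_mem_homogeneousIn (by simp [h, hm])
  | zero => rw [zero_mul]; exact Submodule.zero_mem _
  | add p p' _ _ hp hp' => rw [add_mul]; exact Submodule.add_mem _ hp hp'
  | smul a p _ hp => rw [smul_mul_assoc]; exact Submodule.smul_mem _ _ hp

/-- The power series `p` in `X / z_j`, as a Laurent series in `X`. -/
def seriesIn (j : ι) : ℂ⟦X⟧ →+* HahnSeries ℤ (Laurent ι) :=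
  ((HahnSeries.ofPowerSeries ℤ (Laurent ι)).comp
    (PowerSeries.rescale (mono (Pi.single j (-1))))).comp
      (PowerSeries.map (algebraMap ℂ (Laurent ι)))

theorem seriesIn_coeff (j : ι) (p : ℂ⟦X⟧) (n : ℤ) :
    (seriesIn j p).coeff n = zcoeff p n • mono (Pi.single j (-n)) := by
  rw [seriesIn, RingHom.comp_apply, RingHom.comp_apply, zcoeff]
  split_ifs with h
  · lift n to ℕ using h
    have h1 : n • (Pi.single j (-1) : ι → ℤ) = Pi.single j (-n : ℤ) := by
      rw [← Pi.single_smul]; simp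
    rw [HahnSeries.ofPowerSeries_apply_coeff, PowerSeries.coeff_rescale, PowerSeries.coeff_map,
      mono_pow, h1, Algebra.smul_def, mul_comm, Int.toNat_natCast]
  · rw [ofPS_coeff_neg _ _ (by omega), zero_smul]

theorem seriesIn_C (j : ι) (a : ℂ) :
    seriesIn j (PowerSeries.C a) = HahnSeries.C (algebraMap ℂ (Laurent ι) a) := by
  rw [seriesIn, RingHom.comp_apply, RingHom.comp_apply, PowerSeries.map_C,
    show PowerSeries.rescale (mono (Pi.single j (-1))) (PowerSeries.C (algebraMap ℂ (Laurent ι) a)) =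
      PowerSeries.C (algebraMap ℂ (Laurent ι) a) from by
        ext1 n; rcases n with _ | n <;> simp [PowerSeries.coeff_rescale, PowerSeries.coeff_C], HahnSeries.ofPowerSeries_C]

theorem seriesIn_X (j : ι) :
    seriesIn j PowerSeries.X = HahnSeries.single 1 (mono (Pi.single j (-1))) := by
  rw [seriesIn, RingHom.comp_apply, RingHom.comp_apply, PowerSeries.map_X, PowerSeries.rescale_X,
    map_mul, HahnSeries.ofPowerSeries_C, HahnSeries.ofPowerSeries_X, HahnSeries.C_apply,
    HahnSeries.single_mul_single, zero_add, mul_one]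

/-- The factor `s (z_l - t z_j)`. -/
def factor (s t : ι → ι → ℂ) (j l : ι) : Laurent ι := algebraMap ℂ _ (s j l) * (var l - algebraMap ℂ _ (t j l) * var j)

/-- The product of the factors over all the pairs of entries of a list. -/
def pairProd (s t : ι → ι → ℂ) : List ι → Laurent ι
  | [] => 1
  | j :: π => (π.map (factor s t j)).prod * pairProd s t π

/-- Replacement of the variable `i` by the Laurent series variable. -/
def extract (i : ι) : Laurent ι →+* HahnSeries ℤ (Laurent ι) :=
  AddMonoidAlgebra.liftNCRingHom
    ((HahnSeries.C : Laurent ι →+* HahnSeries ℤ (Laurent ι)).comp (algebraMap ℂ (Laurent ι)))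
    { toFun := fun m => HahnSeries.single (m.toAdd i) (mono (m.toAdd - Pi.single i (m.toAdd i)))
      map_one' := by simp [mono_zero]
      map_mul' := fun m m' => by
        rw [HahnSeries.single_mul_single, mono_mul, toAdd_mul, Pi.add_apply, Pi.single_add]
        congr 2
        abel }
    fun _ _ => Commute.all _ _

theorem extract_mono (i : ι) (m : ι → ℤ) :
    extract i (mono m) = HahnSeries.single (m i) (mono (m - Pi.single i (m i))) := by
  refine (AddMonoidAlgebra.liftNC_single _ _ m (1 : ℂ)).trans ?_
  simp [← AddMonoidAlgebra.one_def]

theorem extract_algebraMap (i : ι) (a : ℂ) : extract i (algebraMap ℂ (Laurent ι) a) =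
    HahnSeries.C (algebraMap ℂ (Laurent ι) a) := by
  refine (AddMonoidAlgebra.liftNC_single _ _ (0 : ι → ℤ) a).trans ?_
  simp [mono_zero]

theorem extract_var_self (i : ι) : extract i (var i) = HahnSeries.single 1 1 := by
  rw [var, extract_mono]
  simp [mono_zero]

theorem extract_var_of_ne {i j : ι} (h : j ≠ i) : extract i (var j) = HahnSeries.C (var j) := by
  rw [var, extract_mono]
  simp [h.symm, HahnSeries.C_apply]

theorem extract_factor_of_ne (s t : ι → ι → ℂ) {i j l : ι} (hj : j ≠ i) (hl : l ≠ i) :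
    extract i (factor s t j l) = HahnSeries.C (factor s t j l) := by
  simp only [factor, map_mul, map_sub, extract_algebraMap, extract_var_of_ne hj,
    extract_var_of_ne hl]

theorem extract_pairProd_of_notMem (s t : ι → ι → ℂ) {i : ι} {π : List ι} (h : i ∉ π) :
    extract i (pairProd s t π) = HahnSeries.C (pairProd s t π) := by
  induction π with
  | nil => simp [pairProd]
  | cons j π ih =>
    rw [List.mem_cons, not_or] at h
    rw [pairProd, map_mul, map_mul, ih h.2, map_list_prod, map_list_prod, List.map_map,
      List.map_map]
    congr 2
    refine List.map_congr_left fun l hl => ?_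
    exact extract_factor_of_ne s t (Ne.symm h.1) fun h' => h.2 (h' ▸ hl)

/-- The product of the expansions of `(t z_j - X) / (z_j - t X)` over the entries `j` of a list
that precede `i`. -/
def precedingSeries (t : ι → ι → ℂ) (i : ι) : List ι → HahnSeries ℤ (Laurent ι)
  | [] => 1
  | j :: π => if j = i then 1 else precedingSeries t i π * seriesIn j (kernelPlus (t i j)⁻¹)

/-- With `X` in place of `z_i`, the series is the expansion of `(t z_j - X) / (z_j - t X)`. It
exchanges the order of `i` and `j` in `factor`, the sign being absorbed by the antisymmetry of `s`.
-/
theorem seriesIn_kernelPlus_mul {s t : ι → ι → ℂ} (hs : ∀ i j, s i j = -s j i)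
    (ht : ∀ i j, t i j = t j i) (ht0 : ∀ i j, t i j ≠ 0) {i j : ι} (h : j ≠ i) :
    seriesIn j (kernelPlus (t i j)⁻¹) * extract i (factor s t i j) = extract i (factor s t j i) := by
  have h1 := congrArg (seriesIn j) (kernelPlus_spec (inv_ne_zero (ht0 i j)))
  rw [map_mul, map_sub, map_sub, map_mul, map_one, seriesIn_C, seriesIn_X] at h1
  have h2 : (HahnSeries.C (var j) : HahnSeries ℤ (Laurent ι)) *
      HahnSeries.single 1 (mono (Pi.single j (-1))) = HahnSeries.single 1 1 := by
    rw [HahnSeries.C_apply, HahnSeries.single_mul_single, var, mono_mul, ← Pi.single_add]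
    simp [mono_zero]
  have h3 : (HahnSeries.C (algebraMap ℂ (Laurent ι) (t i j)) : HahnSeries ℤ (Laurent ι)) *
      HahnSeries.C (algebraMap ℂ (Laurent ι) (t i j)⁻¹) = 1 := by
    rw [← map_mul, ← map_mul, mul_inv_cancel₀ (ht0 i j), map_one, map_one]
  simp only [factor, map_mul, map_sub, extract_algebraMap]
  rw [extract_var_self, extract_var_of_ne h, hs j i, ht j i, map_neg, map_neg]
  set T : HahnSeries ℤ (Laurent ι) := HahnSeries.C (algebraMap ℂ (Laurent ι) (t i j))
  set T' : HahnSeries ℤ (Laurent ι) := HahnSeries.C (algebraMap ℂ (Laurent ι) (t i j)⁻¹)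
  set Z : HahnSeries ℤ (Laurent ι) := HahnSeries.C (var j)
  set Y : HahnSeries ℤ (Laurent ι) := HahnSeries.single 1 (mono (Pi.single j (-1)))
  rw [← h2]
  set K := seriesIn j (kernelPlus (t i j)⁻¹)
  set S : HahnSeries ℤ (Laurent ι) := HahnSeries.C (algebraMap ℂ (Laurent ι) (s i j))
  linear_combination S * T * Z * h1 - S * (Z * K + Z * Y) * h3

/-- Moving `i` to the front of the list costs one kernel for each entry that precedes it. The middle
factor then depends on the set of the other entries but not on their order. -/
theorem extract_pairProd {s t : ι → ι → ℂ} (hs : ∀ i j, s i j = -s j i)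
    (ht : ∀ i j, t i j = t j i) (ht0 : ∀ i j, t i j ≠ 0) {i : ι} {π : List ι} (hπ : π.Nodup)
    (hi : i ∈ π) : extract i (pairProd s t π) = precedingSeries t i π *
      extract i ((π.erase i).map (factor s t i)).prod * HahnSeries.C (pairProd s t (π.erase i)) := by
  induction π with
  | nil => simp at hi
  | cons j π ih =>
    rw [List.nodup_cons] at hπ
    by_cases hj : j = i
    · subst hj
      rw [List.erase_cons_head, precedingSeries, if_pos rfl, one_mul, pairProd, map_mul,
        extract_pairProd_of_notMem s t hπ.1]
    · have hi' : i ∈ π := (List.mem_cons.1 hi).resolve_left (Ne.symm hj)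
      have h1 : extract i ((π.erase i).map (factor s t j)).prod =
          HahnSeries.C ((π.erase i).map (factor s t j)).prod := by
        rw [map_list_prod, map_list_prod, List.map_map, List.map_map]
        congr 1
        refine List.map_congr_left fun l hl => ?_
        exact extract_factor_of_ne s t hj ((List.Nodup.mem_erase_iff hπ.2).1 hl).1
      have h2 : (π.map (factor s t j)).prod =
          factor s t j i * ((π.erase i).map (factor s t j)).prod := by
        rw [((List.perm_cons_erase hi').map _).prod_eq, List.map_cons, List.prod_cons]
      rw [List.erase_cons_tail (by simpa using hj), precedingSeries, if_neg hj, pairProd, h2,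
        map_mul, map_mul, h1, ih hπ.2 hi', pairProd, List.map_cons, List.prod_cons, map_mul,
        map_mul, ← seriesIn_kernelPlus_mul hs ht ht0 hj]
      ring

end Laurent

end QuantumCurrents

namespace QuantumCurrents

open Filter Plus

/-! ### The form on words in the currents -/

section Word

variable {I : Type*} (D : Datum I) {ι : Type*} [DecidableEq ι] (c : ι → I)

/-- The product of the generators `e_{c(j)}[m_j]` over the entries `j` of the list `π`, taken in
the reversed order. -/
def word : List ι → (ι → ℤ) → UPlus D
  | [], _ => 1
  | j :: π, m => word π m * gen D (Sum.inl (c j)) (m j)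

omit [DecidableEq ι] in
theorem word_congr {π : List ι} {m m' : ι → ℤ} (h : ∀ j ∈ π, m j = m' j) :
    word D c π m = word D c π m' := by
  induction π with
  | nil => rfl
  | cons j π ih =>
    rw [word, word, h j (by simp), ih fun l hl => h l (by simp [hl])]

/-- The pairing of `z` with linear combinations of words. -/
def wordForm (z : UPlus D) (π : List ι) : Laurent ι →ₗ[ℂ] ℂ :=
  Finsupp.linearCombination ℂ (fun m => form D z (word D c π m)) ∘ₗ
    (AddMonoidAlgebra.coeffLinearEquiv ℂ).toLinearMap

omit [DecidableEq ι] in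
theorem wordForm_mono (z : UPlus D) (π : List ι) (m : ι → ℤ) :
    wordForm D c z π (mono m) = form D z (word D c π m) := by
  refine (Finsupp.linearCombination_single ℂ (1 : ℂ) m).trans (one_smul _ _)

omit [DecidableEq ι] in
theorem single_eq_smul_mono (m : ι → ℤ) (a : ℂ) :
    (AddMonoidAlgebra.single m a : Laurent ι) = a • mono m := by
  rw [mono, AddMonoidAlgebra.smul_single, smul_eq_mul, mul_one]

omit [DecidableEq ι] in
theorem linearMap_ext_mono {M : Type*} [AddCommGroup M] [Module ℂ M] {f g : Laurent ι →ₗ[ℂ] M}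
    (h : ∀ m, f (mono m) = g (mono m)) : f = g := by
  refine LinearMap.ext fun p => ?_
  induction p using AddMonoidAlgebra.induction_linear with
  | zero => simp
  | add p p' hp hp' => rw [map_add, map_add, hp, hp']
  | single m a =>
    rw [single_eq_smul_mono, map_smul, map_smul]
    exact congrArg _ (h m)

omit [DecidableEq ι] in
theorem wordForm_add (z z' : UPlus D) (π : List ι) :
    wordForm D c (z + z') π = wordForm D c z π + wordForm D c z' π :=
  linearMap_ext_mono fun m => by simp [wordForm_mono]

omit [DecidableEq ι] in
theorem wordForm_smul (a : ℂ) (z : UPlus D) (π : List ι) :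
    wordForm D c (a • z) π = a • wordForm D c z π :=
  linearMap_ext_mono fun m => by simp [wordForm_mono]

omit [DecidableEq ι] in
theorem wordForm_one_cons (j : ι) (π : List ι) : wordForm D c 1 (j :: π) = 0 :=
  linearMap_ext_mono fun m => by
    rw [wordForm_mono, word, form_mul_gen, der_one, counit_gen]
    simp

/-- The head of the list is the last letter of the word, and its adjoint is a skew derivation.
Homogeneity in `z_j` is what allows its mode to be read off from `p`. -/
theorem wordForm_cons_mul {π : List ι} {j : ι} (hj : j ∉ π) {d : ℤ} {p : Laurent ι}
    (hp : p ∈ homogeneousIn j d) (z : UPlus D) (k : ℤ) :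
    wordForm D c z (j :: π) (p * mono (Pi.single j (-k))) =
      wordForm D c (der D (Sum.inl (c j)) (d - k) z) π p := by
  induction hp using Submodule.span_induction with
  | mem p h =>
    obtain ⟨m, h, rfl⟩ := h
    rw [mono_mul, wordForm_mono, wordForm_mono, word, form_mul_gen]
    rw [show (m + Pi.single j (-k) : ι → ℤ) j = d - k from by simp [h, sub_eq_add_neg],
      word_congr D c (m' := m) fun l hl => ?_]
    have hl : l ≠ j := fun h' => hj (h' ▸ hl)
    simp [hl]
  | zero => rw [zero_mul, map_zero, map_zero]
  | add p p' _ _ hp hp' => rw [add_mul, map_add, map_add, hp, hp']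
  | smul a p _ hp => rw [smul_mul_assoc, map_smul, map_smul, hp]

theorem coeff_mul_seriesIn_mem {i j : ι} (h : j ≠ i) {d : ℤ}
    {B : HahnSeries ℤ (Laurent ι)} (hB : ∀ n, B.coeff n ∈ homogeneousIn j d) (p : ℂ⟦X⟧) (n : ℤ) :
    (B * seriesIn i p).coeff n ∈ homogeneousIn j d := by
  obtain ⟨s, hs⟩ := (eventually_coeff_mul B (seriesIn i p) n).exists
  rw [hs]
  refine Submodule.sum_mem _ fun k _ => ?_
  rw [seriesIn_coeff, mul_smul_comm]
  exact Submodule.smul_mem _ _ (mul_mono_mem_homogeneousIn (hB _) (by simp [h]))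

theorem wordForm_cons_coeff {π : List ι} {j : ι} (hj : j ∉ π) {d : ℤ}
    {B : HahnSeries ℤ (Laurent ι)} (hB : ∀ n, B.coeff n ∈ homogeneousIn j d) (p : ℂ⟦X⟧)
    (z : UPlus D) (u : ℤ) : ∀ᶠ s : Finset ℤ in atTop,
    wordForm D c z (j :: π) ((B * seriesIn j p).coeff u) = ∑ k ∈ s, zcoeff p k *
      wordForm D c (der D (Sum.inl (c j)) (d - k) z) π (B.coeff (u - k)) := by
  filter_upwards [eventually_coeff_mul B (seriesIn j p) u] with s hs
  rw [hs, map_sum]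
  refine Finset.sum_congr rfl fun k _ => ?_
  rw [seriesIn_coeff, mul_smul_comm, map_smul, wordForm_cons_mul D c hj (hB _), smul_eq_mul]

/-- The product of the power series `kform` in `X / z_j` over the entries `j` of a list. -/
def kelSeries (i : I ⊕ I) : List ι → HahnSeries ℤ (Laurent ι)
  | [] => 1
  | j :: π => kelSeries i π * seriesIn j (kform D i (Sum.inl (c j)))

theorem kelSeries_perm (i : I ⊕ I) {π π' : List ι} (h : π.Perm π') :
    kelSeries D c i π = kelSeries D c i π' := by
  induction h with
  | nil => rfl
  | cons j _ ih => rw [kelSeries, kelSeries, ih]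
  | swap j l π => simp only [kelSeries]; ring
  | trans _ _ h1 h2 => rw [h1, h2]

theorem coeff_C_mul_kelSeries_mem (i : I ⊕ I) {π : List ι} {j : ι} (hj : j ∉ π) (m : ι → ℤ) (n : ℤ) :
    (HahnSeries.C (mono m) * kelSeries D c i π).coeff n ∈ homogeneousIn j (m j) := by
  induction π generalizing n with
  | nil =>
    rw [kelSeries, mul_one, HahnSeries.C_apply, HahnSeries.coeff_single]
    split_ifs
    · exact mono_mem_homogeneousIn rfl
    · exact Submodule.zero_mem _
  | cons l π ih =>
    rw [List.mem_cons, not_or] at hj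
    rw [kelSeries, ← mul_assoc]
    exact coeff_mul_seriesIn_mem hj.1 (ih hj.2) _ _

/-- Every letter of the word that meets the group-like current `K_i(X)` multiplies by `kform` in `X
/ z_j`. The total factor is therefore independent of the order of the letters. -/
theorem wordForm_mul_kel_mono (i : I ⊕ I) (u : ℤ) {π : List ι} (hπ : π.Nodup) (z : UPlus D)
    (m : ι → ℤ) : wordForm D c (z * kel D i u) π (mono m) =
      wordForm D c z π ((HahnSeries.C (mono m) * kelSeries D c i π).coeff u) := by
  induction π generalizing z u with
  | nil =>
    rw [kelSeries, mul_one, wordForm_mono, word, form_one, map_mul, counit_kel, HahnSeries.C_apply,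
      HahnSeries.coeff_single]
    split_ifs
    · rw [wordForm_mono, word, form_one, mul_one]
    · rw [mul_zero, map_zero]
  | cons j π ih =>
    rw [List.nodup_cons] at hπ
    obtain ⟨s, h1, h2⟩ := ((der_mul_gen D (Sum.inl (c j)) (Sum.inr i) (m j) u z).and
      (wordForm_cons_coeff D c hπ.1 (coeff_C_mul_kelSeries_mem D c i hπ.1 m)
        (kform D i (Sum.inl (c j))) z u)).exists
    rw [kelSeries, ← mul_assoc, h2, wordForm_mono, word, form_mul_gen,
      show kel D i u = gen D (Sum.inr i) u from rfl, h1, if_neg (by simp), zero_add, map_sum,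
      LinearMap.sum_apply]
    refine Finset.sum_congr rfl fun k _ => ?_
    rw [map_smul, LinearMap.smul_apply, smul_eq_mul, ← ih _ hπ.2, wordForm_mono]
    rfl

theorem wordForm_mul_kel (i : I ⊕ I) (u : ℤ) {π : List ι} (hπ : π.Nodup) (z : UPlus D)
    (p : Laurent ι) : wordForm D c (z * kel D i u) π p =
      wordForm D c z π ((HahnSeries.C p * kelSeries D c i π).coeff u) := by
  induction p using AddMonoidAlgebra.induction_linear with
  | zero => simp
  | add p p' hp hp' => rw [map_add, map_add, hp, hp', add_mul, HahnSeries.coeff_add, map_add]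
  | single m a =>
    have h : (HahnSeries.C (a • mono m) * kelSeries D c i π).coeff u =
        a • (HahnSeries.C (mono m) * kelSeries D c i π).coeff u := by
      rw [HahnSeries.C_apply, HahnSeries.C_apply, HahnSeries.coeff_single_zero_mul,
        HahnSeries.coeff_single_zero_mul, smul_mul_assoc]
    rw [single_eq_smul_mono]
    rw [map_smul, h, map_smul, wordForm_mul_kel_mono D c i u hπ]

/-- The function `t` on labels. -/
def labelT (i j : ι) : ℂ := D.t (c i) (c j)

theorem coeff_extract_mul_precedingSeries_mem (i : ι) {π : List ι} {j : ι} (hj : j ∉ π)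
    (hi : j ≠ i) (m : ι → ℤ) (n : ℤ) :
    (extract i (mono m) * precedingSeries (labelT D c) i π).coeff n ∈ homogeneousIn j (m j) := by
  have h1 : ∀ n, (extract i (mono m)).coeff n ∈ homogeneousIn j (m j) := fun n => by
    rw [extract_mono, HahnSeries.coeff_single]
    split_ifs
    · exact mono_mem_homogeneousIn (by simp [hi])
    · exact Submodule.zero_mem _
  induction π generalizing n with
  | nil => rw [precedingSeries, mul_one]; exact h1 n
  | cons l π ih =>
    rw [List.mem_cons, not_or] at hj
    rw [precedingSeries]
    split_ifs
    · rw [mul_one]; exact h1 n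
    · rw [← mul_assoc]
      exact coeff_mul_seriesIn_mem hj.1 (ih hj.2) _ _

open Classical in
-- Letters of the word are removed one by one through their skew derivations. Either a letter `i` of
-- the right colour is contracted with `e_γ(X)`, which sets `z_i = X`, or the letter passes it and
-- contributes a kernel. Hence the kernels come from the entries preceding `i`.
theorem wordForm_mul_e_mono (γ : I) (u : ℤ) {π : List ι} (hπ : π.Nodup) (z : UPlus D)
    (m : ι → ℤ) : wordForm D c (z * gen D (Sum.inl γ) u) π (mono m) =
      ∑ i ∈ π.toFinset, if c i = γ then wordForm D c z (π.erase i)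
        ((extract i (mono m) * precedingSeries (labelT D c) i π).coeff u) else 0 := by
  induction π generalizing z u with
  | nil =>
    rw [wordForm_mono, word, form_one, map_mul, counit_gen]
    simp
  | cons j π ih =>
    rw [List.nodup_cons] at hπ
    -- One finite set of modes has to serve all the contracted labels `i` at once, so that the two
    -- sums can be interchanged.
    have h2 : ∀ᶠ s : Finset ℤ in atTop, ∀ i ∈ π.toFinset, c i = γ →
        wordForm D c z ((j :: π).erase i)
          ((extract i (mono m) * precedingSeries (labelT D c) i (j :: π)).coeff u) =
        ∑ k ∈ s, zcoeff (kform D (Sum.inl γ) (Sum.inl (c j))) k *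
          wordForm D c (der D (Sum.inl (c j)) (m j - k) z) (π.erase i)
            ((extract i (mono m) * precedingSeries (labelT D c) i π).coeff (u - k)) := by
      refine (Filter.eventually_all_finset _).2 fun i hi => ?_
      have hij : j ≠ i := fun h => hπ.1 (h ▸ List.mem_toFinset.1 hi)
      by_cases hγ : c i = γ
      · filter_upwards [wordForm_cons_coeff D c (fun h => hπ.1 (List.mem_of_mem_erase h))
          (coeff_extract_mul_precedingSeries_mem D c i hπ.1 hij m)
          (kform D (Sum.inl γ) (Sum.inl (c j))) z u] with s hs _
        rw [← hs, List.erase_cons_tail (by simpa using hij), precedingSeries, if_neg hij,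
          ← mul_assoc, kform, labelT, hγ]
      · exact Filter.Eventually.of_forall fun s h => absurd h hγ
    obtain ⟨s, h1, h2⟩ := ((der_mul_gen D (Sum.inl (c j)) (Sum.inl γ) (m j) u z).and h2).exists
    rw [wordForm_mono, word, form_mul_gen, h1, map_add, LinearMap.add_apply, List.toFinset_cons,
      Finset.sum_insert (by simpa using hπ.1)]
    congr 1
    · rw [List.erase_cons_head, precedingSeries, if_pos rfl, mul_one, extract_mono,
        HahnSeries.coeff_single]
      by_cases hγ : c j = γ
      · by_cases hu : m j = u
        · rw [if_pos (by simp [hγ, hu]), if_pos hγ, if_pos hu.symm, wordForm_mono]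
          refine congrArg _ (word_congr D c fun l hl => ?_)
          have hl : l ≠ j := fun h' => hπ.1 (h' ▸ hl)
          simp [hl]
        · rw [if_neg (by simp [hu]), if_pos hγ, if_neg (Ne.symm hu), map_zero, map_zero,
            LinearMap.zero_apply]
      · rw [if_neg (by simp [hγ]), if_neg hγ, map_zero, LinearMap.zero_apply]
    · rw [map_sum, LinearMap.sum_apply]
      have h3 : ∀ i ∈ π.toFinset, (if c i = γ then wordForm D c z ((j :: π).erase i)
          ((extract i (mono m) * precedingSeries (labelT D c) i (j :: π)).coeff u) else 0) =
          ∑ k ∈ s, zcoeff (kform D (Sum.inl γ) (Sum.inl (c j))) k * if c i = γ then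
          wordForm D c (der D (Sum.inl (c j)) (m j - k) z) (π.erase i)
            ((extract i (mono m) * precedingSeries (labelT D c) i π).coeff (u - k)) else 0 := by
        intro i hi
        split_ifs with hγ
        · exact h2 i hi hγ
        · simp
      rw [Finset.sum_congr rfl h3, Finset.sum_comm]
      refine Finset.sum_congr rfl fun k _ => ?_
      rw [map_smul, LinearMap.smul_apply, smul_eq_mul, ← Finset.mul_sum, ← ih _ hπ.2,
        wordForm_mono]
      rfl

open Classical in
theorem wordForm_mul_e (γ : I) (u : ℤ) {π : List ι} (hπ : π.Nodup) (z : UPlus D)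
    (p : Laurent ι) : wordForm D c (z * gen D (Sum.inl γ) u) π p =
      ∑ i ∈ π.toFinset, if c i = γ then wordForm D c z (π.erase i)
        ((extract i p * precedingSeries (labelT D c) i π).coeff u) else 0 := by
  induction p using AddMonoidAlgebra.induction_linear with
  | zero => simp
  | add p p' hp hp' =>
    rw [map_add, hp, hp', ← Finset.sum_add_distrib]
    refine Finset.sum_congr rfl fun i _ => ?_
    split_ifs
    · rw [map_add, add_mul, HahnSeries.coeff_add, map_add]
    · rw [add_zero]
  | single m a =>
    have h : ∀ i, (extract i (a • mono m) * precedingSeries (labelT D c) i π).coeff u =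
        a • (extract i (mono m) * precedingSeries (labelT D c) i π).coeff u := fun i => by
      rw [Algebra.smul_def, map_mul, extract_algebraMap, mul_assoc, HahnSeries.C_apply,
        HahnSeries.coeff_single_zero_mul, ← Algebra.smul_def]
    rw [single_eq_smul_mono]
    rw [map_smul, wordForm_mul_e_mono D c γ u hπ, Finset.smul_sum]
    refine Finset.sum_congr rfl fun i _ => ?_
    rw [h, map_smul]
    split_ifs <;> simp

end Word

end QuantumCurrents

namespace QuantumCurrents

open Filter Plus

/-! ### Vanishing of the form on combinations of words -/

section Vanishing

variable {I : Type*} (D : Datum I) {ι : Type*} [DecidableEq ι] (c : ι → I)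

theorem extract_factor_ne_zero {s t : ι → ι → ℂ} {i l : ι} (h : l ≠ i) (hs : s i l ≠ 0) :
    extract i (factor s t i l) ≠ 0 := by
  intro h0
  rw [factor, map_mul, map_sub, map_mul, extract_algebraMap, extract_algebraMap, extract_var_self,
    extract_var_of_ne h] at h0
  have h1 := congrArg (fun p => HahnSeries.coeff p 0) h0
  simp [HahnSeries.C_apply, var, mono, hs] at h1

/-- Induction on `z`. Contracting with an `e` current removes the same label from every list, and by
`extract_pairProd` the hypothesis is inherited after division by a factor common to all orderings.
Multiplying by a group-like current only introduces a factor independent of the ordering. At `z = 1`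
every nonempty word pairs to zero. -/
theorem sum_wordForm_eq_zero {s : ι → ι → ℂ} (hs : ∀ i j, s i j = -s j i)
    (hs0 : ∀ i j, i ≠ j → s i j ≠ 0) {R : Type*} (F : Finset R) (z : UPlus D) {π₀ : List ι}
    (h₀ : π₀.Nodup) (π : R → List ι) (hπ : ∀ r, (π r).Perm π₀) (p : R → Laurent ι)
    (h : ∑ r ∈ F, p r * pairProd s (labelT D c) (π r) = 0) :
    ∑ r ∈ F, wordForm D c z (π r) (p r) = 0 := by
  classical
  have hnd : ∀ r, (π r).Nodup := fun r => (hπ r).nodup_iff.2 h₀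
  induction z using induction_right generalizing π₀ π p with
  | one =>
    rcases π₀ with _ | ⟨j, π₀⟩
    · have h1 : ∀ r, π r = [] := fun r => (hπ r).eq_nil
      simp only [h1, pairProd, mul_one] at h ⊢
      rw [← map_sum, h, map_zero]
    · refine Finset.sum_eq_zero fun r _ => ?_
      rcases hr : π r with _ | ⟨l, π'⟩
      · have := hπ r
        rw [hr] at this
        exact absurd this.symm.eq_nil (by simp)
      · rw [wordForm_one_cons, LinearMap.zero_apply]
  | add z z' hz hz' =>
    simp only [wordForm_add, LinearMap.add_apply, Finset.sum_add_distrib]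
    rw [hz h₀ π hπ p h hnd, hz' h₀ π hπ p h hnd, add_zero]
  | smul a z hz =>
    simp only [wordForm_smul, LinearMap.smul_apply, ← Finset.smul_sum]
    rw [hz h₀ π hπ p h hnd, smul_zero]
  | mul z g u hz =>
    rcases g with γ | i
    · simp only [wordForm_mul_e D c γ u (hnd _),
        fun r => List.toFinset_eq_of_perm _ _ (hπ r)]
      rw [Finset.sum_comm]
      refine Finset.sum_eq_zero fun i hi => ?_
      split_ifs
      · have hi := List.mem_toFinset.1 hi
        refine hz (h₀.erase i) (fun r => (π r).erase i) (fun r => (hπ r).erase i) _ ?_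
          fun r => (hnd r).erase i
        have h1 : ∑ r ∈ F, extract i (p r) * precedingSeries (labelT D c) i (π r) *
            HahnSeries.C (pairProd s (labelT D c) ((π r).erase i)) = 0 := by
          -- The common factor is nonzero because the signs `s` do not vanish on distinct labels; it
          -- can be cancelled as there are no zero divisors.
          have h2 : extract i ((π₀.erase i).map (factor s (labelT D c) i)).prod ≠ 0 := by
            rw [map_list_prod, List.map_map]
            intro h0
            obtain ⟨l, hl, hl0⟩ := List.mem_map.1 (List.prod_eq_zero_iff.1 h0)
            have hli := ((List.Nodup.mem_erase_iff h₀).1 hl).1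
            exact extract_factor_ne_zero hli (hs0 _ _ hli.symm) hl0
          refine (mul_eq_zero.1 ?_).resolve_left h2
          have h3 := congrArg (extract i) h
          rw [map_sum, map_zero] at h3
          rw [← h3, Finset.mul_sum]
          refine Finset.sum_congr rfl fun r _ => ?_
          rw [map_mul, extract_pairProd (t := labelT D c) hs (fun i j => D.t_symm _ _) (fun i j => D.t_ne_zero _ _)
            (hnd r) ((hπ r).mem_iff.2 hi), (((hπ r).erase i).map _).prod_eq]
          ring
        have h4 := congrArg (fun x => HahnSeries.coeff x u) h1
        simpa only [HahnSeries.coeff_sum, HahnSeries.C_apply, HahnSeries.coeff_mul_single_zero,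
          HahnSeries.coeff_zero] using h4
      · exact Finset.sum_const_zero
    · simp only [gen, wordForm_mul_kel D c i u (hnd _)]
      refine hz h₀ π hπ _ ?_ hnd
      have h1 : ∑ r ∈ F, HahnSeries.C (p r) * kelSeries D c i (π r) *
          HahnSeries.C (pairProd s (labelT D c) (π r)) = 0 := by
        have h3 := congrArg (HahnSeries.C : Laurent ι →+* HahnSeries ℤ (Laurent ι)) h
        rw [map_sum, map_zero] at h3
        rw [← mul_zero (kelSeries D c i π₀), ← h3, Finset.mul_sum]
        refine Finset.sum_congr rfl fun r _ => ?_
        rw [map_mul, kelSeries_perm D c i (hπ r)]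
        ring
      have h4 := congrArg (fun x => HahnSeries.coeff x u) h1
      simpa only [HahnSeries.coeff_sum, HahnSeries.C_apply, HahnSeries.coeff_mul_single_zero,
        HahnSeries.coeff_zero] using h4

end Vanishing

end QuantumCurrents

namespace QuantumCurrents

/-! ### A symmetrization identity for quantum binomial coefficients -/

section Symmetrization

variable {P M : Type*} [CommRing P] [Algebra ℂ P] [AddCommGroup M] [Module ℂ M]

/-- The variables `x`, the transpositions `τ k` of `x k` and `x (k + 1)`, and a linear map `L` such
that `L (x (k + 1) F) = t L (x k F)` for the elements `F` fixed by `τ k`. -/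
structure IsTwisted (x : ℕ → P) (τ : ℕ → P →+* P) (t : ℂ) (N : ℕ) (L : P →ₗ[ℂ] M) : Prop where
  map_other : ∀ k i, i ≠ k → i ≠ k + 1 → τ k (x i) = x i
  twist : ∀ k, k + 1 < N → ∀ F, τ k F = F → L (x (k + 1) * F) = t • L (x k * F)

variable {x : ℕ → P} {τ : ℕ → P →+* P} {t : ℂ} {N : ℕ} {L : P →ₗ[ℂ] M}

theorem IsTwisted.prod_shift (h : IsTwisted x τ t N L) (a n : ℕ) (han : a + n < N) (F : P)
    (hF : ∀ k, a ≤ k → k < a + n → τ k F = F) :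
    L ((∏ i ∈ Finset.range n, x (a + 1 + i)) * F) =
      t ^ n • L ((∏ i ∈ Finset.range n, x (a + i)) * F) := by
  -- The factors are lowered one at a time from the bottom: when `x (a + m + 1)` becomes `x (a +
  -- m)`, the other factors avoid both variables and are fixed by `τ (a + m)`.
  have key : ∀ m ≤ n, L ((∏ i ∈ Finset.range n, x (a + 1 + i)) * F) = t ^ m •
      L ((∏ i ∈ Finset.range m, x (a + i)) * (∏ i ∈ Finset.Ico m n, x (a + 1 + i)) * F) := by
    intro m
    induction m with
    | zero => intro _; simp
    | succ m ih =>
      intro hm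
      rw [ih (by omega), pow_succ, mul_smul]
      congr 1
      rw [Finset.prod_range_succ, Finset.prod_eq_prod_Ico_succ_bot (by omega : m < n)]
      have h1 := h.twist (a + m) (by omega) ((∏ i ∈ Finset.range m, x (a + i)) *
        (∏ i ∈ Finset.Ico (m + 1) n, x (a + 1 + i)) * F) (by
          rw [map_mul, map_mul, map_prod, map_prod, hF _ (by omega) (by omega)]
          congr 2
          · refine Finset.prod_congr rfl fun i hi => h.map_other _ _ ?_ ?_ <;>
              have := Finset.mem_range.1 hi <;> omega
          · refine Finset.prod_congr rfl fun i hi => h.map_other _ _ ?_ ?_ <;>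
              have := Finset.mem_Ico.1 hi <;> omega)
      have e1 : a + 1 + m = a + m + 1 := by ring
      rw [e1]
      convert h1 using 2
      · ring
      · congr 1
        ring
  have := key n le_rfl
  simpa using this

/-- The product `(x_a - s w) ⋯ (x_{a+r-1} - s w) (w - s x_{a+r}) ⋯ (w - s x_{a+n-1})`. -/
def insertProd (x : ℕ → P) (s : ℂ) (w : P) (a n r : ℕ) : P :=
  (∏ i ∈ Finset.range r, (x (a + i) - s • w)) *
    ∏ i ∈ Finset.Ico r n, (w - s • x (a + i))

theorem insertProd_succ_right (s : ℂ) (w : P) (a n r : ℕ) (hr : r ≤ n) :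
    insertProd x s w a (n + 1) r = insertProd x s w a n r * (w - s • x (a + n)) := by
  rw [insertProd, insertProd, Finset.prod_Ico_succ_top hr, mul_assoc]

theorem insertProd_succ_left (s : ℂ) (w : P) (a n r : ℕ) :
    insertProd x s w a (n + 1) (r + 1) = (x a - s • w) * insertProd x s w (a + 1) n r := by
  rw [insertProd, insertProd, Finset.prod_range_succ', ← Finset.prod_Ico_add' _ r n 1]
  have h : ∀ i, x (a + (i + 1)) = x (a + 1 + i) := fun i => by congr 1; ring
  simp only [h, add_zero]
  ring

/-- The constants in the symmetrization identity. -/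
def symmConst (p s : ℂ) : ℕ → ℂ
  | 0 => 1
  | n + 1 => symmConst p s n * ((p⁻¹ ^ n) ^ 2 * s⁻¹ - s)

/-- The weights `(p^{1-n} s⁻¹)^r`, the base point `a` and the spectator `F` are what make the
induction on `n` close: the Pascal rule splits off either the last variable or the first one, whose
linear factor is then absorbed into `F`. -/
theorem IsTwisted.sum_insertProd {p s : ℂ} (hp : p ≠ 0) (hs : s ≠ 0)
    (h : IsTwisted x τ (p ^ 2) N L) {w : P} (hw : ∀ k, τ k w = w)
    (hτ : ∀ k (a : ℂ) (F : P), τ k (a • F) = a • τ k F) (n : ℕ) :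
    ∀ (a : ℕ), a + n ≤ N → ∀ F : P, (∀ k, a ≤ k → k + 1 < a + n → τ k F = F) →
    ∑ r ∈ Finset.range (n + 1), (qBinom p n r * (p * p⁻¹ ^ n * s⁻¹) ^ r) •
      L (insertProd x s w a n r * F) =
      symmConst p s n • L ((∏ i ∈ Finset.range n, x (a + i)) * F) := by
  induction n with
  | zero => intro a _ F _; simp [qBinom, symmConst, insertProd]
  | succ n ih =>
    intro a ha F hF
    -- The ratio of weights at level `n + 1`; the one at level `n` is `p * c`.
    set c := p * p⁻¹ ^ (n + 1) * s⁻¹ with hc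
    have hpc : p * c = p * p⁻¹ ^ n * s⁻¹ := by
      rw [hc, pow_succ]; field_simp
    have h1 : ∑ r ∈ Finset.range (n + 1), (qBinom p n r * (p * c) ^ r) •
        L (insertProd x s w a (n + 1) r * F) =
        symmConst p s n • L ((∏ i ∈ Finset.range n, x (a + i)) * ((w - s • x (a + n)) * F)) := by
      rw [hpc, ← ih a (by omega) ((w - s • x (a + n)) * F)]
      · refine Finset.sum_congr rfl fun r hr => ?_
        rw [insertProd_succ_right _ _ _ _ _ (by have := Finset.mem_range.1 hr; omega),
          mul_assoc (insertProd x s w a n r)]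
      · intro k hk hk'
        rw [map_mul, map_sub, hw, hτ, h.map_other _ _ (by omega) (by omega),
          hF k hk (by omega)]
    have h2 : ∑ r ∈ Finset.range (n + 1), (qBinom p n r * (p * c) ^ r) •
        L (insertProd x s w a (n + 1) (r + 1) * F) =
        symmConst p s n •
          L ((∏ i ∈ Finset.range n, x (a + 1 + i)) * ((x a - s • w) * F)) := by
      rw [hpc, ← ih (a + 1) (by omega) ((x a - s • w) * F)]
      · refine Finset.sum_congr rfl fun r hr => ?_
        rw [insertProd_succ_left]
        congr 2
        ring
      · intro k hk hk'
        rw [map_mul, map_sub, hτ, hw, h.map_other _ _ (by omega) (by omega),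
          hF k (by omega) (by omega)]
    -- The Pascal rule: `p^{r+1}` turns `c^{r+1}` into `(p c)^{r+1}`, and `p^{-(n-r)} c^{r+1}`
    -- equals `p^{-n} c (p c)^r`.
    have h3 : ∑ r ∈ Finset.range (n + 1 + 1), (qBinom p (n + 1) r * c ^ r) •
        L (insertProd x s w a (n + 1) r * F) =
        ∑ r ∈ Finset.range (n + 1), (qBinom p n r * (p * c) ^ r) •
          L (insertProd x s w a (n + 1) r * F) +
        (p⁻¹ ^ n * c) • ∑ r ∈ Finset.range (n + 1), (qBinom p n r * (p * c) ^ r) •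
          L (insertProd x s w a (n + 1) (r + 1) * F) := by
      have h5 : ∀ r ∈ Finset.range (n + 1), (qBinom p (n + 1) (r + 1) * c ^ (r + 1)) •
          L (insertProd x s w a (n + 1) (r + 1) * F) =
          (qBinom p n (r + 1) * (p * c) ^ (r + 1)) • L (insertProd x s w a (n + 1) (r + 1) * F) +
          (p⁻¹ ^ n * c) • (qBinom p n r * (p * c) ^ r) •
            L (insertProd x s w a (n + 1) (r + 1) * F) := by
        intro r hr
        have hr : r ≤ n := by have := Finset.mem_range.1 hr; omega
        obtain ⟨m, rfl⟩ := Nat.exists_eq_add_of_le hr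
        rw [smul_smul, ← add_smul, qBinom, Nat.add_sub_cancel_left]
        congr 1
        rw [mul_pow, mul_pow, pow_add p⁻¹]
        have : p⁻¹ ^ r * p ^ r = 1 := by rw [← mul_pow, inv_mul_cancel₀ hp, one_pow]
        linear_combination (-p⁻¹ ^ m * c ^ (r + 1) * qBinom p (r + m) r) * this
      have h6 : ∑ r ∈ Finset.range (n + 1), (qBinom p n r * (p * c) ^ r) •
          L (insertProd x s w a (n + 1) r * F) =
          ∑ r ∈ Finset.range (n + 1), (qBinom p n (r + 1) * (p * c) ^ (r + 1)) •
            L (insertProd x s w a (n + 1) (r + 1) * F) + L (insertProd x s w a (n + 1) 0 * F) := by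
        rw [Finset.sum_range_succ', Finset.sum_range_succ _ n, qBinom_eq_zero p n (n + 1) (by omega),
          qBinom]
        simp
      rw [h6, Finset.sum_range_succ' _ (n + 1), Finset.sum_congr rfl h5, Finset.sum_add_distrib,
        ← Finset.smul_sum, qBinom, pow_zero, mul_one, one_smul]
      abel
    rw [h3, h1, h2]
    have hwF : ∀ k, a ≤ k → k < a + n → τ k (w * F) = w * F := fun k hk hk' => by
      rw [map_mul, hw, hF k hk (by omega)]
    have h4 := h.prod_shift a n (by omega) (w * F) hwF
    have e1 : (∏ i ∈ Finset.range n, x (a + i)) * ((w - s • x (a + n)) * F) =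
        (∏ i ∈ Finset.range n, x (a + i)) * (w * F) -
          s • ((∏ i ∈ Finset.range (n + 1), x (a + i)) * F) := by
      rw [Finset.prod_range_succ, sub_mul, mul_sub, smul_mul_assoc, mul_smul_comm]
      congr 2
      ring
    have e2 : (∏ i ∈ Finset.range n, x (a + 1 + i)) * ((x a - s • w) * F) =
        (∏ i ∈ Finset.range (n + 1), x (a + i)) * F -
          s • ((∏ i ∈ Finset.range n, x (a + 1 + i)) * (w * F)) := by
      rw [Finset.prod_range_succ', sub_mul, mul_sub, smul_mul_assoc, mul_smul_comm]
      have h : ∀ i, x (a + (i + 1)) = x (a + 1 + i) := fun i => by congr 1; ring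
      simp only [h, add_zero]
      congr 1
      ring
    rw [e1, e2, map_sub, map_sub, map_smul, map_smul, h4, symmConst]
    -- This makes the two contributions containing `w` cancel once the shifted product has been
    -- moved back by `prod_shift`.
    have h7 : p⁻¹ ^ n * c * s * (p ^ 2) ^ n = 1 := by
      rw [hc]
      simp only [inv_pow, pow_succ]
      field_simp
      ring
    have h8 : p⁻¹ ^ n * c = (p⁻¹ ^ n) ^ 2 * s⁻¹ := by
      rw [hc, pow_succ]; field_simp
    rw [← h8]
    have h9 := congrArg (fun b : ℂ => (symmConst p s n * b) •
      L ((∏ i ∈ Finset.range n, x (a + i)) * (w * F))) h7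
    linear_combination (norm := module) -h9

/-- The symmetrization identity underlying the quantum Serre relations. -/
theorem IsTwisted.sum_qBinom_eq_zero {p s : ℂ} (hp : p ≠ 0) (hs : s * p ^ N = p)
    (h : IsTwisted x τ (p ^ 2) N L) (hN : N ≠ 0) {w : P} (hw : ∀ k, τ k w = w)
    (hτ : ∀ k (a : ℂ) (F : P), τ k (a • F) = a • τ k F) :
    ∑ r ∈ Finset.range (N + 1), qBinom p N r • L (insertProd x s w 0 N r) = 0 := by
  have hs0 : s ≠ 0 := by rintro rfl; exact hp (by simpa using hs.symm)
  obtain ⟨n, rfl⟩ := Nat.exists_eq_succ_of_ne_zero hN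
  have h1 := h.sum_insertProd hp hs0 hw hτ (n + 1) 0 (by omega) 1 fun k _ _ => map_one _
  have hs' : s = p * p⁻¹ ^ (n + 1) := by
    rw [inv_pow]
    exact (eq_mul_inv_iff_mul_eq₀ (pow_ne_zero _ hp)).2 hs
  have h2 : p * p⁻¹ ^ (n + 1) * s⁻¹ = 1 := by rw [← hs', mul_inv_cancel₀ hs0]
  -- With `N = n + 1` the hypothesis says `s = p^{1-N} = p^{-n}`: all weights become `1` and the
  -- last factor of `symmConst` vanishes.
  have h3 : (p⁻¹ ^ n) ^ 2 * s⁻¹ - s = 0 := by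
    have h5 : s = p⁻¹ ^ n := by
      rw [hs', pow_succ, mul_left_comm, mul_inv_cancel₀ hp, mul_one]
    rw [← h5, sq, mul_assoc, mul_inv_cancel₀ hs0, mul_one, sub_self]
  simpa only [h2, h3, symmConst, one_pow, mul_one, mul_zero, zero_smul] using h1

end Symmetrization

end QuantumCurrents

namespace QuantumCurrents

open Plus

/-! ### The quantum Serre elements lie in the radical -/

section PairProd

variable {ι : Type*} [DecidableEq ι] (s t : ι → ι → ℂ)

theorem pairProd_insert (w : ι) (l₁ l₂ : List ι) : pairProd s t (l₁ ++ w :: l₂) =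
    pairProd s t (l₁ ++ l₂) * (l₁.map fun l => factor s t l w).prod *
      (l₂.map (factor s t w)).prod := by
  induction l₁ with
  | nil => simp [pairProd, mul_comm]
  | cons j l₁ ih =>
    simp only [List.cons_append, pairProd, ih, List.map_append, List.prod_append, List.map_cons,
      List.prod_cons]
    ring

/-- Exchanging neighbours affects only the factor of that pair. -/
theorem exists_pairProd_swap (a b : ι) (l₁ l₂ : List ι) : ∃ U : Laurent ι,
    pairProd s t (l₁ ++ a :: b :: l₂) = U * factor s t a b ∧
      pairProd s t (l₁ ++ b :: a :: l₂) = U * factor s t b a := by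
  refine ⟨pairProd s t (l₁ ++ l₂) * (l₁.map fun l => factor s t l a).prod *
    (l₁.map fun l => factor s t l b).prod * (l₂.map (factor s t a)).prod *
    (l₂.map (factor s t b)).prod, ?_, ?_⟩ <;>
  · rw [pairProd_insert, pairProd_insert, List.map_cons, List.prod_cons]
    ring

end PairProd

theorem ofFn_eq_take_append {A : Type*} {N : ℕ} (f : Fin N → A) {k : ℕ} (hk : k + 1 < N) :
    List.ofFn f = (List.ofFn f).take k ++ f ⟨k, by omega⟩ :: f ⟨k + 1, hk⟩ ::
      (List.ofFn f).drop (k + 2) := by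
  conv_lhs => rw [← List.take_append_drop k (List.ofFn f)]
  rw [List.drop_eq_getElem_cons (by simpa using by omega),
    List.drop_eq_getElem_cons (by simpa using hk)]
  simp

theorem ofFn_swap_eq_take_append {A : Type*} {N : ℕ} (f : Fin N → A) {k : ℕ} (hk : k + 1 < N) :
    List.ofFn (fun i => f (Equiv.swap ⟨k, by omega⟩ ⟨k + 1, hk⟩ i)) =
      (List.ofFn f).take k ++ f ⟨k + 1, hk⟩ :: f ⟨k, by omega⟩ ::
        (List.ofFn f).drop (k + 2) := by
  rw [ofFn_eq_take_append _ hk, Equiv.swap_apply_left, Equiv.swap_apply_right]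
  congr 1
  · refine List.ext_getElem (by simp) fun i h1 h2 => ?_
    have : i < k := by simp at h1; omega
    rw [List.getElem_take, List.getElem_take, List.getElem_ofFn, List.getElem_ofFn,
      Equiv.swap_apply_of_ne_of_ne] <;> simp <;> omega
  · congr 2
    refine List.ext_getElem (by simp) fun i h1 h2 => ?_
    rw [List.getElem_drop, List.getElem_drop, List.getElem_ofFn, List.getElem_ofFn,
      Equiv.swap_apply_of_ne_of_ne] <;> simp <;> omega

theorem prod_map_take_ofFn {A M : Type*} [CommMonoid M] {N : ℕ} (f : Fin N → A) (g : A → M)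
    (y : ℕ → M) (h : ∀ i : Fin N, g (f i) = y i) {r : ℕ} (hr : r ≤ N) :
    (((List.ofFn f).take r).map g).prod = ∏ i ∈ Finset.range r, y i := by
  induction r with
  | zero => simp
  | succ r ih =>
    rw [List.take_succ_eq_append_getElem (by simpa using by omega), List.map_append,
      List.prod_append, ih (by omega), Finset.prod_range_succ]
    simp [h]

theorem prod_map_drop_ofFn {A M : Type*} [CommMonoid M] {N : ℕ} (f : Fin N → A) (g : A → M)
    (y : ℕ → M) (h : ∀ i : Fin N, g (f i) = y i) {r : ℕ} (hr : r ≤ N) :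
    (((List.ofFn f).drop r).map g).prod = ∏ i ∈ Finset.Ico r N, y i := by
  induction hr using Nat.decreasingInduction with
  | self => simp [List.drop_eq_nil_of_le]
  | of_succ r hr ih =>
    rw [List.drop_eq_getElem_cons (by simpa using by omega), List.map_cons, List.prod_cons, ih,
      Finset.prod_eq_prod_Ico_succ_bot hr]
    simp [h]

/-! ### Antisymmetrization over permutations and the Serre elements; the label `⊥` stands for the
variable `w`. -/

section Serre

variable {N : ℕ}

/-- The sign of the order of two labels. -/
def orderSign (i j : WithBot (Fin N)) : ℂ := if i < j then 1 else if j < i then -1 else 0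

theorem orderSign_antisymm (i j : WithBot (Fin N)) : orderSign i j = -orderSign j i := by
  rcases lt_trichotomy i j with h | h | h
  · simp [orderSign, h, h.not_gt]
  · simp [orderSign, h]
  · simp [orderSign, h, h.not_gt]

theorem orderSign_ne_zero (i j : WithBot (Fin N)) (h : i ≠ j) : orderSign i j ≠ 0 := by
  rcases lt_trichotomy i j with h' | h' | h'
  · simp [orderSign, h']
  · exact absurd h' h
  · simp [orderSign, h', h'.not_gt]

/-- The labels in the order given by a permutation. -/
def permList (σ : Equiv.Perm (Fin N)) : List (WithBot (Fin N)) :=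
  List.ofFn fun i => (σ i : WithBot (Fin N))

/-- The variables in the order given by a permutation. -/
def permVar (σ : Equiv.Perm (Fin N)) (i : ℕ) : Laurent (WithBot (Fin N)) :=
  if h : i < N then var (σ ⟨i, h⟩ : WithBot (Fin N)) else 0

/-- The antisymmetrization of functions of `N` variables. -/
def antisymmetrize (t : WithBot (Fin N) → WithBot (Fin N) → ℂ) :
    ((ℕ → Laurent (WithBot (Fin N))) → Laurent (WithBot (Fin N))) →ₗ[ℂ]
      Laurent (WithBot (Fin N)) where
  toFun F := ∑ σ : Equiv.Perm (Fin N),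
    pairProd orderSign t (permList σ).reverse * F (permVar σ)
  map_add' F G := by simp [mul_add, Finset.sum_add_distrib]
  map_smul' a F := by simp [Finset.smul_sum]

/-- The transposition of consecutive variables. -/
def swapHom {R : Type*} [CommRing R] (k : ℕ) : ((ℕ → R) → R) →+* ((ℕ → R) → R) where
  toFun F z := F fun i => z (Equiv.swap k (k + 1) i)
  map_one' := rfl
  map_mul' _ _ := rfl
  map_zero' := rfl
  map_add' _ _ := rfl

theorem permVar_mul_swap (σ : Equiv.Perm (Fin N)) {k : ℕ} (hk : k + 1 < N) :
    permVar (σ * Equiv.swap ⟨k, by omega⟩ ⟨k + 1, hk⟩) =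
      fun i => permVar σ (Equiv.swap k (k + 1) i) := by
  funext i
  rcases eq_or_ne i k with rfl | h1
  · simp [permVar, hk, show i < N by omega]
  rcases eq_or_ne i (k + 1) with rfl | h2
  · simp [permVar, hk, show k < N by omega]
  rw [Equiv.swap_apply_of_ne_of_ne h1 h2, permVar, permVar]
  split_ifs with h
  · rw [Equiv.Perm.mul_apply, Equiv.swap_apply_of_ne_of_ne (by simpa using h1) (by simpa using h2)]
  · rfl

/-- Permutations are paired by transposing positions `k` and `k + 1`. In `pairProd` these two
contribute `± (z_{σ k} - t₀ z_{σ (k+1)})`. Multiplied by `z_{σ (k+1)} - t₀ z_{σ k}` this gives an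
expression symmetric up to the sign, which `orderSign` reverses, so the two terms cancel. -/
theorem isTwisted_antisymmetrize {t : WithBot (Fin N) → WithBot (Fin N) → ℂ} {t₀ : ℂ}
    (ht : ∀ i j : Fin N, t i j = t₀) :
    IsTwisted (fun k (z : ℕ → Laurent (WithBot (Fin N))) => z k) swapHom t₀ N
      (antisymmetrize t) where
  map_other k i h1 h2 := by
    funext z
    simp [swapHom, Equiv.swap_apply_of_ne_of_ne h1 h2]
  twist k hk F hF := by
    have hk' : k < N := by omega
    rw [← sub_eq_zero, ← map_smul, ← map_sub]
    refine Finset.sum_involution (fun σ _ => σ * Equiv.swap ⟨k, hk'⟩ ⟨k + 1, hk⟩)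
      ?_ ?_ (fun _ _ => Finset.mem_univ _) (fun σ _ => by simp [mul_assoc])
    · intro σ _
      obtain ⟨U, h1, h2⟩ := exists_pairProd_swap orderSign t
        (σ ⟨k + 1, hk⟩ : WithBot (Fin N)) (σ ⟨k, hk'⟩ : WithBot (Fin N))
        ((permList σ).drop (k + 2)).reverse ((permList σ).take k).reverse
      have e1 : (permList σ).reverse = ((permList σ).drop (k + 2)).reverse ++
          (σ ⟨k + 1, hk⟩ : WithBot (Fin N)) :: (σ ⟨k, hk'⟩ : WithBot (Fin N)) ::
            ((permList σ).take k).reverse := by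
        conv_lhs => rw [permList, ofFn_eq_take_append _ hk]
        simp [permList]
      have e2 : (permList (σ * Equiv.swap ⟨k, hk'⟩ ⟨k + 1, hk⟩)).reverse =
          ((permList σ).drop (k + 2)).reverse ++
          (σ ⟨k, hk'⟩ : WithBot (Fin N)) :: (σ ⟨k + 1, hk⟩ : WithBot (Fin N)) ::
            ((permList σ).take k).reverse := by
        have := ofFn_swap_eq_take_append (fun i => (σ i : WithBot (Fin N))) hk
        simp only [permList, Equiv.Perm.mul_apply]
        rw [this]
        simp
      have e3 : F (permVar (σ * Equiv.swap ⟨k, hk'⟩ ⟨k + 1, hk⟩)) = F (permVar σ) := by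
        rw [permVar_mul_swap]
        exact congrFun hF (permVar σ)
      rw [e1, e2, h1, h2]
      simp only [Pi.sub_apply, Pi.mul_apply, Pi.smul_apply, e3]
      rw [permVar_mul_swap]
      simp only [Equiv.swap_apply_left, Equiv.swap_apply_right]
      rw [permVar, permVar, dif_pos hk, dif_pos hk']
      simp only [factor, ht, Algebra.smul_def]
      rw [orderSign_antisymm (σ ⟨k, _⟩ : WithBot (Fin N)), map_neg]
      ring
    · intro σ _ _ h
      have := congrArg (fun τ => τ ⟨k, hk'⟩) (mul_eq_left.1 h)
      simp at this

/-- After the reversal the labels in positions `r` and beyond precede `⊥`. Each of these `N - r`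
labels contributes `orderSign = -1`, since `⊥` is the smallest label; the labels following `⊥`
contribute `+1`. -/
theorem pairProd_permList_insert {t : WithBot (Fin N) → WithBot (Fin N) → ℂ} {s₀ : ℂ}
    (hs : ∀ i : Fin N, t i ⊥ = s₀ ∧ t ⊥ i = s₀) (σ : Equiv.Perm (Fin N)) {r : ℕ} (hr : r ≤ N) :
    pairProd orderSign t ((permList σ).take r ++ ⊥ :: (permList σ).drop r).reverse =
      (-1) ^ (N - r) * (pairProd orderSign t (permList σ).reverse *
        insertProd (fun k (z : ℕ → Laurent (WithBot (Fin N))) => z k) s₀ (fun _ => var ⊥) 0 N r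
          (permVar σ)) := by
  have h1 : (((permList σ).take r).map (factor orderSign t ⊥)).prod =
      ∏ i ∈ Finset.range r, (permVar σ i - s₀ • var ⊥) :=
    prod_map_take_ofFn _ _ _ (fun i => by
      rw [factor, (hs (σ i)).2, show orderSign ⊥ (σ i : WithBot (Fin N)) = 1 by simp [orderSign],
        map_one, one_mul, permVar, dif_pos i.2, Algebra.smul_def]) hr
  have h2 : (((permList σ).drop r).map (fun l => factor orderSign t l ⊥)).prod =
      ∏ i ∈ Finset.Ico r N, (-1) * (var ⊥ - s₀ • permVar σ i) :=
    prod_map_drop_ofFn _ _ _ (fun i => by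
      rw [factor, (hs (σ i)).1, show orderSign (σ i : WithBot (Fin N)) ⊥ = -1 by simp [orderSign],
        map_neg, map_one, permVar, dif_pos i.2, Algebra.smul_def]) hr
  rw [Finset.prod_mul_distrib, Finset.prod_const, Nat.card_Ico] at h2
  have h3 : (permList σ).reverse =
      ((permList σ).drop r).reverse ++ ((permList σ).take r).reverse := by
    rw [← List.reverse_append, List.take_append_drop]
  rw [List.reverse_append, List.reverse_cons, List.append_assoc, List.singleton_append,
    pairProd_insert, List.map_reverse, List.map_reverse, List.prod_reverse, List.prod_reverse, h1,
    h2, h3, insertProd]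
  simp only [Pi.mul_apply, Finset.prod_apply, Pi.sub_apply, Pi.smul_apply, zero_add]
  ring

theorem sum_pairProd_eq_zero {t : WithBot (Fin N) → WithBot (Fin N) → ℂ} {p s₀ : ℂ} (hp : p ≠ 0)
    (hN : N ≠ 0) (ht : ∀ i j : Fin N, t i j = p ^ 2) (hs : ∀ i : Fin N, t i ⊥ = s₀ ∧ t ⊥ i = s₀)
    (hsp : s₀ * p ^ N = p) :
    ∑ r ∈ Finset.range (N + 1), ∑ σ : Equiv.Perm (Fin N), ((-1) ^ r * qBinom p N r) •
      pairProd orderSign t ((permList σ).take r ++ ⊥ :: (permList σ).drop r).reverse = 0 := by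
  have h := (isTwisted_antisymmetrize ht).sum_qBinom_eq_zero hp hsp hN
    (w := fun _ => var ⊥) (fun _ => rfl) (fun _ _ _ => rfl)
  -- The sign `(-1)^r` of the Serre sum and the sign `(-1)^{N-r}` of `pairProd` combine to the
  -- global `(-1)^N`.
  have h1 := congrArg (fun y => ((-1) ^ N : ℂ) • y) h
  rw [smul_zero] at h1
  rw [← h1, Finset.smul_sum]
  refine Finset.sum_congr rfl fun r hr => ?_
  have hr : r ≤ N := by have := Finset.mem_range.1 hr; omega
  rw [antisymmetrize, LinearMap.coe_mk, AddHom.coe_mk, Finset.smul_sum, Finset.smul_sum]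
  refine Finset.sum_congr rfl fun σ _ => ?_
  rw [pairProd_permList_insert hs σ hr, smul_smul]
  have h2 : ((-1) ^ r * qBinom p N r : ℂ) • ((-1) ^ (N - r) : Laurent (WithBot (Fin N))) =
      algebraMap ℂ _ ((-1) ^ N * qBinom p N r) := by
    obtain ⟨m, rfl⟩ := Nat.exists_eq_add_of_le hr
    rw [Algebra.smul_def, Nat.add_sub_cancel_left, pow_add, map_mul, map_mul, map_mul, map_pow,
      map_pow, map_neg, map_one]
    ring
  rw [← smul_mul_assoc, h2, Algebra.smul_def]

variable {I : Type*} (D : Datum I)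

theorem word_append {ι : Type*} (c : ι → I) (l₁ l₂ : List ι) (m : ι → ℤ) :
    word D c (l₁ ++ l₂) m = word D c l₂ m * word D c l₁ m := by
  induction l₁ with
  | nil => simp [word]
  | cons j l ih => rw [List.cons_append, word, ih, word, mul_assoc]

theorem word_reverse {ι : Type*} (c : ι → I) (l : List ι) (m : ι → ℤ) :
    word D c l.reverse m = (l.map fun j => e D (c j) (m j)).prod := by
  induction l with
  | nil => rfl
  | cons j l ih => simp [word_append, ih, word, gen]

/-- The vanishing criterion applied to the orderings of `N` letters `α` and one letter `β`, all
weighted by the same monomial; its hypothesis is the symmetrization identity with `p = q_α` and `s =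
q^{(α,β)}`. -/
theorem form_serreElement {α β : I} (hα : D.a α α = 2) (hN : (N : ℤ) = 1 - D.a α β) (hN0 : N ≠ 0)
    (n : Fin N → ℤ) (m : ℤ) (z : UPlus D) :
    form D z (serreElement (D.qs α) (e D α) (e D β) N n m) = 0 := by
  set c : WithBot (Fin N) → I := fun i => WithBot.recBotCoe β (fun _ => α) i with hc
  set M : WithBot (Fin N) → ℤ := fun i => WithBot.recBotCoe m n i with hM
  have hq : D.qs α ≠ 0 := pow_ne_zero _ D.q_ne_zero
  have h1 : D.t α α = D.qs α ^ 2 := by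
    rw [Datum.t, Datum.form, Datum.qs, hα, zpow_mul, zpow_natCast]
    rfl
  -- Here `q^{(α,β)} = q_α^{a_{αβ}} = q_α^{1-N}`, the value at which the symmetrization constant
  -- vanishes.
  have h2 : D.t α β * D.qs α ^ N = D.qs α := by
    have h3 : D.t α β = D.qs α ^ D.a α β := by
      rw [Datum.t, Datum.form, Datum.qs, zpow_mul, zpow_natCast]
    rw [h3, ← zpow_natCast, hN, ← zpow_add₀ hq]
    simp
  have h4 := sum_pairProd_eq_zero (t := labelT D c) hq hN0 (fun _ _ => h1)
    (fun _ => ⟨rfl, D.t_symm β α⟩) h2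
  have hnd : (⊥ :: permList (1 : Equiv.Perm (Fin N))).Nodup := by
    refine List.nodup_cons.2 ⟨by simp [permList], List.nodup_ofFn.2 fun i j h => ?_⟩
    simpa using h
  have h5 := sum_wordForm_eq_zero D c orderSign_antisymm orderSign_ne_zero
    (Finset.range (N + 1) ×ˢ (Finset.univ : Finset (Equiv.Perm (Fin N)))) z hnd
    (fun x => ((permList x.2).take x.1 ++ ⊥ :: (permList x.2).drop x.1).reverse)
    (fun x => by
      refine (List.reverse_perm _).trans (List.perm_middle.trans (List.Perm.cons _ ?_))
      rw [List.take_append_drop]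
      exact Equiv.Perm.ofFn_comp_perm x.2 (fun i => (i : WithBot (Fin N))))
    (fun x => ((-1) ^ x.1 * qBinom (D.qs α) N x.1) • mono M)
    (by
      rw [Finset.sum_product]
      simp only [smul_mul_assoc, ← mul_smul_comm, ← Finset.mul_sum]
      rw [h4, mul_zero])
  rw [← h5, Finset.sum_product, serreElement, map_sum]
  refine Finset.sum_congr rfl fun r _ => ?_
  rw [map_smul, map_sum, Finset.smul_sum]
  refine Finset.sum_congr rfl fun σ _ => ?_
  rw [map_smul, wordForm_mono, word_reverse, List.map_append, List.map_cons, List.prod_append,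
    List.prod_cons, List.map_take, List.map_drop, permList, List.map_ofFn, mul_assoc]
  rfl

/-- Since `toPlus` is a morphism rather than an antimorphism, the order of the factors is kept and
the same parameter `p` serves both halves. -/
theorem toPlus_serreElement (p : ℂ) (α β : I) (n : Fin N → ℤ) (m : ℤ) :
    Minus.toPlus D (serreElement p (Minus.f D α) (Minus.f D β) N n m) =
      serreElement p (e D α) (e D β) N (fun i => -n i) (-m) := by
  simp only [serreElement, map_sum, map_smul, map_mul, map_list_prod, List.map_take, List.map_drop,
    List.map_ofFn, Function.comp_def, Minus.toPlus_f]

end Serre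

end QuantumCurrents

end

/-- The transposition in `hD` reconciles conventions: the entry of `cartanMatrix` at `β`, `α` is the
value of the coroot of `α` on the root `β`, that is `2(α,β)/(α,α)`. Besides the integrality and
symmetrizability recorded in `D`, the argument uses only that the diagonal entries are `2` and the
others are nonpositive, so that `N = 1 - a_{αβ}` is a positive integer. -/
theorem mainTheorem4 {L : Type*} [LieRing L] [LieAlgebra ℂ L] [FiniteDimensional ℂ L]
    [LieAlgebra.IsSimple ℂ L] (H : LieSubalgebra ℂ L) [H.IsCartanSubalgebra]
    (b : (LieAlgebra.IsKilling.rootSystem H).Base)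
    (D : QuantumCurrents.Datum b.support) (hD : ∀ α β, D.a α β = b.cartanMatrix β α) :
    ∃ φ : QuantumCurrents.UPlus D →ₗ[ℂ] QuantumCurrents.UMinus D →ₗ[ℂ] ℂ,
      (QuantumCurrents.IsHopfPairing φ ∧ QuantumCurrents.HasGeneratorValues φ) ∧
      (∀ ψ : QuantumCurrents.UPlus D →ₗ[ℂ] QuantumCurrents.UMinus D →ₗ[ℂ] ℂ,
        QuantumCurrents.IsHopfPairing ψ → QuantumCurrents.HasGeneratorValues ψ → ψ = φ) ∧
      (QuantumCurrents.serreIdealPlus D : Set (QuantumCurrents.UPlus D)) ⊆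
        QuantumCurrents.radicalPlus φ ∧
      (QuantumCurrents.serreIdealMinus D : Set (QuantumCurrents.UMinus D)) ⊆
        QuantumCurrents.radicalMinus φ := by
  have h2 : ∀ α, D.a α α = 2 := fun α => by rw [hD, b.cartanMatrix_apply_same]
  have hle : ∀ α β, α ≠ β → D.a α β ≤ 0 := fun α β h => by
    rw [hD]
    exact b.cartanMatrix_le_zero_of_ne β α h.symm
  have hform : ∀ α β, α ≠ β → ∀ (n : Fin (1 - D.a α β).toNat → ℤ) (m : ℤ) z,
      QuantumCurrents.Plus.form D (QuantumCurrents.serreElement (D.qs α) (QuantumCurrents.Plus.e D α)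
        (QuantumCurrents.Plus.e D β) (1 - D.a α β).toNat n m) z = 0 := fun α β h n m z => by
    have := hle α β h
    rw [QuantumCurrents.Plus.form_symm]
    exact QuantumCurrents.form_serreElement D (h2 α) (by omega) (by omega) n m z
  refine ⟨QuantumCurrents.pairing D,
    ⟨QuantumCurrents.isHopfPairing_pairing D, QuantumCurrents.hasGeneratorValues_pairing D⟩,
    fun ψ h g => h.unique g (QuantumCurrents.isHopfPairing_pairing D)
      (QuantumCurrents.hasGeneratorValues_pairing D), fun x hx y => ?_, fun y hy x => ?_⟩
  · refine QuantumCurrents.form_eq_zero_of_mem_span ?_ hx _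
    rintro x ⟨α, β, h, n, m, rfl⟩
    exact hform α β h n m
  · rw [QuantumCurrents.pairing_apply, QuantumCurrents.Plus.form_symm]
    refine QuantumCurrents.form_toPlus_eq_zero_of_mem_span ?_ hy _
    rintro y ⟨α, β, h, n, m, rfl⟩
    rw [QuantumCurrents.toPlus_serreElement]
    exact hform α β h _ _
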